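/- \textbf{Setting.} Let $\mathcal S\subset\mathbb R^3$ be a connected compact set (a rigid body with its centre of mass at the origin) such that $\Omega=\mathbb R^3\setminus\mathcal S$ is connected with $C^\infty$ boundary; $\nu$ is the unit normal on $\partial\Omega$ pointing out of $\Omega$. Let $\rho\ge 0$ be an integrable density on $\mathcal S$ with $\int_{\mathcal S}\rho=|\mathcal S|$, and put $m_0=\int_{\mathcal S}\rho$, $J_0=\int_{\mathcal S}\rho(y)(|y|^2 Id-yy^*)\,dy$. Let $m\ge1$ and $\chi_1,\dots,\chi_m\in C^\infty(\partial\Omega)$ with $\int_{\partial\Omega}\chi_j\,d\sigma=0$. Let $\phi_i,\varphi_i$ ($1\le i\le 3$), $\psi_j$ ($1\le j\le m$) be functions, smooth up to the boundary and harmonic in $\Omega$, whose gradients are in $L^2(\Omega)$ and tend to $0$ at infinity, with $\partial_\nu\phi_i=\nu_i$, $\partial_\nu\varphi_i=(y\times\nu)_i$, $\partial_\nu\psi_j=\chi_j$ on $\partial\Omega$. Define $$M_{ij}=\int_\Omega\nabla\phi_i\cdot\nabla\phi_j,\quad J_{ij}=\int_\Omega\nabla\varphi_i\cdot\nabla\varphi_j,\quad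 N_{ij}=\int_\Omega\nabla\phi_i\cdot\nabla\varphi_j,\quad C^M_{ij}=\int_\Omega\nabla\phi_i\cdot\nabla\psi_j,\quad C^J_{ij}=\int_\Omega\nabla\varphi_i\cdot\nabla\psi_j,$$ $$(L^M_p)_{ij}=\int_{\partial\Omega}(\nabla\phi_j)_i\chi_p,\quad (R^M_p)_{ij}=\int_{\partial\Omega}(\nabla\varphi_j)_i\chi_p,\quad (W^M_p)_{ij}=\int_{\partial\Omega}(\nabla\psi_j)_i\chi_p,$$ and $L^J_p,R^J_p,W^J_p$ in the same way with $y\times\nabla\phi_j$, $y\times\nabla\varphi_j$, $y\times\nabla\psi_j$ in place of the gradients. Let $S(y)$ be the matrix of $x\mapsto y\times x$ and $$\mathcal J=\begin{pmatrix}m_0Id+M&N\\N^*&J_0+J\end{pmatrix},\qquad C=-\begin{pmatrix}C^M\\C^J\end{pmatrix},$$ $$F(l,r,w)=-\begin{pmatrix}S(r)&0\\S(l)&S(r)\end{pmatrix}\Big(\mathcal J\begin{pmatrix}l\\r\end{pmatrix}-Cw\Big)-\sum_{p=1}^m w_p\begin{pmatrix}L^M_pl+R^M_pr+W^M_pw\\L^J_pl+R^J_pr+W^J_pw\end{pmatrix}.$$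 The control system, with state $(h,\vec q,l,r)\in\mathbb R^{12}$, $\|\vec q\|<1$, and control $w\in\mathbb R^m$, is $$(\ast)\quad\begin{cases}h'=(1-\|\vec q\|^2)\,l+2\sqrt{1-\|\vec q\|^2}\;\vec q\times l+(l\cdot\vec q)\,\vec q-(\vec q\times l)\times\vec q,\\ \vec q\,'=\tfrac12\big(\sqrt{1-\|\vec q\|^2}\;r+\vec q\times r\big),\\ (l,r)'=\mathcal J^{-1}\big(Cw'+F(l,r,w)\big).\end{cases}$$ Put $\alpha=-\frac{(C^M)_{11}}{m_0+M_{11}}$, $\beta=-\frac{(L^M_1)_{11}}{m_0+M_{11}}$, $\gamma=-\frac{(W^M_1)_{11}}{m_0+M_{11}}$. Assume that $\Omega$ and $\chi_1$ are invariant under the reflections $y_p\mapsto -y_p$, $p=2,3$, and that $\alpha\ne0$. \textbf{Constant matrices.} Let $\mathbf A\in\mathbb R^{6\times6}$ be the matrix whose only possibly nonzero entries are $\mathbf A_{ii}=-(L_1^M)_{ii}$ ($i=1,2,3$), $\mathbf A_{53}=\alpha(M_{33}-M_{11})-(L^J_1)_{23}-(C^M)_{11}$, $\mathbf A_{62}=\alpha(M_{11}-M_{22})-(L_1^J)_{32}+(C^M)_{11}$,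 $\mathbf A_{26}=-(R_1^M)_{23}$, $\mathbf A_{35}=-(R^M_1)_{32}$, $\mathbf A_{44}=-(R^J_1)_{11}$, $\mathbf A_{55}=\alpha N_{32}-(R^J_1)_{22}$, $\mathbf A_{66}=-\alpha N_{23}-(R_1^J)_{33}$. Let $\mathbf B\in\mathbb R^{6\times m}$ be the matrix with columns $$\mathbf Be_p=\begin{pmatrix}0\\-\alpha S(e_1)C^Me_p\end{pmatrix}-\alpha\begin{pmatrix}L^M_pe_1\\L^J_pe_1\end{pmatrix}-\begin{pmatrix}W^M_1e_p\\W^J_1e_p\end{pmatrix}-\begin{pmatrix}W^M_pe_1\\W^J_pe_1\end{pmatrix},\qquad \mathbf D=\begin{pmatrix}0&-\alpha S(e_1)\\0&0\end{pmatrix}.$$ \textbf{Reference trajectory and rank condition.} For $T>0$, $\lambda\neq0$ and $\xi\in C^\infty(\mathbb R;[0,1])$ with $\xi=0$ on $t<T/3$ and $\xi=1$ on $t>2T/3$, let $\bar l_1=\frac{d}{dt}\big(\lambda\xi(t)(t-T)^2\big)$ and let $\bar w_1$ solve $\bar w_1'=\alpha^{-1}(\bar l_1'-\beta\bar l_1\bar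 w_1-\gamma\bar w_1^2)$, $\bar w_1(0)=0$ on $[0,T]$. Let $A(t)$ and $B(t)$ be the Jacobian matrices of $F$ with respect to $(l,r)$ and to $w$ at $l=\bar l_1(t)e_1$, $r=0$, $w=\bar w_1(t)e_1$, and let $$\mathcal A=\begin{pmatrix}D&Id\\0&\mathcal J^{-1}A\end{pmatrix},\quad D=\begin{pmatrix}0&-S(\bar l_1e_1)\\0&0\end{pmatrix},\quad \mathcal B=\begin{pmatrix}0\\\mathcal J^{-1}B\end{pmatrix},\quad\mathcal C=\begin{pmatrix}0\\\mathcal J^{-1}C\end{pmatrix},$$ $\mathcal M_0=\mathcal B+\mathcal A\mathcal C$, $\mathcal M_i=\mathcal M_{i-1}'-\mathcal A\mathcal M_{i-1}$. The rank condition is $$(\mathrm{R})\qquad \operatorname{rank}(\mathcal C,\mathcal M_0(T),\mathcal M_1(T),\mathcal M_2(T),\dots)=12.$$ \textbf{Statement.} If $$\operatorname{rank}(C,\ \mathbf B+\mathbf A\mathcal J^{-1}C)=6\quad\text{and}\quad\operatorname{rank}\big(C,\ \tfrac12\mathcal J\mathbf D\mathcal J^{-1}C+\mathbf B+\mathbf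 A\mathcal J^{-1}C\big)=6,$$ then for every $T>0$: (i) for every $\xi$ as above there is $\lambda_0>0$ such that for every $\lambda\ne0$ with $|\lambda|\le\lambda_0$ (and for every $\lambda\neq0$ if $\gamma+\alpha\beta=0$) the solution $\bar w_1$ exists on $[0,T]$ and $(\mathrm R)$ holds; (ii) $(\ast)$ is locally controllable around the origin in time $T$, with controls $w\in H^2(0,T;\mathbb R^m)$ satisfying $w(0)=0$: there is $\eta>0$ such that any two states of norm less than $\eta$ can be joined in time $T$ by such a control; (iii) for some $\eta>0$ there is a $C^1$ map from the ball $B_{\mathbb R^{24}}(0,\eta)$ to $H^2(0,T;\mathbb R^m)$ which associates with $(h_0,\vec q_0,l_0,r_0,h_T,\vec q_T,l_T,r_T)$ a control $w$ with $w(0)=0$ that steers $(\ast)$ from $(h_0,\vec q_0,l_0,r_0)$ at $t=0$ to $(h_T,\vec q_T,l_T,r_T)$ at $t=T$. -/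

import Mathlib

open MeasureTheory Set Filter Topology
open scoped ContDiff Matrix Gradient

noncomputable section

namespace Underwater

/-- Physical space. -/
abbrev E3 : Type := EuclideanSpace ℝ (Fin 3)

/-- Index set of the velocities: linear velocity, then angular velocity. -/
abbrev I6 : Type := Fin 3 ⊕ Fin 3

/-- The matrix of the map `x ↦ y × x`. -/
def skew (y : Fin 3 → ℝ) : Matrix (Fin 3) (Fin 3) ℝ :=
  !![0, -y 2, y 1; y 2, 0, -y 0; -y 1, y 0, 0]

/-- The first vector of the canonical basis. -/
def e1 : Fin 3 → ℝ := ![1, 0, 0]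

/-- Cross product of two points of physical space. -/
def cross (a b : E3) : E3 := WithLp.toLp 2 (crossProduct (WithLp.ofLp a) (WithLp.ofLp b))

/-- The reflection through the plane orthogonal to the axis `p`. -/
def reflect (p : Fin 3) (y : E3) : E3 :=
  WithLp.toLp 2 fun i => if i = p then -y i else y i

/-! ### The exterior Neumann problem -/

/-- Unit normal on the boundary of `{0 < bdf}`, pointing out of that set. -/
def outwardNormal (bdf : E3 → ℝ) (y : E3) : E3 := -(‖∇ bdf y‖⁻¹ • ∇ bdf y)

/-- `u` is a potential of the exterior domain `Ω = {0 < bdf}` with Neumann data `g`: it is smooth up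
to the boundary (the restriction to the closure of `Ω` of a smooth function on the space), harmonic
in `Ω`, with normal derivative `g` on the boundary, and its gradient is square integrable on `Ω`
and vanishes at infinity. -/
structure IsPotential (Ω : Set E3) (bdf : E3 → ℝ) (g : E3 → ℝ) (u : E3 → ℝ) : Prop where
  smooth : ContDiff ℝ ∞ u
  harmonic : InnerProductSpace.HarmonicOnNhd u Ω
  neumann : ∀ y ∈ frontier Ω, inner ℝ (∇ u y) (outwardNormal bdf y) = g y
  decay : Tendsto (∇ u) (cocompact E3) (𝓝 0)
  finite_energy : MemLp (∇ u) 2 (volume.restrict Ω)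

/-! ### The vehicle -/

/-- A neutrally buoyant rigid body in an infinite volume of fluid, with `m` flow controls, and the
potentials that it generates. The centre of mass is at the origin. -/
structure Vehicle (m : ℕ) where
  /-- the region occupied by the rigid body -/
  solid : Set E3
  /-- a smooth function that is positive exactly in the fluid, with nonzero gradient on its zero
  set; for a compact body this says that the fluid domain is smooth -/
  bdf : E3 → ℝ
  /-- the density of the body -/
  density : E3 → ℝ
  /-- the profiles of the flow controls (only their values on the boundary matter) -/
  χ : Fin m → E3 → ℝ
  /-- potentials of the translations -/
  φ : Fin 3 → E3 → ℝ
  /-- potentials of the rotations -/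
  φr : Fin 3 → E3 → ℝ
  /-- potentials of the controls -/
  ψ : Fin m → E3 → ℝ
  solid_compact : IsCompact solid
  solid_connected : IsConnected solid
  fluid_connected : IsConnected solidᶜ
  bdf_smooth : ContDiff ℝ ∞ bdf
  fluid_eq : solidᶜ = {y | 0 < bdf y}
  bdf_regular : ∀ y, bdf y = 0 → ∇ bdf y ≠ 0
  density_nonneg : ∀ y ∈ solid, 0 ≤ density y
  density_integrable : IntegrableOn density solid
  buoyancy : ∫ y in solid, density y = ∫ _y in solid, (1 : ℝ)
  center_of_mass : ∫ y in solid, density y • y = 0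
  χ_smooth : ∀ j, ContDiff ℝ ∞ (χ j)
  χ_mean : ∀ j, ∫ y in frontier solidᶜ, χ j y ∂μHE[2] = 0
  φ_spec : ∀ i, IsPotential solidᶜ bdf (fun y => outwardNormal bdf y i) (φ i)
  φr_spec : ∀ i, IsPotential solidᶜ bdf (fun y => cross y (outwardNormal bdf y) i) (φr i)
  ψ_spec : ∀ j, IsPotential solidᶜ bdf (χ j) (ψ j)

namespace Vehicle

variable {m : ℕ} (V : Vehicle m)

/-- The fluid domain. -/
def fluid : Set E3 := V.solidᶜ

/-- Integral over the boundary of the fluid domain, for the surface measure. -/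
def bint (f : E3 → ℝ) : ℝ := ∫ y in frontier V.fluid, f y ∂μHE[2]

/-- The mass of the body. -/
def m0 : ℝ := ∫ y in V.solid, V.density y

/-- The inertia matrix of the body. -/
def J0 : Matrix (Fin 3) (Fin 3) ℝ := Matrix.of fun i j =>
  ∫ y in V.solid, V.density y * ((if i = j then ‖y‖ ^ 2 else 0) - y i * y j)

def M : Matrix (Fin 3) (Fin 3) ℝ := Matrix.of fun i j =>
  ∫ y in V.fluid, inner ℝ (∇ (V.φ i) y) (∇ (V.φ j) y)

def J : Matrix (Fin 3) (Fin 3) ℝ := Matrix.of fun i j =>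
  ∫ y in V.fluid, inner ℝ (∇ (V.φr i) y) (∇ (V.φr j) y)

def N : Matrix (Fin 3) (Fin 3) ℝ := Matrix.of fun i j =>
  ∫ y in V.fluid, inner ℝ (∇ (V.φ i) y) (∇ (V.φr j) y)

def CM : Matrix (Fin 3) (Fin m) ℝ := Matrix.of fun i j =>
  ∫ y in V.fluid, inner ℝ (∇ (V.φ i) y) (∇ (V.ψ j) y)

def CJ : Matrix (Fin 3) (Fin m) ℝ := Matrix.of fun i j =>
  ∫ y in V.fluid, inner ℝ (∇ (V.φr i) y) (∇ (V.ψ j) y)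

def LM (p : Fin m) : Matrix (Fin 3) (Fin 3) ℝ := Matrix.of fun i j =>
  V.bint fun y => ∇ (V.φ j) y i * V.χ p y

def LJ (p : Fin m) : Matrix (Fin 3) (Fin 3) ℝ := Matrix.of fun i j =>
  V.bint fun y => cross y (∇ (V.φ j) y) i * V.χ p y

def RM (p : Fin m) : Matrix (Fin 3) (Fin 3) ℝ := Matrix.of fun i j =>
  V.bint fun y => ∇ (V.φr j) y i * V.χ p y

def RJ (p : Fin m) : Matrix (Fin 3) (Fin 3) ℝ := Matrix.of fun i j =>
  V.bint fun y => cross y (∇ (V.φr j) y) i * V.χ p y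

def WM (p : Fin m) : Matrix (Fin 3) (Fin m) ℝ := Matrix.of fun i j =>
  V.bint fun y => ∇ (V.ψ j) y i * V.χ p y

def WJ (p : Fin m) : Matrix (Fin 3) (Fin m) ℝ := Matrix.of fun i j =>
  V.bint fun y => cross y (∇ (V.ψ j) y) i * V.χ p y

/-- The total inertia matrix (body and added mass). -/
def JJ : Matrix I6 I6 ℝ :=
  Matrix.fromBlocks (V.m0 • (1 : Matrix (Fin 3) (Fin 3) ℝ)) 0 0 V.J0 +
    Matrix.fromBlocks V.M V.N V.Nᵀ V.J

/-- The matrix in front of the derivative of the control. -/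
def C : Matrix I6 (Fin m) ℝ := -(Matrix.fromRows V.CM V.CJ)

/-- The nonlinearity, as a function of the velocity `v = (l, r)` and of the control `w`. -/
def F (v : I6 → ℝ) (w : Fin m → ℝ) : I6 → ℝ :=
  let l : Fin 3 → ℝ := fun i => v (Sum.inl i)
  let r : Fin 3 → ℝ := fun i => v (Sum.inr i);
  -(Matrix.fromBlocks (skew r) 0 (skew l) (skew r) *ᵥ (V.JJ *ᵥ v - V.C *ᵥ w)) -
    ∑ p, w p • Sum.elim (V.LM p *ᵥ l + V.RM p *ᵥ r + V.WM p *ᵥ w)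
      (V.LJ p *ᵥ l + V.RJ p *ᵥ r + V.WJ p *ᵥ w)

end Vehicle

/-! ### The control system -/

/-- The states `(h, q, l, r)`: position, vector part of the unit quaternion that gives the attitude,
linear and angular velocity in the frame of the body. -/
abbrev State : Type := (Fin 3 → ℝ) × (Fin 3 → ℝ) × (Fin 3 → ℝ) × (Fin 3 → ℝ)

/-- The right-hand side of the control system at state `x`, control `w`, derivative `w'` of the
control. -/
def Vehicle.field {m : ℕ} (V : Vehicle m) (x : State) (w w' : Fin m → ℝ) : State :=
  let q : Fin 3 → ℝ := x.2.1
  let l : Fin 3 → ℝ := x.2.2.1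
  let r : Fin 3 → ℝ := x.2.2.2
  let q0 : ℝ := Real.sqrt (1 - q ⬝ᵥ q)
  let a : I6 → ℝ := V.JJ⁻¹ *ᵥ (V.C *ᵥ w' + V.F (Sum.elim l r) w)
  ((1 - q ⬝ᵥ q) • l + (2 * q0) • crossProduct q l + (l ⬝ᵥ q) • q
      - crossProduct (crossProduct q l) q,
    (1 / 2 : ℝ) • (q0 • r + crossProduct q r),
    fun i => a (Sum.inl i),
    fun i => a (Sum.inr i))

/-- `x` solves the control system on `[0, T]` with the `C¹` control `w`, and its attitude stays in
the chart in which the quaternion has positive real part. -/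
def Vehicle.IsTrajectory {m : ℕ} (V : Vehicle m) (T : ℝ) (w : ℝ → Fin m → ℝ) (x : ℝ → State) :
    Prop :=
  ∀ t ∈ Icc 0 T, (x t).2.1 ⬝ᵥ (x t).2.1 < 1 ∧
    HasDerivWithinAt x (V.field (x t) (w t) (derivWithin w (Icc 0 T) t)) (Icc 0 T) t

/-! ### The Sobolev space of the controls -/

/-- `g` is the weak derivative of `f` on `(0, T)`. -/
def IsWeakDeriv {m : ℕ} (T : ℝ) (f g : ℝ → EuclideanSpace ℝ (Fin m)) : Prop :=
  ∀ θ : ℝ → ℝ, ContDiff ℝ ∞ θ → HasCompactSupport θ → tsupport θ ⊆ Ioo 0 T →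
    ∫ t in Ioo 0 T, deriv θ t • f t = -∫ t in Ioo 0 T, θ t • g t

/-- `L²(0, T; ℝᵐ)`. -/
abbrev L2 (T : ℝ) (m : ℕ) : Type :=
  Lp (EuclideanSpace ℝ (Fin m)) 2 (volume.restrict (Ioo 0 T))

theorem integrable_smul_of_L2 {m : ℕ} {T : ℝ} {θ : ℝ → ℝ} (h : Continuous θ)
    (hc : HasCompactSupport θ) (f : L2 T m) :
    Integrable (fun t => θ t • f t) (volume.restrict (Ioo 0 T)) := by
  have hf : Integrable f (volume.restrict (Ioo 0 T)) := (Lp.memLp f).integrable one_le_two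
  obtain ⟨K, hK⟩ := h.bounded_above_of_compact_support hc
  exact hf.bdd_smul K h.aestronglyMeasurable (ae_of_all _ hK)

/-- The Sobolev space `H²(0, T; ℝᵐ)`, as the space of triples `(u, u', u'')` in `L²` in which
each term is the weak derivative of the previous one, with the Hilbert norm
`(‖u‖² + ‖u'‖² + ‖u''‖²)^(1/2)`. -/
def H2 (T : ℝ) (m : ℕ) : Submodule ℝ (PiLp 2 fun _ : Fin 3 => L2 T m) where
  carrier := {u | IsWeakDeriv T (u 0) (u 1) ∧ IsWeakDeriv T (u 1) (u 2)}
  zero_mem' := by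
    have h : IsWeakDeriv T ((0 : L2 T m) : ℝ → _) ((0 : L2 T m) : ℝ → _) := by
      intro θ _ _ _
      have h0 := Lp.coeFn_zero (EuclideanSpace ℝ (Fin m)) 2 (volume.restrict (Ioo 0 T))
      rw [integral_eq_zero_of_ae, integral_eq_zero_of_ae, neg_zero]
      · filter_upwards [h0] with t ht
        rw [ht]; simp
      · filter_upwards [h0] with t ht
        rw [ht]; simp
    exact ⟨h, h⟩
  add_mem' := by
    have h : ∀ f g f' g' : L2 T m, IsWeakDeriv T f g → IsWeakDeriv T f' g' →
        IsWeakDeriv T (f + f' : L2 T m) (g + g' : L2 T m) := by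
      intro f g f' g' h1 h2 θ hθ hc hs
      have key : ∀ (η : ℝ → ℝ), Continuous η → HasCompactSupport η → ∀ a b : L2 T m,
          ∫ t in Ioo 0 T, η t • (a + b : L2 T m) t =
            (∫ t in Ioo 0 T, η t • a t) + ∫ t in Ioo 0 T, η t • b t := by
        intro η hη hηc a b
        rw [← integral_add (integrable_smul_of_L2 hη hηc a) (integrable_smul_of_L2 hη hηc b)]
        refine integral_congr_ae ?_
        filter_upwards [Lp.coeFn_add a b] with t ht
        rw [ht, Pi.add_apply, smul_add]
      rw [key _ (hθ.continuous_deriv (by simp)) hc.deriv, key _ hθ.continuous hc,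
        h1 θ hθ hc hs, h2 θ hθ hc hs, neg_add]
    intro a b ha hb
    exact ⟨h _ _ _ _ ha.1 hb.1, h _ _ _ _ ha.2 hb.2⟩
  smul_mem' := by
    have h : ∀ (c : ℝ) (f g : L2 T m), IsWeakDeriv T f g →
        IsWeakDeriv T (c • f : L2 T m) (c • g : L2 T m) := by
      intro c f g h1 θ hθ hc hs
      have key : ∀ (η : ℝ → ℝ) (a : L2 T m),
          ∫ t in Ioo 0 T, η t • (c • a : L2 T m) t = c • ∫ t in Ioo 0 T, η t • a t := by
        intro η a
        rw [← integral_smul]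
        refine integral_congr_ae ?_
        filter_upwards [Lp.coeFn_smul c a] with t ht
        rw [ht, Pi.smul_apply, smul_comm]
      rw [key, key, h1 θ hθ hc hs, smul_neg]
    intro c a ha
    exact ⟨h _ _ _ ha.1, h _ _ _ ha.2⟩

/-- `w` is the `C¹` representative on `[0, T]` of the class `u` in `H²(0, T; ℝᵐ)`. -/
def IsRepresentative {m : ℕ} (T : ℝ) (u : H2 T m) (w : ℝ → Fin m → ℝ) : Prop :=
  ContDiffOn ℝ 1 w (Icc 0 T) ∧
    ∀ᵐ t ∂(volume.restrict (Ioo 0 T)), u.1 0 t = WithLp.toLp 2 (w t)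

/-- The control `u`, with representative vanishing at time `0`, steers the state `x₀` at time `0`
to the state `x₁` at time `T`. -/
def Vehicle.Steers {m : ℕ} (V : Vehicle m) (T : ℝ) (u : H2 T m) (x₀ x₁ : State) : Prop :=
  ∃ w : ℝ → Fin m → ℝ, IsRepresentative T u w ∧ w 0 = 0 ∧
    ∃ x : ℝ → State, V.IsTrajectory T w x ∧ x 0 = x₀ ∧ x T = x₁

/-- Local controllability around the origin in time `T`, with controls in `H²` that vanish at
time `0`. -/
def Vehicle.LocallyControllable {m : ℕ} (V : Vehicle m) (T : ℝ) : Prop :=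
  ∃ η > 0, ∀ x₀ x₁ : State, ‖x₀‖ < η → ‖x₁‖ < η → ∃ u : H2 T m, V.Steers T u x₀ x₁

/-- For some `η > 0` there is a `C¹` map from the ball of radius `η` of `ℝ²⁴` to `H²` which
associates with each pair of states a control that steers the first one to the second one. (The
ball is for the sup norm; all norms of `ℝ²⁴` being equivalent, this does not matter.) -/
def Vehicle.HasC1Steering {m : ℕ} (V : Vehicle m) (T : ℝ) : Prop :=
  ∃ η > 0, ∃ Φ : State × State → H2 T m, ContDiffOn ℝ 1 Φ (Metric.ball 0 η) ∧
    ∀ x ∈ Metric.ball (0 : State × State) η, V.Steers T (Φ x) x.1 x.2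

/-! ### The reference trajectory and the linearized system -/

/-- A smooth cut-off function with values in `[0, 1]`, which is `0` before `T / 3` and `1` after
`2 T / 3`. -/
def IsCutoff (T : ℝ) (ξ : ℝ → ℝ) : Prop :=
  ContDiff ℝ ∞ ξ ∧ (∀ t, ξ t ∈ Icc (0 : ℝ) 1) ∧ (∀ t < T / 3, ξ t = 0) ∧ ∀ t > 2 * T / 3, ξ t = 1

/-- First coordinate of the reference position. -/
def hbar (T : ℝ) (ξ : ℝ → ℝ) (lam : ℝ) (t : ℝ) : ℝ := lam * ξ t * (t - T) ^ 2

/-- First coordinate of the reference velocity. -/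
def lbar (T : ℝ) (ξ : ℝ → ℝ) (lam : ℝ) : ℝ → ℝ := deriv (hbar T ξ lam)

namespace Vehicle

variable {m : ℕ} [NeZero m] (V : Vehicle m)

def α : ℝ := -V.CM 0 0 / (V.m0 + V.M 0 0)

def β : ℝ := -V.LM 0 0 0 / (V.m0 + V.M 0 0)

def γ : ℝ := -V.WM 0 0 0 / (V.m0 + V.M 0 0)

/-- `w` is, on `[0, T]`, the first component of the reference control. -/
def IsReferenceControl (T : ℝ) (ξ : ℝ → ℝ) (lam : ℝ) (w : ℝ → ℝ) : Prop :=
  w 0 = 0 ∧ ∀ t ∈ Icc 0 T,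
    HasDerivWithinAt w
      (V.α⁻¹ * (deriv (lbar T ξ lam) t - V.β * lbar T ξ lam t * w t - V.γ * w t ^ 2)) (Icc 0 T) t

/-- The velocity `(l e₁, 0)`. -/
def refVelocity (l : ℝ) : I6 → ℝ := Sum.elim (l • e1) 0

/-- The control `(w, 0, …, 0)`. -/
def refControl (w : ℝ) : Fin m → ℝ := Pi.single 0 w

/-- Jacobian matrix of `F` with respect to the velocity, at `(l e₁, 0)` and `(w, 0, …, 0)`. -/
def linA (l w : ℝ) : Matrix I6 I6 ℝ :=
  LinearMap.toMatrix' (fderiv ℝ (fun v => V.F v (refControl w)) (refVelocity l)).toLinearMap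

/-- Jacobian matrix of `F` with respect to the control, at `(l e₁, 0)` and `(w, 0, …, 0)`. -/
def linB (l w : ℝ) : Matrix I6 (Fin m) ℝ :=
  LinearMap.toMatrix' (fderiv ℝ (fun u => V.F (refVelocity l) u) (refControl w)).toLinearMap

/-- The matrix `D` of the linearized kinematics. -/
def linD (l : ℝ) : Matrix I6 I6 ℝ := Matrix.fromBlocks 0 (-skew (l • e1)) 0 0

/-- The linearized system is `x' = calA x + calB f + calC f'`. -/
def calA (l w : ℝ) : Matrix (I6 ⊕ I6) (I6 ⊕ I6) ℝ :=
  Matrix.fromBlocks (linD l) 1 0 (V.JJ⁻¹ * V.linA l w)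

def calB (l w : ℝ) : Matrix (I6 ⊕ I6) (Fin m) ℝ := Matrix.fromRows 0 (V.JJ⁻¹ * V.linB l w)

def calC : Matrix (I6 ⊕ I6) (Fin m) ℝ := Matrix.fromRows 0 (V.JJ⁻¹ * V.C)

/-- The matrices `ℳ₀ = 𝓑 + 𝓐 𝓒` and `ℳᵢ₊₁ = ℳᵢ' - 𝓐 ℳᵢ` along the trajectory given by `l` and `w`;
derivatives are taken entrywise on `[0, T]`. -/
def calM (T : ℝ) (l w : ℝ → ℝ) : ℕ → ℝ → Matrix (I6 ⊕ I6) (Fin m) ℝ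
  | 0, t => V.calB (l t) (w t) + V.calA (l t) (w t) * V.calC
  | i + 1, t =>
      (Matrix.of fun a b => derivWithin (fun s => calM T l w i s a b) (Icc 0 T) t) -
        V.calA (l t) (w t) * calM T l w i t

/-- The rank condition `rank (𝓒, ℳ₀(T), ℳ₁(T), ℳ₂(T), …) = 12`: the rank is the dimension of the
span of all the columns. -/
def RankCondition (T : ℝ) (l w : ℝ → ℝ) : Prop :=
  Module.finrank ℝ ↥(LinearMap.range V.calC.mulVecLin ⊔
    ⨆ i : ℕ, LinearMap.range (V.calM T l w i T).mulVecLin) = 12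

/-! ### The constant matrices of the two rank hypotheses -/

def boldAL : Matrix I6 (Fin 3) ℝ :=
  Matrix.fromRows
    !![-V.LM 0 0 0, 0, 0;
       0, -V.LM 0 1 1, 0;
       0, 0, -V.LM 0 2 2]
    !![0, 0, 0;
       0, 0, V.α * (V.M 2 2 - V.M 0 0) - (V.LJ 0 1 2 + V.CM 0 0);
       0, V.α * (V.M 0 0 - V.M 1 1) - (V.LJ 0 2 1 - V.CM 0 0), 0]

def boldAR : Matrix I6 (Fin 3) ℝ :=
  Matrix.fromRows
    !![0, 0, 0;
       0, 0, -V.RM 0 1 2;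
       0, -V.RM 0 2 1, 0]
    !![-V.RJ 0 0 0, 0, 0;
       0, V.α * V.N 2 1 - V.RJ 0 1 1, 0;
       0, 0, -V.α * V.N 1 2 - V.RJ 0 2 2]

def boldA : Matrix I6 I6 ℝ := Matrix.fromCols V.boldAL V.boldAR

def boldB : Matrix I6 (Fin m) ℝ :=
  Matrix.fromRows 0 (-V.α • (skew e1 * V.CM))
    - V.α • Matrix.fromRows (Matrix.of fun i p => (V.LM p *ᵥ e1) i)
        (Matrix.of fun i p => (V.LJ p *ᵥ e1) i)
    - Matrix.fromRows (V.WM 0) (V.WJ 0)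
    - Matrix.fromRows (Matrix.of fun i p => V.WM p i 0) (Matrix.of fun i p => V.WJ p i 0)

def boldD : Matrix I6 I6 ℝ := Matrix.fromBlocks 0 (-V.α • skew e1) 0 0

end Vehicle

end Underwater

end

/-! The proof is an instance of the return method. At rest the brackets only produce the columns of
`C`, once in the velocities and once in the positions, so the linearization there need not be
controllable. Instead one linearizes along a loop from `0` to `0`: the body moves along the first
axis with position `hbar`, velocity `lbar` and a control `w` in the first slot alone. If the system
linearized along this loop is controllable, the inverse function theorem transfers controllability
to the nonlinear system near the loop, hence between all pairs of states close to `0`.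

Symmetry makes the loop a solution. The two reflections force many entries of the coefficient
matrices to vanish (`symmetricEntries`), so that momentum and force along the first axis stay on
that axis and the system reduces to the scalar equation for `w`. An entry vanishes because its
integrand is odd, and this needs the equivariance of the potentials
(`IsPotential.gradient_reflect`). Equivariance follows from uniqueness for the exterior Neumann
problem (`gradient_eq_zero_of_neumann_zero`), which is proved with a Caccioppoli inequality on large
annuli and the interior estimate `exists_norm_gradient_sq_le`. The inertia matrix is invertible
because it is positive definite (`dotProduct_JJ_mulVec_pos`).

The rank condition is checked at the final time. There the velocity vanishes, its derivative is `2 *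
lam`, its second derivative is `0`, and `w` equals `lam * s` with `s` small. After division by
`lam`, the brackets of order one and two have a limit as `(lam, s)` tends to `(0, 0)`. In this limit
`w' = lbar' / α`, so only the direction `(α, 1)` of the pair (velocity, control) matters. The
nonlinearity is quadratic, hence its Jacobians are linear in that pair, and in this direction they
are `boldA` and `boldB` (`linA_α`, `linB_α`). A covector annihilating the limit brackets splits into
two halves, and each half is killed by one of the two rank hypotheses (`endMatrix_zero_zero`).
Spanning is an open condition, so it persists for small `(lam, s)` (`exists_forall_endMatrix`). When
`γ + α β = 0` the control is exactly `lbar / α`, so `s = 0`, and nothing depends on `lam` any more.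

Spanning brackets give controllability of the linearized system by duality
(`exists_linearSteers_of_span`). Twelve controls that reach the basis vectors span a
finite-dimensional space of perturbations. In `exists_steering` the unknowns are the trajectory, as
a continuous function solving an integral equation, and the twelve coefficients of the perturbation;
the linearization in these unknowns is bijective. The control in `H²` is affine in the twelve
coefficients, which gives the `C¹` dependence at once (`hasC1Steering_of_controllable`). Local
controllability is a consequence. -/

noncomputable section

namespace Underwater

/-! ### Integration by parts in the exterior of a smooth compact set -/

/-- The partial derivative in the direction of the axis `i`. -/
def pderiv (i : Fin 3) (f : E3 → ℝ) (y : E3) : ℝ := fderiv ℝ f y (EuclideanSpace.single i 1)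

theorem gradient_apply {f : E3 → ℝ} (y : E3) (i : Fin 3) : ∇ f y i = pderiv i f y := by
  have h : inner ℝ (∇ f y) (EuclideanSpace.single i 1) = pderiv i f y := inner_gradient_left
  rw [← h, EuclideanSpace.inner_single_right]
  simp

theorem inner_gradient_eq_sum (f g : E3 → ℝ) (y : E3) :
    inner ℝ (∇ f y) (∇ g y) = ∑ i, pderiv i f y * pderiv i g y := by
  simp only [PiLp.inner_apply, gradient_apply]
  exact Finset.sum_congr rfl fun i _ => by simp [mul_comm]

theorem contDiff_pderiv {f : E3 → ℝ} {n k : ℕ∞ω} (hf : ContDiff ℝ n f) (h : k + 1 ≤ n) (i : Fin 3) :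
    ContDiff ℝ k (pderiv i f) :=
  (hf.fderiv_right h).clm_apply contDiff_const

theorem contDiff_gradient {f : E3 → ℝ} {n k : ℕ∞ω} (hf : ContDiff ℝ n f) (h : k + 1 ≤ n) :
    ContDiff ℝ k (∇ f) :=
  (InnerProductSpace.toDual ℝ E3).symm.contDiff.comp (hf.fderiv_right h)

theorem laplacian_eq_sum_pderiv {f : E3 → ℝ} (hf : ContDiff ℝ 2 f) (y : E3) :
    Laplacian.laplacian f y = ∑ i, pderiv i (pderiv i f) y := by
  rw [InnerProductSpace.laplacian_eq_iteratedFDeriv_orthonormalBasis f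
    (EuclideanSpace.basisFun (Fin 3) ℝ)]
  refine Finset.sum_congr rfl fun i _ => ?_
  have hd : DifferentiableAt ℝ (fderiv ℝ f) y :=
    (hf.fderiv_right (m := 1) (by norm_num)).differentiable (by norm_num) y
  rw [iteratedFDeriv_two_apply]
  simp only [pderiv, EuclideanSpace.basisFun_apply, Matrix.cons_val_zero, Matrix.cons_val_one]
  have e : fderiv ℝ (pderiv i f) y = _ := fderiv_clm_apply hd (differentiableAt_const _)
  rw [e]
  simp

theorem integral_inner_gradient_of_hasCompactSupport {a b : E3 → ℝ} (ha : ContDiff ℝ 1 a)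
    (hc : HasCompactSupport a) (hb : ContDiff ℝ 2 b) :
    ∫ y, inner ℝ (∇ a y) (∇ b y) = -∫ y, a y * Laplacian.laplacian b y := by
  have hb1 : ∀ i, ContDiff ℝ 1 (pderiv i b) := fun i => contDiff_pderiv hb (by norm_num) i
  have hb2 : ∀ i, Continuous (pderiv i (pderiv i b)) := fun i =>
    (contDiff_pderiv (k := 0) (hb1 i) (by norm_num) i).continuous
  have ha1 : ∀ i, Continuous (pderiv i a) := fun i =>
    (contDiff_pderiv (k := 0) ha (by norm_num) i).continuous
  have hca : ∀ i, HasCompactSupport (pderiv i a) := fun i => hc.fderiv_apply ℝ _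
  have i1 : ∀ i, Integrable fun y => pderiv i a y * pderiv i b y := fun i =>
    ((ha1 i).mul (hb1 i).continuous).integrable_of_hasCompactSupport (hca i).mul_right
  have i2 : ∀ i, Integrable fun y => a y * pderiv i (pderiv i b) y := fun i =>
    (ha.continuous.mul (hb2 i)).integrable_of_hasCompactSupport hc.mul_right
  simp only [inner_gradient_eq_sum, laplacian_eq_sum_pderiv hb, Finset.mul_sum]
  rw [integral_finsetSum _ fun i _ => i1 i, integral_finsetSum _ fun i _ => i2 i,
    ← Finset.sum_neg_distrib]
  refine Finset.sum_congr rfl fun i _ => ?_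
  have := integral_mul_fderiv_eq_neg_fderiv_mul_of_integrable (μ := (volume : Measure E3))
    (f := a) (g := pderiv i b) (v := EuclideanSpace.single i 1) (i1 i) (i2 i)
    ((ha.continuous.mul (hb1 i).continuous).integrable_of_hasCompactSupport hc.mul_right)
    (fun x _ => ha.differentiable (by norm_num) x)
    (fun x _ => (hb1 i).differentiable (by norm_num) x)
  rw [eq_comm, neg_eq_iff_eq_neg]
  exact this

/-- At a zero of `f` choose a direction `n` along which `f` grows at rate at least `c` nearby. From
a point `y` with `f y > 0`, moving along `-n` meets the zero set before time `f y / c`, and `g`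
vanishes there. The Lipschitz bound for `g` along this short segment is then proportional to `f y`.
Away from the zero set the claim is trivial. -/
theorem exists_local_le_mul_of_eq_zero {f g : E3 → ℝ} (hf : ContDiff ℝ 1 f) (hg : ContDiff ℝ 1 g)
    {p : E3} (hreg : f p = 0 → fderiv ℝ f p ≠ 0) (hz : ∀ y, f y = 0 → g y = 0) :
    ∃ U ∈ 𝓝 p, ∃ K, 0 ≤ K ∧ ∀ y ∈ U, 0 < f y → |g y| ≤ K * f y := by
  rcases lt_trichotomy (f p) 0 with h | h | h
  · exact ⟨{y | f y < 0}, hf.continuous.continuousAt.eventually_lt_const h, 0, le_rfl,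
      fun y hy hy' => absurd hy' (not_lt.2 (le_of_lt hy))⟩
  · obtain ⟨n, hn⟩ : ∃ n, 0 < fderiv ℝ f p n := by
      by_contra! hcon
      refine hreg h (ContinuousLinearMap.ext fun v => le_antisymm (hcon v) ?_)
      have := hcon (-v)
      simpa using this
    set c := fderiv ℝ f p n / 2 with hc
    have hc0 : 0 < c := by positivity
    set L := ‖fderiv ℝ g p‖ + 1 with hL
    have hL0 : 0 < L := by positivity
    have hcf : Continuous fun y => fderiv ℝ f y n :=
      (hf.continuous_fderiv (by norm_num)).clm_apply continuous_const
    have hcg : Continuous fun y => ‖fderiv ℝ g y‖ := (hg.continuous_fderiv (by norm_num)).norm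
    have ev : ∀ᶠ y in 𝓝 p, c < fderiv ℝ f y n ∧ ‖fderiv ℝ g y‖ < L :=
      (hcf.continuousAt.eventually_const_lt (by simp only [hc]; linarith)).and
        (hcg.continuousAt.eventually_lt_const (by simp only [hL]; linarith))
    obtain ⟨r, hr, hball⟩ := Metric.eventually_nhds_iff_ball.1 ev
    have hn0 : 0 < ‖n‖ := by
      rw [norm_pos_iff]; rintro rfl; simp at hn
    have hs0 : 0 < c * (r / (2 * ‖n‖)) := by positivity
    refine ⟨Metric.ball p (r / 2) ∩ {y | f y < c * (r / (2 * ‖n‖))},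
      inter_mem (Metric.ball_mem_nhds _ (by positivity))
        (hf.continuous.continuousAt.eventually_lt_const (by rw [h]; exact hs0)),
      L * ‖n‖ / c, by positivity, ?_⟩
    rintro y ⟨hy1, hy2⟩ hy0
    have hy2 : f y / c < r / (2 * ‖n‖) := by
      rw [div_lt_iff₀ hc0, mul_comm]; exact hy2
    have hS : 0 < f y / c := by positivity
    have hmem : ∀ s ∈ Icc 0 (f y / c), y - s • n ∈ Metric.ball p r := by
      intro s hs
      rw [Metric.mem_ball] at hy1 ⊢
      have : dist (y - s • n) y = s * ‖n‖ := by
        rw [dist_eq_norm]; simp [norm_smul, abs_of_nonneg hs.1]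
      have h2 : s * ‖n‖ < r / 2 := by
        have := lt_of_le_of_lt hs.2 hy2
        calc s * ‖n‖ < r / (2 * ‖n‖) * ‖n‖ := by gcongr
          _ = r / 2 := by field_simp
      linarith [dist_triangle (y - s • n) y p]
    have hder : ∀ s, HasDerivAt (fun s : ℝ => f (y - s • n)) (-fderiv ℝ f (y - s • n) n) s := by
      intro s
      have h1 : HasDerivAt (fun s : ℝ => y - s • n) (-n) s := by
        simpa using ((hasDerivAt_id s).smul_const n).const_sub y
      have := (hf.differentiable (by norm_num) (y - s • n)).hasFDerivAt.comp_hasDerivAt s h1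
      simpa [Function.comp_def] using this
    have hend : f (y - (f y / c) • n) ≤ 0 := by
      have hcd : ContinuousOn (fun s : ℝ => f (y - s • n)) (Icc 0 (f y / c)) :=
        fun s _ => (hder s).continuousAt.continuousWithinAt
      obtain ⟨s, hs, hs'⟩ := exists_hasDerivAt_eq_slope _ _ hS hcd (fun s _ => hder s)
      have h1 := (hball _ (hmem s ⟨hs.1.le, hs.2.le⟩)).1
      simp only [zero_smul, sub_zero] at hs'
      rw [eq_div_iff hS.ne'] at hs'
      have h2 : f y = c * (f y / c) := by field_simp
      nlinarith
    obtain ⟨s, hs, hs0⟩ : ∃ s ∈ Icc 0 (f y / c), f (y - s • n) = 0 := by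
      have := intermediate_value_Icc' hS.le (f := fun s : ℝ => f (y - s • n))
        (fun s _ => (hder s).continuousAt.continuousWithinAt)
      exact this ⟨hend, by simpa using hy0.le⟩
    have hy3 : y ∈ Metric.ball p r := Metric.ball_subset_ball (by linarith) hy1
    have hle := (convex_ball p r).norm_image_sub_le_of_norm_fderiv_le (𝕜 := ℝ) (f := g) (C := L)
      (fun x _ => hg.differentiable (by norm_num) x) (fun x hx => (hball x hx).2.le)
      (hmem s hs) hy3
    rw [hz _ hs0, sub_zero, Real.norm_eq_abs, sub_sub_cancel, norm_smul, Real.norm_eq_abs,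
      abs_of_nonneg hs.1] at hle
    calc |g y| ≤ L * (s * ‖n‖) := hle
      _ ≤ L * (f y / c * ‖n‖) := by gcongr; exact hs.2
      _ = L * ‖n‖ / c * f y := by ring
  · refine ⟨{y | f p / 2 < f y} ∩ {y | |g y| < |g p| + 1},
      inter_mem (hf.continuous.continuousAt.eventually_const_lt (by linarith))
        (hg.continuous.abs.continuousAt.eventually_lt_const (by linarith)),
      (|g p| + 1) / (f p / 2), by positivity, ?_⟩
    rintro y ⟨hy1, hy2⟩ _
    have hy1 : f p / 2 < f y := hy1
    have hy2 : |g y| < |g p| + 1 := hy2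
    rw [div_mul_eq_mul_div, le_div_iff₀ (by positivity)]
    have := abs_nonneg (g y)
    nlinarith

theorem exists_le_mul_of_eq_zero {f g : E3 → ℝ} (hf : ContDiff ℝ 1 f) (hg : ContDiff ℝ 1 g)
    (hreg : ∀ p, f p = 0 → fderiv ℝ f p ≠ 0) (hz : ∀ y, f y = 0 → g y = 0) {Q : Set E3}
    (hQ : IsCompact Q) : ∃ K, 0 ≤ K ∧ ∀ y ∈ Q, 0 < f y → |g y| ≤ K * f y := by
  refine hQ.induction_on (p := fun s => ∃ K, 0 ≤ K ∧ ∀ y ∈ s, 0 < f y → |g y| ≤ K * f y)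
    ⟨0, le_rfl, by simp⟩ ?_ ?_ ?_
  · rintro s t hst ⟨K, hK, h⟩
    exact ⟨K, hK, fun y hy => h y (hst hy)⟩
  · rintro s t ⟨K, hK, h⟩ ⟨K', hK', h'⟩
    refine ⟨max K K', le_max_of_le_left hK, fun y hy h0 => ?_⟩
    rcases hy with hy | hy
    · exact (h y hy h0).trans (by gcongr; exact le_max_left _ _)
    · exact (h' y hy h0).trans (by gcongr; exact le_max_right _ _)
  · intro p _
    obtain ⟨U, hU, K, hK, h⟩ := exists_local_le_mul_of_eq_zero hf hg (hreg p) hz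
    exact ⟨U, mem_nhdsWithin_of_mem_nhds hU, K, hK, h⟩

theorem deriv_smoothTransition_of_nonpos {x : ℝ} (hx : x ≤ 0) :
    deriv Real.smoothTransition x = 0 := by
  refine IsLocalMin.deriv_eq_zero (Eventually.of_forall fun z => ?_)
  rw [Real.smoothTransition.zero_of_nonpos hx]
  exact Real.smoothTransition.nonneg z

theorem deriv_smoothTransition_of_one_le {x : ℝ} (hx : 1 ≤ x) :
    deriv Real.smoothTransition x = 0 := by
  refine IsLocalMax.deriv_eq_zero (Eventually.of_forall fun z => ?_)
  rw [Real.smoothTransition.one_of_one_le hx]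
  exact Real.smoothTransition.le_one z

theorem exists_abs_deriv_smoothTransition_le :
    ∃ D, 0 ≤ D ∧ ∀ x, |deriv Real.smoothTransition x| ≤ D := by
  have hc : Continuous (deriv Real.smoothTransition) :=
    (Real.smoothTransition.contDiff (n := 1)).continuous_deriv le_rfl
  obtain ⟨D, hD⟩ := isCompact_Icc.exists_bound_of_continuousOn (s := Icc (0 : ℝ) 1) hc.continuousOn
  refine ⟨D, (norm_nonneg _).trans (hD 0 (by simp)), fun x => ?_⟩
  have hD0 : 0 ≤ D := (norm_nonneg _).trans (hD 0 (by simp))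
  rcases le_total x 0 with h | h
  · rw [deriv_smoothTransition_of_nonpos h]; simpa
  rcases le_total 1 x with h1 | h1
  · rw [deriv_smoothTransition_of_one_le h1]; simpa
  · exact hD x ⟨h, h1⟩

theorem gradient_mul {f g : E3 → ℝ} {y : E3} (hf : DifferentiableAt ℝ f y)
    (hg : DifferentiableAt ℝ g y) : ∇ (fun y => f y * g y) y = f y • ∇ g y + g y • ∇ f y := by
  ext i
  simp only [gradient_apply, PiLp.add_apply, PiLp.smul_apply, pderiv]
  rw [fderiv_fun_mul hf hg]
  simp

theorem gradient_comp_real {f : E3 → ℝ} {k : ℝ → ℝ} {y : E3} (hf : DifferentiableAt ℝ f y)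
    (hk : DifferentiableAt ℝ k (f y)) : ∇ (fun y => k (f y)) y = deriv k (f y) • ∇ f y := by
  ext i
  simp only [gradient_apply, PiLp.smul_apply, pderiv]
  have := (hk.hasDerivAt.comp_hasFDerivAt y hf.hasFDerivAt).fderiv
  simp only [Function.comp_def] at this
  rw [this]
  simp

/-- A harmonic function with zero normal derivative is weakly harmonic up to the boundary. -/
theorem integral_inner_gradient_eq_zero {f u η : E3 → ℝ} (hf : ContDiff ℝ 2 f)
    (hreg : ∀ p, f p = 0 → fderiv ℝ f p ≠ 0) (hu : ContDiff ℝ 2 u)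
    (hharm : ∀ y, 0 < f y → Laplacian.laplacian u y = 0)
    (hneu : ∀ y, f y = 0 → inner ℝ (∇ f y) (∇ u y) = 0)
    (hη : ContDiff ℝ 1 η) (hc : HasCompactSupport η) :
    ∫ y in {y | 0 < f y}, inner ℝ (∇ η y) (∇ u y) = 0 := by
  have hgu : ContDiff ℝ 1 (∇ u) := contDiff_gradient hu (by norm_num)
  have hgf : ContDiff ℝ 1 (∇ f) := contDiff_gradient hf (by norm_num)
  have hgη : Continuous (∇ η) := (contDiff_gradient (k := 0) hη (by norm_num)).continuous
  have hf1 : ContDiff ℝ 1 f := hf.of_le (by norm_num)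
  have hcη : HasCompactSupport (∇ η) :=
    (hc.fderiv ℝ).comp_left (g := (InnerProductSpace.toDual ℝ E3).symm) (map_zero _)
  obtain ⟨D, hD0, hD⟩ := exists_abs_deriv_smoothTransition_le
  obtain ⟨K, hK0, hK⟩ := exists_le_mul_of_eq_zero hf1
    (g := fun y => inner ℝ (∇ f y) (∇ u y)) (hgf.inner ℝ hgu) hreg hneu hc.isCompact
  have hst : ContDiff ℝ 1 Real.smoothTransition := Real.smoothTransition.contDiff
  -- A cut-off that is `0` where `f ≤ 0` and `1` where `f ≥ 1 / (n + 1)`. It replaces the boundary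
  -- by a thin layer, so that no surface integral is needed.
  set k : ℕ → E3 → ℝ := fun n y => Real.smoothTransition ((n + 1) * f y) with hk
  have hkd : ∀ n, ContDiff ℝ 1 (k n) := fun n => hst.comp (contDiff_const.mul hf1)
  have hgk : ∀ n y, ∇ (k n) y =
      (((n : ℝ) + 1) * deriv Real.smoothTransition ((n + 1) * f y)) • ∇ f y := by
    intro n y
    have := gradient_comp_real (k := fun s => Real.smoothTransition (((n : ℝ) + 1) * s))
      (hf1.differentiable (by norm_num) y) (by
        exact (hst.comp (contDiff_const.mul contDiff_id)).differentiable (by norm_num) _)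
    rw [hk]
    simp only at this ⊢
    rw [this]
    congr 1
    have h1 : HasDerivAt (fun s : ℝ => ((n : ℝ) + 1) * s) ((n : ℝ) + 1) (f y) := by
      simpa using (hasDerivAt_id (f y)).const_mul ((n : ℝ) + 1)
    have h2 := ((hst.differentiable (by norm_num) (((n : ℝ) + 1) * f y)).hasDerivAt.comp _ h1).deriv
    simp only [Function.comp_def] at h2
    rw [h2, mul_comm]
  have hint : Integrable fun y => inner ℝ (∇ η y) (∇ u y) :=
    (hgη.inner hgu.continuous).integrable_of_hasCompactSupport
      (hcη.mono fun y hy h => hy (by simp [h]))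
  have hηi : Integrable η := hη.continuous.integrable_of_hasCompactSupport hc
  -- Integration by parts on the whole space with the test function `η * k n`. The Laplacian term
  -- vanishes: `u` is harmonic where `f > 0` and `k n` is `0` elsewhere.
  have key : ∀ n, ∫ y, k n y * inner ℝ (∇ η y) (∇ u y) =
      -∫ y, η y * (((n : ℝ) + 1) * deriv Real.smoothTransition ((n + 1) * f y)
        * inner ℝ (∇ f y) (∇ u y)) := by
    intro n
    have h1 := integral_inner_gradient_of_hasCompactSupport (a := fun y => η y * k n y)
      (hη.mul (hkd n)) hc.mul_right hu
    have h2 : ∀ y, η y * k n y * Laplacian.laplacian u y = 0 := by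
      intro y
      rcases lt_or_ge 0 (f y) with h | h
      · simp [hharm y h]
      · have : k n y = 0 := Real.smoothTransition.zero_of_nonpos
          (mul_nonpos_of_nonneg_of_nonpos (by positivity) h)
        simp [this]
    simp only [h2, integral_zero, neg_zero] at h1
    have h3 : ∀ y, inner ℝ (∇ (fun y => η y * k n y) y) (∇ u y) =
        η y * (((n : ℝ) + 1) * deriv Real.smoothTransition ((n + 1) * f y)
        * inner ℝ (∇ f y) (∇ u y)) + k n y * inner ℝ (∇ η y) (∇ u y) := by
      intro y
      rw [gradient_mul (hη.differentiable (by norm_num) y) ((hkd n).differentiable (by norm_num) y),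
        hgk, inner_add_left, inner_smul_left, inner_smul_left, inner_smul_left]
      simp
    simp only [h3] at h1
    rw [integral_add] at h1
    · linarith
    · refine Continuous.integrable_of_hasCompactSupport ?_ hc.mul_right
      exact hη.continuous.mul ((continuous_const.mul ((hst.continuous_deriv le_rfl).comp
        (continuous_const.mul hf.continuous))).mul (hgf.continuous.inner hgu.continuous))
    · refine ((hkd n).continuous.mul (hgη.inner hgu.continuous)).integrable_of_hasCompactSupport
        (hcη.mono fun y hy h => hy (by simp [h]))
  have lim1 : Tendsto (fun n => ∫ y, k n y * inner ℝ (∇ η y) (∇ u y)) atTop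
      (𝓝 (∫ y in {y | 0 < f y}, inner ℝ (∇ η y) (∇ u y))) := by
    rw [← integral_indicator (isOpen_lt continuous_const hf.continuous).measurableSet]
    refine tendsto_integral_of_dominated_convergence (fun y => ‖inner ℝ (∇ η y) (∇ u y)‖)
      (fun n => ((hkd n).continuous.mul (hgη.inner hgu.continuous)).aestronglyMeasurable)
      hint.norm (fun n => Eventually.of_forall fun y => ?_) (Eventually.of_forall fun y => ?_)
    · rw [norm_mul, Real.norm_eq_abs (k n y), abs_of_nonneg (Real.smoothTransition.nonneg _)]
      exact mul_le_of_le_one_left (norm_nonneg _) (Real.smoothTransition.le_one _)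
    · rcases lt_or_ge 0 (f y) with h | h
      · rw [indicator_of_mem (by exact h)]
        refine tendsto_const_nhds.congr' ?_
        obtain ⟨N, hN⟩ := exists_nat_gt (1 / f y)
        filter_upwards [eventually_ge_atTop N] with n hn
        have : (1 : ℝ) ≤ (n + 1) * f y := by
          rw [div_lt_iff₀ h] at hN
          have : (N : ℝ) ≤ n := by exact_mod_cast hn
          nlinarith
        simp [hk, Real.smoothTransition.one_of_one_le this]
      · rw [indicator_of_notMem (by simpa using h)]
        refine tendsto_const_nhds.congr fun n => ?_
        have : k n y = 0 := Real.smoothTransition.zero_of_nonpos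
          (mul_nonpos_of_nonneg_of_nonpos (by positivity) h)
        simp [this]
  -- In the layer the factor `n + 1` is compensated by the Neumann condition: the normal component
  -- of `∇ u` is at most `K * f y`, and `(n + 1) * f y ≤ 1` there. The integrand is thus dominated,
  -- and it is eventually `0` at each point.
  have lim2 : Tendsto (fun n : ℕ => ∫ y, η y * (((n : ℝ) + 1) *
      deriv Real.smoothTransition ((n + 1) * f y) * inner ℝ (∇ f y) (∇ u y))) atTop
      (𝓝 (∫ _y : E3, (0 : ℝ))) := by
    refine tendsto_integral_of_dominated_convergence (fun y => ‖η y‖ * (D * K))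
      (fun n => Continuous.aestronglyMeasurable ?_)
      (hηi.norm.mul_const _) (fun n => Eventually.of_forall fun y => ?_)
      (Eventually.of_forall fun y => ?_)
    · exact hη.continuous.mul ((continuous_const.mul ((hst.continuous_deriv le_rfl).comp
        (continuous_const.mul hf.continuous))).mul (hgf.continuous.inner hgu.continuous))
    · rw [norm_mul]
      by_cases hy : η y = 0
      · simp [hy]
      gcongr
      have hy' : y ∈ tsupport η := subset_tsupport _ hy
      rcases lt_or_ge 0 (f y) with h | h
      · rcases le_total 1 (((n : ℝ) + 1) * f y) with h1 | h1
        · simp only [deriv_smoothTransition_of_one_le h1, mul_zero, zero_mul, norm_zero]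
          positivity
        · rw [norm_mul, norm_mul, Real.norm_eq_abs, Real.norm_eq_abs, Real.norm_eq_abs,
            abs_of_nonneg (by positivity : (0 : ℝ) ≤ n + 1)]
          calc ((n : ℝ) + 1) * |deriv Real.smoothTransition ((n + 1) * f y)|
                * |inner ℝ (∇ f y) (∇ u y)| ≤ ((n : ℝ) + 1) * D * (K * f y) := by
                gcongr
                · exact hD _
                · exact hK y hy' h
            _ = ((n + 1) * f y) * (D * K) := by ring
            _ ≤ 1 * (D * K) := by gcongr
            _ = D * K := one_mul _
      · rw [deriv_smoothTransition_of_nonpos (mul_nonpos_of_nonneg_of_nonpos (by positivity) h)]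
        simp only [mul_zero, zero_mul, norm_zero]
        positivity
    · rcases lt_or_ge 0 (f y) with h | h
      · refine tendsto_const_nhds.congr' ?_
        obtain ⟨N, hN⟩ := exists_nat_gt (1 / f y)
        filter_upwards [eventually_ge_atTop N] with n hn
        have : (1 : ℝ) ≤ (n + 1) * f y := by
          rw [div_lt_iff₀ h] at hN
          have : (N : ℝ) ≤ n := by exact_mod_cast hn
          nlinarith
        simp [deriv_smoothTransition_of_one_le this]
      · refine tendsto_const_nhds.congr fun n => ?_
        rw [deriv_smoothTransition_of_nonpos (mul_nonpos_of_nonneg_of_nonpos (by positivity) h)]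
        simp
  have lim3 := lim2.neg
  rw [integral_zero, neg_zero] at lim3
  exact tendsto_nhds_unique lim1 (lim3.congr fun n => (key n).symm)

/-! ### Mean values and interior gradient estimates for harmonic functions -/

/-- A smooth radial function supported in the unit ball. -/
def radialKernel (z : E3) : ℝ := deriv Real.smoothTransition (1 - ‖z‖ ^ 2)

theorem continuous_radialKernel : Continuous radialKernel :=
  ((Real.smoothTransition.contDiff (n := 1)).continuous_deriv le_rfl).comp (by fun_prop)

theorem radialKernel_nonneg (z : E3) : 0 ≤ radialKernel z :=
  Real.smoothTransition.monotone.deriv_nonneg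

theorem radialKernel_eq_zero {z : E3} (hz : 1 ≤ ‖z‖) : radialKernel z = 0 :=
  deriv_smoothTransition_of_nonpos (by nlinarith)

theorem hasCompactSupport_radialKernel : HasCompactSupport radialKernel :=
  HasCompactSupport.intro (isCompact_closedBall 0 1) fun z hz =>
    radialKernel_eq_zero (by simpa using (not_le.1 (fun h => hz (by simpa using h))).le)

theorem integral_radialKernel_pos : 0 < ∫ z, radialKernel z := by
  rw [integral_pos_iff_support_of_nonneg radialKernel_nonneg
    (continuous_radialKernel.integrable_of_hasCompactSupport hasCompactSupport_radialKernel)]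
  refine continuous_radialKernel.isOpen_support.measure_pos _ ?_
  -- The transition rises from `0` to `1` on `[0, 1]`, so its derivative equals `1` at some `s`; a
  -- point with `1 - ‖z‖ ^ 2 = s` lies in the support of the kernel.
  obtain ⟨s, hs, hs'⟩ := exists_deriv_eq_slope Real.smoothTransition zero_lt_one
    Real.smoothTransition.continuous.continuousOn
    ((Real.smoothTransition.contDiff (n := 1)).differentiable one_ne_zero).differentiableOn
  refine ⟨Real.sqrt (1 - s) • EuclideanSpace.single 0 1, ?_⟩
  have h1 : 1 - ‖Real.sqrt (1 - s) • (EuclideanSpace.single 0 1 : E3)‖ ^ 2 = s := by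
    rw [norm_smul, mul_pow, Real.norm_eq_abs, sq_abs, Real.sq_sqrt (by linarith [hs.2])]
    simp
  simp [radialKernel, h1, hs', Real.smoothTransition.one, Real.smoothTransition.zero]

theorem gradient_norm_sq (z : E3) : ∇ (fun z : E3 => 1 - ‖z‖ ^ 2) z = -(2 : ℝ) • z := by
  have h : HasFDerivAt (fun z : E3 => 1 - ‖z‖ ^ 2) (-((2 : ℝ) • (innerSL ℝ) z)) z := by
    have := (hasStrictFDerivAt_norm_sq z).hasFDerivAt.const_sub 1
    rwa [← Nat.cast_smul_eq_nsmul ℝ, Nat.cast_ofNat] at this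
  ext i
  rw [gradient_apply, pderiv, h.fderiv]
  simp [EuclideanSpace.inner_single_right]

/-- This explains the choice of the kernel: `radialKernel z • z` is, up to a constant, the gradient
of a compactly supported function. A radial derivative weighted by the kernel can therefore be
integrated by parts into a Laplacian. -/
theorem gradient_smoothTransition_norm (z : E3) :
    ∇ (fun z : E3 => Real.smoothTransition (1 - ‖z‖ ^ 2)) z = -(2 * radialKernel z) • z := by
  have := gradient_comp_real (f := fun z : E3 => 1 - ‖z‖ ^ 2) (k := Real.smoothTransition)
    (y := z) ((contDiff_const.sub (contDiff_norm_sq ℝ)).differentiable one_ne_zero z)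
    ((Real.smoothTransition.contDiff (n := 1)).differentiable one_ne_zero _)
  rw [this, gradient_norm_sq, smul_smul, radialKernel]
  congr 1
  ring

theorem pderiv_comp_affine {v : E3 → ℝ} (hv : ContDiff ℝ 1 v) (y : E3) (t : ℝ) (i : Fin 3) (z : E3) :
    pderiv i (fun z => v (y + t • z)) z = t * pderiv i v (y + t • z) := by
  have h1 : HasFDerivAt (fun z : E3 => y + t • z) (t • ContinuousLinearMap.id ℝ E3) z :=
    ((hasFDerivAt_id z).const_smul t).const_add y
  have := ((hv.differentiable one_ne_zero (y + t • z)).hasFDerivAt.comp z h1).fderiv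
  simp only [Function.comp_def] at this
  rw [pderiv, this]
  simp [pderiv]

theorem laplacian_comp_affine {v : E3 → ℝ} (hv : ContDiff ℝ 2 v) (y : E3) (t : ℝ) (z : E3) :
    Laplacian.laplacian (fun z => v (y + t • z)) z =
      t ^ 2 * Laplacian.laplacian v (y + t • z) := by
  have h : ContDiff ℝ 2 fun z : E3 => v (y + t • z) := hv.comp (by fun_prop)
  rw [laplacian_eq_sum_pderiv h, laplacian_eq_sum_pderiv hv, Finset.mul_sum]
  refine Finset.sum_congr rfl fun i _ => ?_
  have h1 : pderiv i (fun z => v (y + t • z)) = fun z => t * pderiv i v (y + t • z) :=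
    funext fun z => pderiv_comp_affine (hv.of_le (by norm_num)) y t i z
  have h2 := pderiv_comp_affine (contDiff_pderiv hv (k := 1) (by norm_num) i) y t i z
  have h3 : DifferentiableAt ℝ (fun z => pderiv i v (y + t • z)) z :=
    ((contDiff_pderiv hv (k := 1) (by norm_num) i).comp (by fun_prop)).differentiable one_ne_zero z
  rw [h1, pderiv, fderiv_const_mul h3]
  simp only [_root_.smul_apply, smul_eq_mul]
  rw [← pderiv, h2]
  ring

/-- The derivative in `t` of the weighted mean over the ball of radius `t` is a radial derivative
integrated against the kernel. By integration by parts it is a multiple of an integral of the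
Laplacian over that ball, so it vanishes for `0 < t < r`. The mean at `t = r` is therefore equal to
the mean at `t = 0`. -/
theorem integral_mul_radialKernel_of_harmonic {v : E3 → ℝ} (hv : ContDiff ℝ 2 v) {y : E3} {r : ℝ}
    (hr : 0 < r) (hharm : ∀ x ∈ Metric.ball y r, Laplacian.laplacian v x = 0) :
    ∫ z, v (y + r • z) * radialKernel z = v y * ∫ z, radialKernel z := by
  have hv1 : ContDiff ℝ 1 v := hv.of_le (by norm_num)
  have hcd : Continuous (fderiv ℝ v) := hv1.continuous_fderiv one_ne_zero
  have hder : ∀ t₀ : ℝ, HasDerivAt (fun t : ℝ => ∫ z, v (y + t • z) * radialKernel z)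
      (∫ z, fderiv ℝ v (y + t₀ • z) z * radialKernel z) t₀ := by
    intro t₀
    obtain ⟨G, hG⟩ := (isCompact_closedBall y (|t₀| + 1)).exists_bound_of_continuousOn
      hcd.continuousOn
    have hG0 : 0 ≤ G := (norm_nonneg _).trans (hG y (by simp; positivity))
    refine (hasDerivAt_integral_of_dominated_loc_of_deriv_le
      (F := fun t z => v (y + t • z) * radialKernel z)
      (F' := fun t z => fderiv ℝ v (y + t • z) z * radialKernel z)
      (bound := fun z => G * radialKernel z) (Metric.ball_mem_nhds t₀ zero_lt_one)
      (Eventually.of_forall fun t => ?_) ?_ ?_ ?_ ?_ ?_).2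
    · exact ((hv.continuous.comp (by fun_prop)).mul continuous_radialKernel).aestronglyMeasurable
    · exact ((hv.continuous.comp (by fun_prop)).mul
        continuous_radialKernel).integrable_of_hasCompactSupport
        hasCompactSupport_radialKernel.mul_left
    · exact (((hcd.comp (by fun_prop)).clm_apply continuous_id).mul
        continuous_radialKernel).aestronglyMeasurable
    · refine Eventually.of_forall fun z t ht => ?_
      rw [norm_mul, Real.norm_eq_abs (radialKernel z), abs_of_nonneg (radialKernel_nonneg z)]
      rcases le_or_gt 1 ‖z‖ with h | h
      · simp [radialKernel_eq_zero h]
      refine mul_le_mul_of_nonneg_right ?_ (radialKernel_nonneg z)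
      have ht' : |t| ≤ |t₀| + 1 := by
        rw [Metric.mem_ball, Real.dist_eq] at ht
        linarith [abs_sub_abs_le_abs_sub t t₀]
      have hmem : y + t • z ∈ Metric.closedBall y (|t₀| + 1) := by
        rw [mem_closedBall_iff_norm, add_sub_cancel_left, norm_smul, Real.norm_eq_abs]
        nlinarith [norm_nonneg z, abs_nonneg t]
      calc ‖fderiv ℝ v (y + t • z) z‖ ≤ ‖fderiv ℝ v (y + t • z)‖ * ‖z‖ :=
            ContinuousLinearMap.le_opNorm _ _
        _ ≤ G * 1 := by gcongr; exact hG _ hmem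
        _ = G := mul_one G
    · exact (continuous_radialKernel.integrable_of_hasCompactSupport
        hasCompactSupport_radialKernel).const_mul G
    · refine Eventually.of_forall fun z t _ => ?_
      have h1 : HasDerivAt (fun t : ℝ => y + t • z) z t := by
        simpa using ((hasDerivAt_id t).smul_const z).const_add y
      have := (hv1.differentiable one_ne_zero (y + t • z)).hasFDerivAt.comp_hasDerivAt t h1
      exact this.mul_const _
  obtain ⟨t, ht, ht'⟩ := exists_hasDerivAt_eq_slope _ _ hr
    (fun t _ => (hder t).continuousAt.continuousWithinAt) (fun t _ => hder t)
  have hzero : ∫ z, fderiv ℝ v (y + t • z) z * radialKernel z = 0 := by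
    have hst : ContDiff ℝ 1 fun z : E3 => Real.smoothTransition (1 - ‖z‖ ^ 2) :=
      Real.smoothTransition.contDiff.comp (contDiff_const.sub (contDiff_norm_sq ℝ))
    have hcs : HasCompactSupport fun z : E3 => Real.smoothTransition (1 - ‖z‖ ^ 2) :=
      HasCompactSupport.intro (isCompact_closedBall 0 1) fun z hz =>
        Real.smoothTransition.zero_of_nonpos (by
          have : 1 < ‖z‖ := not_le.1 fun h => hz (by simpa using h)
          nlinarith)
    have hb : ContDiff ℝ 2 fun z : E3 => v (y + t • z) := hv.comp (by fun_prop)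
    have h := integral_inner_gradient_of_hasCompactSupport hst hcs hb
    have hR : ∀ z : E3, Real.smoothTransition (1 - ‖z‖ ^ 2) *
        Laplacian.laplacian (fun z => v (y + t • z)) z = 0 := by
      intro z
      rcases le_or_gt 1 ‖z‖ with h | h
      · rw [Real.smoothTransition.zero_of_nonpos (by nlinarith), zero_mul]
      · rw [laplacian_comp_affine hv, hharm, mul_zero, mul_zero]
        rw [mem_ball_iff_norm, add_sub_cancel_left, norm_smul, Real.norm_eq_abs,
          abs_of_pos ht.1]
        nlinarith [ht.1, ht.2, norm_nonneg z]
    have hL : ∀ z : E3, inner ℝ (∇ (fun z : E3 => Real.smoothTransition (1 - ‖z‖ ^ 2)) z)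
        (∇ (fun z => v (y + t • z)) z) =
        -(2 * t) * (fderiv ℝ v (y + t • z) z * radialKernel z) := by
      intro z
      rw [gradient_smoothTransition_norm, inner_smul_left, real_inner_comm, inner_gradient_left]
      have h1 : HasFDerivAt (fun z : E3 => y + t • z) (t • ContinuousLinearMap.id ℝ E3) z :=
        ((hasFDerivAt_id z).const_smul t).const_add y
      have := ((hv1.differentiable one_ne_zero (y + t • z)).hasFDerivAt.comp z h1).fderiv
      simp only [Function.comp_def] at this
      rw [this]
      simp
      ring
    simp only [hR, hL, integral_zero, neg_zero] at h
    rw [integral_const_mul] at h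
    exact (mul_eq_zero.1 h).resolve_left (by have := ht.1; simp; exact this.ne')
  rw [hzero, eq_comm, div_eq_zero_iff] at ht'
  have h2 := ht'.resolve_right (by simpa using hr.ne')
  simp only [zero_smul, add_zero, integral_const_mul] at h2
  linarith

theorem sq_integral_mul_le {X : Type*} [MeasurableSpace X] {μ : Measure X} {f g : X → ℝ}
    (hf : Integrable (fun x => f x ^ 2) μ) (hg : Integrable (fun x => g x ^ 2) μ)
    (hfg : Integrable (fun x => f x * g x) μ) :
    (∫ x, f x * g x ∂μ) ^ 2 ≤ (∫ x, f x ^ 2 ∂μ) * ∫ x, g x ^ 2 ∂μ := by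
  set a := ∫ x, f x ^ 2 ∂μ
  set b := ∫ x, g x ^ 2 ∂μ
  set c := ∫ x, f x * g x ∂μ
  have key : ∀ s t : ℝ, 0 ≤ s ^ 2 * a - 2 * s * t * c + t ^ 2 * b := by
    intro s t
    have h1 : 0 ≤ ∫ x, (s * f x - t * g x) ^ 2 ∂μ := integral_nonneg fun x => sq_nonneg _
    have h2 : ∫ x, (s * f x - t * g x) ^ 2 ∂μ = s ^ 2 * a - 2 * s * t * c + t ^ 2 * b := by
      have e : ∀ x, (s * f x - t * g x) ^ 2 =
          s ^ 2 * f x ^ 2 - 2 * s * t * (f x * g x) + t ^ 2 * g x ^ 2 := fun x => by ring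
      simp only [e]
      rw [integral_add (f := fun x => s ^ 2 * f x ^ 2 - 2 * s * t * (f x * g x))
          ((hf.const_mul _).sub (hfg.const_mul _)) (hg.const_mul _),
        integral_sub (hf.const_mul _) (hfg.const_mul _), integral_const_mul, integral_const_mul,
        integral_const_mul]
    linarith
  have ha : 0 ≤ a := integral_nonneg fun x => sq_nonneg _
  have hb : 0 ≤ b := integral_nonneg fun x => sq_nonneg _
  -- The quadratic form in `(s, t)` is nonnegative. If `a = 0`, evaluating it at `(b + 1, c)` forces
  -- `c = 0`; otherwise `(c, a)` gives the discriminant inequality multiplied by `a`.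
  rcases ha.eq_or_lt with h | h
  · have k1 := key (b + 1) c
    have k2 := key (-(b + 1)) c
    rw [← h] at k1 ⊢
    nlinarith [sq_nonneg c]
  · have k1 := key c a
    have : 0 ≤ a * (a * b - c ^ 2) := by nlinarith
    nlinarith [nonneg_of_mul_nonneg_right this h]

theorem pderiv_comm {f : E3 → ℝ} (hf : ContDiff ℝ 2 f) (i j : Fin 3) (y : E3) :
    pderiv i (pderiv j f) y = pderiv j (pderiv i f) y := by
  have hd : DifferentiableAt ℝ (fderiv ℝ f) y :=
    (hf.fderiv_right (m := 1) (by norm_num)).differentiable (by norm_num) y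
  have e : ∀ i j, pderiv i (pderiv j f) y =
      fderiv ℝ (fderiv ℝ f) y (EuclideanSpace.single i 1) (EuclideanSpace.single j 1) := by
    intro i j
    have e : fderiv ℝ (pderiv j f) y = _ := fderiv_clm_apply hd (differentiableAt_const _)
    rw [pderiv, e]
    simp
  rw [e, e]
  exact (hf.contDiffAt.isSymmSndFDerivAt (by simp)).eq _ _

/-- Partial derivatives commute with the Laplacian. Openness of `U` is needed because the identity
that is differentiated must hold in a neighbourhood of `x`. -/
theorem laplacian_pderiv_eq_zero {u : E3 → ℝ} (hu : ContDiff ℝ 3 u) {U : Set E3} (hU : IsOpen U)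
    (hharm : ∀ x ∈ U, Laplacian.laplacian u x = 0) (i : Fin 3) {x : E3} (hx : x ∈ U) :
    Laplacian.laplacian (pderiv i u) x = 0 := by
  have hu2 : ContDiff ℝ 2 u := hu.of_le (by norm_num)
  have h1 : ∀ j, ContDiff ℝ 2 (pderiv j u) := fun j => contDiff_pderiv hu (by norm_num) j
  have h2 : ∀ j k, ContDiff ℝ 1 (pderiv k (pderiv j u)) :=
    fun j k => contDiff_pderiv (h1 j) (by norm_num) k
  rw [laplacian_eq_sum_pderiv (h1 i)]
  have e : ∀ j, pderiv j (pderiv j (pderiv i u)) x = pderiv i (pderiv j (pderiv j u)) x := by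
    intro j
    rw [pderiv_comm (h1 j) i j]
    congr 1
    exact funext fun z => pderiv_comm hu2 j i z
  simp only [e]
  have hz : (fun z => ∑ j, pderiv j (pderiv j u) z) =ᶠ[𝓝 x] fun _ => 0 := by
    filter_upwards [hU.mem_nhds hx] with z hz
    rw [← laplacian_eq_sum_pderiv hu2, hharm z hz]
  have h3 := hz.fderiv_eq (𝕜 := ℝ)
  rw [fderiv_fun_sum fun j _ => (h2 j j).differentiable one_ne_zero x] at h3
  have h4 := DFunLike.congr_fun h3 (EuclideanSpace.single i 1)
  simpa [pderiv] using h4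

theorem norm_gradient_sq (u : E3 → ℝ) (y : E3) : ‖∇ u y‖ ^ 2 = ∑ i, pderiv i u y ^ 2 := by
  rw [EuclideanSpace.norm_sq_eq]
  simp [gradient_apply]

/-- Interior estimate for the gradient of a harmonic function. -/
theorem exists_norm_gradient_sq_le : ∃ A, 0 ≤ A ∧ ∀ (u : E3 → ℝ) (y : E3) (r : ℝ),
    ContDiff ℝ 3 u → 0 < r → (∀ x ∈ Metric.ball y r, Laplacian.laplacian u x = 0) →
    r ^ 3 * ‖∇ u y‖ ^ 2 ≤ A * ∫ x in Metric.closedBall y r, ‖∇ u x‖ ^ 2 := by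
  set c := ∫ z, radialKernel z with hc
  have hc0 : 0 < c := integral_radialKernel_pos
  set a := ∫ z in Metric.closedBall 0 1, radialKernel z ^ 2 with ha
  have ha0 : 0 ≤ a := integral_nonneg fun x => sq_nonneg _
  refine ⟨a / c ^ 2, by positivity, fun u y r hu hr hharm => ?_⟩
  have hp : ∀ i, ContDiff ℝ 2 (pderiv i u) := fun i => contDiff_pderiv hu (by norm_num) i
  -- The partial derivatives of `u` are harmonic, so their value at `y` is a weighted mean, which
  -- the Cauchy–Schwarz inequality bounds by the energy in the ball.
  have key : ∀ i, c ^ 2 * pderiv i u y ^ 2 ≤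
      a * ∫ z in Metric.closedBall (0 : E3) 1, pderiv i u (y + r • z) ^ 2 := by
    intro i
    have h1 := integral_mul_radialKernel_of_harmonic (hp i) hr
      (fun x hx => laplacian_pderiv_eq_zero hu Metric.isOpen_ball hharm i hx)
    have h2 : ∫ z in Metric.closedBall (0 : E3) 1, radialKernel z * pderiv i u (y + r • z) =
        ∫ z, pderiv i u (y + r • z) * radialKernel z := by
      rw [setIntegral_eq_integral_of_forall_compl_eq_zero]
      · simp only [mul_comm]
      · intro z hz
        rw [radialKernel_eq_zero, zero_mul]
        exact (not_le.1 fun h => hz (by simpa using h)).le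
    have hcp : Continuous fun z : E3 => pderiv i u (y + r • z) :=
      (hp i).continuous.comp (by fun_prop)
    have hI : ∀ {f : E3 → ℝ}, Continuous f → IntegrableOn f (Metric.closedBall (0 : E3) 1) :=
      fun h => h.continuousOn.integrableOn_compact (isCompact_closedBall _ _)
    have h3 := sq_integral_mul_le (μ := volume.restrict (Metric.closedBall (0 : E3) 1))
      (f := radialKernel) (g := fun z => pderiv i u (y + r • z))
      (hI (continuous_radialKernel.pow 2)) (hI (hcp.pow 2)) (hI (continuous_radialKernel.mul hcp))
    rw [h2, h1] at h3
    calc c ^ 2 * pderiv i u y ^ 2 = (pderiv i u y * c) ^ 2 := by ring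
      _ ≤ _ := h3
  have hscale : ∫ z in Metric.closedBall (0 : E3) 1, ‖∇ u (y + r • z)‖ ^ 2 =
      (r ^ 3)⁻¹ * ∫ x in Metric.closedBall y r, ‖∇ u x‖ ^ 2 := by
    rw [← integral_indicator Metric.isClosed_closedBall.measurableSet,
      ← integral_indicator Metric.isClosed_closedBall.measurableSet]
    have e1 : ∀ z : E3, (Metric.closedBall (0 : E3) 1).indicator
        (fun z => ‖∇ u (y + r • z)‖ ^ 2) z =
        (fun x => (Metric.closedBall y r).indicator (fun x => ‖∇ u x‖ ^ 2) (y + x)) (r • z) := by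
      intro z
      have : z ∈ Metric.closedBall (0 : E3) 1 ↔ y + r • z ∈ Metric.closedBall y r := by
        rw [mem_closedBall_zero_iff, mem_closedBall_iff_norm, add_sub_cancel_left, norm_smul,
          Real.norm_eq_abs, abs_of_pos hr]
        constructor
        · intro h; nlinarith
        · intro h; nlinarith
      by_cases hz : z ∈ Metric.closedBall (0 : E3) 1
      · rw [indicator_of_mem hz]
        simp only
        rw [indicator_of_mem (this.1 hz)]
      · rw [indicator_of_notMem hz]
        simp only
        rw [indicator_of_notMem fun h => hz (this.2 h)]
    simp only [e1]
    rw [Measure.integral_comp_smul volume (fun x => (Metric.closedBall y r).indicator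
      (fun x => ‖∇ u x‖ ^ 2) (y + x)) r, integral_add_left_eq_self]
    rw [finrank_euclideanSpace_fin, abs_of_pos (by positivity), smul_eq_mul]
  have hsum : c ^ 2 * ‖∇ u y‖ ^ 2 ≤
      a * ∫ z in Metric.closedBall (0 : E3) 1, ‖∇ u (y + r • z)‖ ^ 2 := by
    simp only [norm_gradient_sq]
    rw [integral_finsetSum, Finset.mul_sum, Finset.mul_sum]
    · exact Finset.sum_le_sum fun i _ => key i
    · intro i _
      exact (((hp i).continuous.comp (by fun_prop)).pow 2).continuousOn.integrableOn_compact
        (isCompact_closedBall _ _)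
  rw [hscale] at hsum
  rw [div_mul_eq_mul_div, le_div_iff₀ (by positivity)]
  have h4 := mul_le_mul_of_nonneg_left hsum (pow_pos hr 3).le
  calc r ^ 3 * ‖∇ u y‖ ^ 2 * c ^ 2 = r ^ 3 * (c ^ 2 * ‖∇ u y‖ ^ 2) := by ring
    _ ≤ _ := h4
    _ = a * ∫ x in Metric.closedBall y r, ‖∇ u x‖ ^ 2 := by field_simp

/-! ### Uniqueness for the exterior Neumann problem -/

/-- In dimension three two vectors have a common orthogonal direction. It supplies the corner of a
broken line that joins two points of an annulus and stays away from the origin. -/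
theorem exists_orthogonal_norm_eq (x x' : E3) {R : ℝ} (hR : 0 ≤ R) :
    ∃ z : E3, ‖z‖ = R ∧ inner ℝ x z = 0 ∧ inner ℝ x' z = 0 := by
  have h := LinearMap.ker_ne_bot_of_finrank_lt
    (f := ((innerSL ℝ x).toLinearMap.prod (innerSL ℝ x').toLinearMap : E3 →ₗ[ℝ] ℝ × ℝ)) (by simp)
  obtain ⟨v, hv, hv0⟩ := (Submodule.ne_bot_iff _).1 h
  have hv := LinearMap.mem_ker.1 hv
  refine ⟨(R / ‖v‖) • v, ?_, ?_, ?_⟩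
  · rw [norm_smul, Real.norm_eq_abs, abs_of_nonneg (by positivity),
      div_mul_cancel₀ _ (norm_ne_zero_iff.2 hv0)]
  · rw [inner_smul_right]; exact mul_eq_zero_of_right _ (congrArg Prod.fst hv)
  · rw [inner_smul_right]; exact mul_eq_zero_of_right _ (congrArg Prod.snd hv)

/-- The two points are joined through a point `z` of norm `R` orthogonal to both. By Pythagoras the
two segments stay outside the ball of radius `R / 2`, and each has length at most `3 * R`. -/
theorem abs_sub_le_of_norm_gradient_le {u : E3 → ℝ} (hu : ContDiff ℝ 1 u) {R G : ℝ} (hR : 0 < R)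
    (hG : ∀ y, R / 2 ≤ ‖y‖ → ‖∇ u y‖ ≤ G) {x x' : E3} (hx : x ∈ Metric.closedBall 0 (2 * R))
    (hx1 : R ≤ ‖x‖) (hx' : x' ∈ Metric.closedBall 0 (2 * R)) (hx1' : R ≤ ‖x'‖) :
    |u x - u x'| ≤ 6 * R * G := by
  obtain ⟨z, hz, hxz, hxz'⟩ := exists_orthogonal_norm_eq x x' hR.le
  have key : ∀ w : E3, w ∈ Metric.closedBall 0 (2 * R) → R ≤ ‖w‖ → inner ℝ w z = 0 →
      |u w - u z| ≤ G * (3 * R) := by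
    intro w hw hw1 hwz
    rw [mem_closedBall_zero_iff] at hw
    have hb : ∀ y ∈ segment ℝ w z, ‖fderiv ℝ u y‖ ≤ G := by
      intro y hy
      have hn : ‖fderiv ℝ u y‖ = ‖∇ u y‖ := by
        rw [← toDual_gradient, LinearIsometryEquiv.norm_map]
      rw [hn]
      refine hG y ?_
      obtain ⟨a, b, ha, hb, hab, rfl⟩ := hy
      have h1 : ‖a • w + b • z‖ ^ 2 = a ^ 2 * ‖w‖ ^ 2 + b ^ 2 * R ^ 2 := by
        rw [norm_add_sq_real, inner_smul_left, inner_smul_right, hwz, norm_smul, norm_smul, hz]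
        simp [mul_pow]
      have h2 : (R / 2) ^ 2 ≤ ‖a • w + b • z‖ ^ 2 := by
        rw [h1]
        have h3 : a ^ 2 * R ^ 2 ≤ a ^ 2 * ‖w‖ ^ 2 := by gcongr
        have h4 : (1 : ℝ) / 4 ≤ a ^ 2 + b ^ 2 := by nlinarith [sq_nonneg (a - b)]
        nlinarith [sq_nonneg R]
      exact (sq_le_sq₀ (by positivity) (norm_nonneg _)).1 h2
    have hle := (convex_segment w z).norm_image_sub_le_of_norm_fderiv_le (𝕜 := ℝ) (f := u) (C := G)
      (fun y _ => hu.differentiable one_ne_zero y) hb (right_mem_segment ℝ w z)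
      (left_mem_segment ℝ w z)
    have hG0 : 0 ≤ G := (norm_nonneg _).trans (hG z (by linarith))
    rw [Real.norm_eq_abs] at hle
    refine hle.trans ?_
    gcongr
    linarith [norm_sub_le w z]
  have h1 := key x hx hx1 hxz
  have h2 := key x' hx' hx1' hxz'
  rw [abs_sub_comm] at h2
  calc |u x - u x'| ≤ |u x - u z| + |u z - u x'| := abs_sub_le _ _ _
    _ ≤ 6 * R * G := by linarith

/-- A smooth function that is `1` on the ball of radius `R` and `0` outside the ball of radius
`2 R`. -/
def radialCutoff (R : ℝ) (y : E3) : ℝ := Real.smoothTransition (1 - (‖y‖ ^ 2 / R ^ 2 - 1))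

theorem contDiff_radialCutoff (R : ℝ) : ContDiff ℝ 1 (radialCutoff R) :=
  Real.smoothTransition.contDiff.comp
    (contDiff_const.sub (((contDiff_norm_sq ℝ).div_const _).sub contDiff_const))

theorem radialCutoff_eq_one {R : ℝ} {y : E3} (hy : ‖y‖ ≤ R) : radialCutoff R y = 1 := by
  refine Real.smoothTransition.one_of_one_le ?_
  have : ‖y‖ ^ 2 / R ^ 2 ≤ 1 := div_le_one_of_le₀ (by gcongr) (sq_nonneg R)
  linarith

theorem radialCutoff_eq_zero {R : ℝ} (hR : 0 < R) {y : E3} (hy : 2 * R ≤ ‖y‖) :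
    radialCutoff R y = 0 := by
  refine Real.smoothTransition.zero_of_nonpos ?_
  have : 2 ≤ ‖y‖ ^ 2 / R ^ 2 := by
    rw [le_div_iff₀ (by positivity)]
    nlinarith
  linarith

theorem exists_norm_gradient_radialCutoff_le : ∃ D, 0 ≤ D ∧ ∀ R : ℝ, 0 < R → ∀ y : E3,
    ‖∇ (radialCutoff R) y‖ ≤ D / R ∧ (∇ (radialCutoff R) y ≠ 0 → R ≤ ‖y‖ ∧ ‖y‖ ≤ 2 * R) := by
  obtain ⟨D, hD0, hD⟩ := exists_abs_deriv_smoothTransition_le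
  refine ⟨4 * D, by positivity, fun R hR y => ?_⟩
  have h0 : HasFDerivAt (fun z : E3 => 1 - (‖z‖ ^ 2 / R ^ 2 - 1))
      (-((2 / R ^ 2) • (innerSL ℝ) y)) y := by
    have := (((hasStrictFDerivAt_norm_sq y).hasFDerivAt.mul_const (R ^ 2)⁻¹).sub_const 1).const_sub
      (1 : ℝ)
    rw [← Nat.cast_smul_eq_nsmul ℝ, Nat.cast_ofNat, smul_smul] at this
    simpa only [div_eq_mul_inv, mul_comm] using this
  have h1 : ∇ (fun z : E3 => 1 - (‖z‖ ^ 2 / R ^ 2 - 1)) y = -(2 / R ^ 2) • y := by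
    ext i
    rw [gradient_apply, pderiv, h0.fderiv]
    simp [EuclideanSpace.inner_single_right]
  have h2 : ∇ (radialCutoff R) y =
      deriv Real.smoothTransition (1 - (‖y‖ ^ 2 / R ^ 2 - 1)) • -(2 / R ^ 2) • y := by
    rw [← h1]
    exact gradient_comp_real h0.differentiableAt
      ((Real.smoothTransition.contDiff (n := 1)).differentiable one_ne_zero _)
  have h3 : ∇ (radialCutoff R) y ≠ 0 → R ≤ ‖y‖ ∧ ‖y‖ ≤ 2 * R := by
    intro hne
    constructor
    · by_contra! h
      refine hne ?_
      rw [h2, deriv_smoothTransition_of_one_le, zero_smul]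
      have : ‖y‖ ^ 2 / R ^ 2 ≤ 1 := div_le_one_of_le₀ (by gcongr) (sq_nonneg R)
      linarith
    · by_contra! h
      refine hne ?_
      rw [h2, deriv_smoothTransition_of_nonpos, zero_smul]
      have : 2 ≤ ‖y‖ ^ 2 / R ^ 2 := by
        rw [le_div_iff₀ (by positivity)]
        nlinarith
      linarith
  refine ⟨?_, h3⟩
  by_cases hne : ∇ (radialCutoff R) y = 0
  · rw [hne, norm_zero]; positivity
  have hy := (h3 hne).2
  rw [h2, norm_smul, norm_smul, Real.norm_eq_abs, norm_neg, Real.norm_eq_abs,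
    abs_of_nonneg (by positivity : (0 : ℝ) ≤ 2 / R ^ 2)]
  calc |deriv Real.smoothTransition (1 - (‖y‖ ^ 2 / R ^ 2 - 1))| * (2 / R ^ 2 * ‖y‖)
      ≤ D * (2 / R ^ 2 * (2 * R)) := by gcongr; exact hD _
    _ = 4 * D / R := by field_simp; ring

theorem tendsto_setIntegral_norm_ge {G : E3 → ℝ} {Ω : Set E3} (hG : IntegrableOn G Ω) :
    Tendsto (fun R : ℝ => ∫ y in Ω ∩ {y | R ≤ ‖y‖}, G y) atTop (𝓝 0) := by
  have hm : ∀ R : ℝ, MeasurableSet {y : E3 | R ≤ ‖y‖} := fun R =>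
    (isClosed_le continuous_const continuous_norm).measurableSet
  have h : Tendsto (fun R : ℝ => ∫ y in Ω, {y : E3 | R ≤ ‖y‖}.indicator G y) atTop
      (𝓝 (∫ _y in Ω, (0 : ℝ))) := by
    refine tendsto_integral_filter_of_dominated_convergence (fun y => ‖G y‖)
      (Eventually.of_forall fun R => hG.aestronglyMeasurable.indicator (hm R))
      (Eventually.of_forall fun R => Eventually.of_forall fun y => norm_indicator_le_norm_self _ _)
      hG.norm (Eventually.of_forall fun y => ?_)
    refine tendsto_const_nhds.congr' ?_
    filter_upwards [eventually_gt_atTop ‖y‖] with R hR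
    rw [indicator_of_notMem (by simpa using hR)]
  rw [integral_zero] at h
  refine h.congr fun R => ?_
  rw [integral_indicator (hm R), Measure.restrict_restrict (hm R), inter_comm]

theorem abs_setIntegral_le_of_closedBall {g : E3 → ℝ} (hg : Integrable g) (Ω : Set E3) {B R : ℝ}
    (hB : 0 ≤ B) (hR : 0 < R) (hsupp : ∀ y, g y ≠ 0 → ‖y‖ ≤ R ∧ |g y| ≤ B) :
    |∫ y in Ω, g y| ≤ B * (R ^ 3 * volume.real (Metric.closedBall (0 : E3) 1)) := by
  have hmc : MeasurableSet (Metric.closedBall (0 : E3) R) := Metric.isClosed_closedBall.measurableSet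
  have hfin : volume (Metric.closedBall (0 : E3) R) ≠ ⊤ := measure_closedBall_lt_top.ne
  have hi3 : Integrable ((Metric.closedBall (0 : E3) R).indicator fun _ => B) :=
    (integrable_indicator_iff hmc).2 (integrableOn_const hfin)
  have hb : ∀ y, ‖g y‖ ≤ (Metric.closedBall (0 : E3) R).indicator (fun _ => B) y := by
    intro y
    by_cases hy : g y = 0
    · rw [hy, norm_zero]
      exact indicator_nonneg (fun _ _ => hB) _
    · rw [indicator_of_mem (by simpa using (hsupp y hy).1)]
      exact (hsupp y hy).2
  have h1 : |∫ y in Ω, g y| ≤ ∫ y in Ω, ‖g y‖ :=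
    norm_integral_le_integral_norm g
  have h2 : ∫ y in Ω, ‖g y‖ ≤ ∫ y, ‖g y‖ :=
    setIntegral_le_integral hg.norm (Eventually.of_forall fun y => norm_nonneg _)
  have h3 : ∫ y, ‖g y‖ ≤ ∫ y, (Metric.closedBall (0 : E3) R).indicator (fun _ => B) y :=
    integral_mono hg.norm hi3 hb
  have h4 : ∫ y, (Metric.closedBall (0 : E3) R).indicator (fun _ => B) y =
      B * (R ^ 3 * volume.real (Metric.closedBall (0 : E3) 1)) := by
    have h : volume.real (Metric.closedBall (0 : E3) R) =
        R ^ 3 * volume.real (Metric.closedBall (0 : E3) 1) := by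
      have h := Measure.addHaar_closedBall_mul volume (0 : E3) hR.le (zero_le_one (α := ℝ))
      rw [mul_one, finrank_euclideanSpace_fin] at h
      rw [Measure.real, h, ENNReal.toReal_mul, ENNReal.toReal_ofReal (by positivity), Measure.real]
    rw [integral_indicator hmc, setIntegral_const, smul_eq_mul, h, mul_comm]
  linarith

/-- A Caccioppoli estimate: the weak equation is tested with the cut-off times `u - c`, where `c` is
the value of `u` at a point of the sphere of radius `R`. The cross term lives on the annulus between
`R` and `2 * R`. There `|u - c| ≤ 6 * R * G` compensates the factor `1 / R` from the gradient of the
cut-off. -/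
theorem setIntegral_radialCutoff_le {f u : E3 → ℝ} (hf : ContDiff ℝ 2 f)
    (hreg : ∀ p, f p = 0 → fderiv ℝ f p ≠ 0) (hu2 : ContDiff ℝ 2 u)
    (hharm : ∀ y, 0 < f y → Laplacian.laplacian u y = 0)
    (hneu : ∀ y, f y = 0 → inner ℝ (∇ f y) (∇ u y) = 0) {D R G : ℝ} (hD0 : 0 ≤ D) (hR : 0 < R)
    (hD : ∀ y : E3, ‖∇ (radialCutoff R) y‖ ≤ D / R ∧
      (∇ (radialCutoff R) y ≠ 0 → R ≤ ‖y‖ ∧ ‖y‖ ≤ 2 * R))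
    (hG : ∀ y, R / 2 ≤ ‖y‖ → ‖∇ u y‖ ≤ G) :
    ∫ y in {y | 0 < f y}, radialCutoff R y * ‖∇ u y‖ ^ 2 ≤
      6 * D * G ^ 2 * ((2 * R) ^ 3 * volume.real (Metric.closedBall (0 : E3) 1)) := by
  have hu1 : ContDiff ℝ 1 u := hu2.of_le (by norm_num)
  have hgu : Continuous (∇ u) := (contDiff_gradient (k := 0) hu1 (by norm_num)).continuous
  have hG0 : 0 ≤ G := (norm_nonneg _).trans
    (hG (EuclideanSpace.single 0 R) (by simp [abs_of_pos hR]; linarith))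
  set x₀ : E3 := EuclideanSpace.single 0 R with hx₀
  have hx₀n : ‖x₀‖ = R := by simp [hx₀, abs_of_pos hR]
  set c := u x₀ with hc
  have hcut := contDiff_radialCutoff R
  have hcs : HasCompactSupport (radialCutoff R) :=
    HasCompactSupport.intro (isCompact_closedBall 0 (2 * R)) fun z hz =>
      radialCutoff_eq_zero hR (not_le.1 fun h => hz (by simpa using h)).le
  have hgc : Continuous (∇ (radialCutoff R)) :=
    (contDiff_gradient (k := 0) hcut (by norm_num)).continuous
  have huc : ContDiff ℝ 1 fun y => u y - c := hu1.sub contDiff_const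
  have h := integral_inner_gradient_eq_zero hf hreg hu2 hharm hneu
    (η := fun y => radialCutoff R y * (u y - c)) (hcut.mul huc) hcs.mul_right
  have e : ∀ y, inner ℝ (∇ (fun y => radialCutoff R y * (u y - c)) y) (∇ u y) =
      radialCutoff R y * ‖∇ u y‖ ^ 2 + (u y - c) * inner ℝ (∇ (radialCutoff R) y) (∇ u y) := by
    intro y
    rw [gradient_mul (hcut.differentiable one_ne_zero y) (huc.differentiable one_ne_zero y)]
    have : ∇ (fun y => u y - c) y = ∇ u y := by
      simp [gradient, fderiv_sub_const]
    rw [this, inner_add_left, inner_smul_left, inner_smul_left, real_inner_self_eq_norm_sq]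
    simp
  simp only [e] at h
  have hcg : HasCompactSupport (∇ (radialCutoff R)) :=
    (hcs.fderiv ℝ).comp_left (g := (InnerProductSpace.toDual ℝ E3).symm) (map_zero _)
  have i1 : Integrable fun y => radialCutoff R y * ‖∇ u y‖ ^ 2 :=
    (hcut.continuous.mul (hgu.norm.pow 2)).integrable_of_hasCompactSupport hcs.mul_right
  have i2 : Integrable fun y => (u y - c) * inner ℝ (∇ (radialCutoff R) y) (∇ u y) :=
    (huc.continuous.mul (hgc.inner hgu)).integrable_of_hasCompactSupport
      (hcg.mono fun y hy h => hy (by simp [h]))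
  rw [integral_add i1.integrableOn i2.integrableOn] at h
  have hle : |∫ y in {y | 0 < f y}, (u y - c) * inner ℝ (∇ (radialCutoff R) y) (∇ u y)| ≤
      6 * D * G ^ 2 * ((2 * R) ^ 3 * volume.real (Metric.closedBall (0 : E3) 1)) := by
    refine abs_setIntegral_le_of_closedBall i2 _ (by positivity) (by positivity) fun y hy => ?_
    have hy0 : ∇ (radialCutoff R) y ≠ 0 := fun h0 => hy (by simp [h0])
    obtain ⟨hy1, hy2⟩ := (hD y).2 hy0
    refine ⟨hy2, ?_⟩
    have hymem : y ∈ Metric.closedBall (0 : E3) (2 * R) := by simpa using hy2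
    have b1 : |u y - c| ≤ 6 * R * G := abs_sub_le_of_norm_gradient_le hu1 hR
      hG hymem hy1 (by simp only [mem_closedBall_zero_iff, hx₀n]; linarith)
      hx₀n.ge
    have b2 : |inner ℝ (∇ (radialCutoff R) y) (∇ u y)| ≤ D / R * G :=
      (abs_real_inner_le_norm _ _).trans (mul_le_mul (hD y).1
        (hG y (by linarith)) (norm_nonneg _) (by positivity))
    calc |(u y - c) * inner ℝ (∇ (radialCutoff R) y) (∇ u y)|
        = |u y - c| * |inner ℝ (∇ (radialCutoff R) y) (∇ u y)| := abs_mul _ _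
      _ ≤ 6 * R * G * (D / R * G) :=
          mul_le_mul b1 b2 (abs_nonneg _) (by positivity)
      _ = 6 * D * G ^ 2 := by field_simp
  linarith [neg_abs_le (∫ y in {y | 0 < f y}, (u y - c) *
    inner ℝ (∇ (radialCutoff R) y) (∇ u y))]

/-- Uniqueness, up to constants, of the solutions of finite energy of the exterior Neumann
problem. -/
theorem gradient_eq_zero_of_neumann_zero {f u : E3 → ℝ} (hf : ContDiff ℝ 2 f)
    (hreg : ∀ p, f p = 0 → fderiv ℝ f p ≠ 0) (hcomp : IsCompact {y | f y ≤ 0})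
    (hu : ContDiff ℝ 3 u) (hharm : ∀ y, 0 < f y → Laplacian.laplacian u y = 0)
    (hneu : ∀ y, f y = 0 → inner ℝ (∇ f y) (∇ u y) = 0)
    (hL2 : IntegrableOn (fun y => ‖∇ u y‖ ^ 2) {y | 0 < f y}) :
    ∀ y, 0 < f y → ∇ u y = 0 := by
  set Ω := {y | 0 < f y} with hΩ
  have hΩo : IsOpen Ω := isOpen_lt continuous_const hf.continuous
  have hu1 : ContDiff ℝ 1 u := hu.of_le (by norm_num)
  have hu2 : ContDiff ℝ 2 u := hu.of_le (by norm_num)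
  have hgu : Continuous (∇ u) := (contDiff_gradient (k := 0) hu1 (by norm_num)).continuous
  obtain ⟨A, hA0, hA⟩ := exists_norm_gradient_sq_le
  obtain ⟨D, hD0, hD⟩ := exists_norm_gradient_radialCutoff_le
  obtain ⟨R₀, hR₀⟩ := hcomp.isBounded.subset_ball 0
  set T : ℝ → ℝ := fun s => ∫ y in Ω ∩ {y | s ≤ ‖y‖}, ‖∇ u y‖ ^ 2 with hT
  have hT0 : ∀ s, 0 ≤ T s := fun s => integral_nonneg fun y => by positivity
  set V := volume.real (Metric.closedBall (0 : E3) 1) with hV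
  have hΩmem : ∀ y : E3, R₀ ≤ ‖y‖ → 0 < f y := by
    intro y hy
    by_contra! h
    have := hR₀ h
    rw [mem_ball_zero_iff] at this
    linarith
  -- For `‖y‖ ≥ R / 2` the ball of radius `R / 4` around `y` lies in the fluid and outside the ball
  -- of radius `R / 4` around the origin. The interior estimate then bounds `‖∇ u y‖ ^ 2` by the
  -- tail energy divided by `R ^ 3`.
  have hdecay : ∀ R, 0 < R → 4 * R₀ ≤ R → ∀ y : E3, R / 2 ≤ ‖y‖ →
      ‖∇ u y‖ ≤ Real.sqrt (64 * A * T (R / 4) / R ^ 3) := by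
    intro R hR hRR y hy
    refine Real.le_sqrt_of_sq_le ?_
    have h1 := hA u y (R / 4) hu (by positivity) (fun x hx => by
      refine hharm x (hΩmem x ?_)
      rw [mem_ball_iff_norm] at hx
      have := norm_sub_norm_le y x
      rw [norm_sub_rev] at this
      linarith)
    have h2 : ∫ x in Metric.closedBall y (R / 4), ‖∇ u x‖ ^ 2 ≤ T (R / 4) := by
      refine setIntegral_mono_set (hL2.mono_set inter_subset_left)
        (Eventually.of_forall fun y => by positivity) (Eventually.of_forall fun x hx => ?_)
      have hx : x ∈ Metric.closedBall y (R / 4) := hx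
      rw [mem_closedBall_iff_norm] at hx
      have := norm_sub_norm_le y x
      rw [norm_sub_rev] at this
      have h3 : R / 4 ≤ ‖x‖ := by linarith
      exact ⟨hΩmem x (by linarith), h3⟩
    rw [le_div_iff₀ (by positivity)]
    have h3 := h1.trans (mul_le_mul_of_nonneg_left h2 hA0)
    nlinarith
  -- The factor `R ^ 3` of the volume cancels the decay rate of `G ^ 2`. What remains is a constant,
  -- `3072 = 6 * 64 * 8`, times the tail energy, which tends to `0`.
  have henergy : ∀ R, 0 < R → 4 * R₀ ≤ R →
      ∫ y in Ω, radialCutoff R y * ‖∇ u y‖ ^ 2 ≤ 3072 * D * A * V * T (R / 4) := by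
    intro R hR hRR
    refine (setIntegral_radialCutoff_le hf hreg hu2 hharm hneu hD0 hR (hD R hR)
      (hdecay R hR hRR)).trans (le_of_eq ?_)
    rw [Real.sq_sqrt (by have := hT0 (R / 4); positivity)]
    field_simp
    ring
  have hlim : Tendsto (fun n : ℕ => ∫ y in Ω, radialCutoff n y * ‖∇ u y‖ ^ 2) atTop
      (𝓝 (∫ y in Ω, ‖∇ u y‖ ^ 2)) := by
    refine tendsto_integral_of_dominated_convergence (fun y => ‖∇ u y‖ ^ 2)
      (fun n => ((contDiff_radialCutoff n).continuous.mul (hgu.norm.pow 2)).aestronglyMeasurable)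
      hL2 (fun n => Eventually.of_forall fun y => ?_) (Eventually.of_forall fun y => ?_)
    · rw [norm_mul, Real.norm_eq_abs, radialCutoff, abs_of_nonneg (Real.smoothTransition.nonneg _),
        Real.norm_eq_abs, abs_of_nonneg (by positivity)]
      exact mul_le_of_le_one_left (by positivity) (Real.smoothTransition.le_one _)
    · refine tendsto_const_nhds.congr' ?_
      obtain ⟨N, hN⟩ := exists_nat_ge ‖y‖
      filter_upwards [eventually_ge_atTop N] with n hn
      rw [radialCutoff_eq_one (hN.trans (by exact_mod_cast hn)), one_mul]
  have hTlim : Tendsto (fun n : ℕ => 3072 * D * A * V * T ((n : ℝ) / 4)) atTop (𝓝 0) := by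
    have h1 := ((tendsto_setIntegral_norm_ge hL2).comp
      (tendsto_natCast_atTop_atTop.atTop_div_const (by norm_num : (0 : ℝ) < 4))).const_mul
      (3072 * D * A * V)
    simpa using h1
  have hzero : ∫ y in Ω, ‖∇ u y‖ ^ 2 = 0 := by
    refine le_antisymm (le_of_tendsto_of_tendsto hlim hTlim ?_)
      (integral_nonneg fun y => by positivity)
    obtain ⟨N, hN⟩ := exists_nat_ge (4 * R₀)
    filter_upwards [eventually_ge_atTop N, eventually_gt_atTop 0] with n hn hn0
    exact henergy n (by exact_mod_cast hn0) (hN.trans (by exact_mod_cast hn))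
  have hae := (setIntegral_eq_zero_iff_of_nonneg_ae (Eventually.of_forall fun y => by positivity)
    hL2).1 hzero
  have heq : EqOn (fun y => ‖∇ u y‖ ^ 2) 0 Ω :=
    Measure.eqOn_open_of_ae_eq hae hΩo (hgu.norm.pow 2).continuousOn continuousOn_const
  intro y hy
  simpa using heq hy

/-! ### Reflections -/

/-- The sign of the coordinate `i` under the reflection `p`. -/
def rsign (p i : Fin 3) : ℝ := if i = p then -1 else 1

theorem rsign_mul_self (p i : Fin 3) : rsign p i * rsign p i = 1 := by
  unfold rsign; split_ifs <;> norm_num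

theorem reflect_apply (p : Fin 3) (y : E3) (i : Fin 3) : reflect p y i = rsign p i * y i := by
  simp only [reflect, rsign]
  split_ifs <;> simp

/-- The reflection as a linear isometry. -/
def reflectL (p : Fin 3) : E3 ≃ₗᵢ[ℝ] E3 :=
  LinearIsometryEquiv.piLpCongrRight 2 fun i =>
    if i = p then LinearIsometryEquiv.neg ℝ else LinearIsometryEquiv.refl ℝ ℝ

theorem coe_reflectL (p : Fin 3) : ⇑(reflectL p) = reflect p := by
  ext y i
  rw [reflect_apply]
  simp only [reflectL, LinearIsometryEquiv.piLpCongrRight_apply, rsign]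
  split_ifs <;> simp

theorem reflect_reflect (p : Fin 3) (y : E3) : reflect p (reflect p y) = y := by
  ext i
  rw [reflect_apply, reflect_apply, ← mul_assoc, rsign_mul_self, one_mul]

theorem inner_reflect_reflect (p : Fin 3) (x y : E3) :
    inner ℝ (reflect p x) (reflect p y) = inner ℝ x y := by
  rw [← coe_reflectL, LinearIsometryEquiv.inner_map_map]

theorem norm_reflect (p : Fin 3) (x : E3) : ‖reflect p x‖ = ‖x‖ := by
  rw [← coe_reflectL, LinearIsometryEquiv.norm_map]

theorem reflect_smul (p : Fin 3) (c : ℝ) (x : E3) : reflect p (c • x) = c • reflect p x := by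
  rw [← coe_reflectL, map_smul]

/-- A reflection has determinant `-1`, so a cross product of reflected vectors acquires one more
sign than a vector does. All the sign differences between translations and rotations come from here.
-/
theorem cross_reflect (p : Fin 3) (x y : E3) (i : Fin 3) :
    cross (reflect p x) (reflect p y) i = -rsign p i * cross x y i := by
  fin_cases p <;> fin_cases i <;>
    simp [cross, cross_apply, reflect_apply, rsign] <;> ring

theorem cross_smul_right (x y : E3) (c : ℝ) (i : Fin 3) :
    cross x (c • y) i = c * cross x y i := by
  simp [cross]

theorem contDiff_reflect (p : Fin 3) {n : ℕ∞ω} : ContDiff ℝ n (reflect p) := by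
  rw [← coe_reflectL]
  exact (reflectL p).contDiff

theorem pderiv_comp_reflect {f : E3 → ℝ} (hf : ContDiff ℝ 1 f) (p i : Fin 3) (y : E3) :
    pderiv i (fun y => f (reflect p y)) y = rsign p i * pderiv i f (reflect p y) := by
  have h := ((hf.differentiable one_ne_zero (reflectL p y)).hasFDerivAt.comp y
    (reflectL p).toContinuousLinearEquiv.hasFDerivAt).fderiv
  simp only [Function.comp_def, coe_reflectL] at h
  have e : reflectL p (EuclideanSpace.single i 1) = rsign p i • EuclideanSpace.single i (1 : ℝ) := by
    rw [coe_reflectL]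
    ext j
    rw [reflect_apply]
    by_cases h : j = i
    · subst h; simp
    · simp [h]
  rw [pderiv, h]
  simp [e, pderiv]

theorem gradient_comp_reflect {f : E3 → ℝ} (hf : ContDiff ℝ 1 f) (p : Fin 3) (y : E3) :
    ∇ (fun y => f (reflect p y)) y = reflect p (∇ f (reflect p y)) := by
  ext i
  rw [gradient_apply, pderiv_comp_reflect hf, reflect_apply, gradient_apply]

theorem laplacian_comp_reflect {f : E3 → ℝ} (hf : ContDiff ℝ 2 f) (p : Fin 3) (y : E3) :
    Laplacian.laplacian (fun y => f (reflect p y)) y = Laplacian.laplacian f (reflect p y) := by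
  have h : ContDiff ℝ 2 fun y => f (reflect p y) := hf.comp (contDiff_reflect p)
  rw [laplacian_eq_sum_pderiv h, laplacian_eq_sum_pderiv hf]
  refine Finset.sum_congr rfl fun i _ => ?_
  have h1 : pderiv i (fun y => f (reflect p y)) = fun y => rsign p i * pderiv i f (reflect p y) :=
    funext fun y => pderiv_comp_reflect (hf.of_le (by norm_num)) p i y
  have h2 := pderiv_comp_reflect (contDiff_pderiv hf (k := 1) (by norm_num) i) p i y
  have h3 : DifferentiableAt ℝ (fun z => pderiv i f (reflect p z)) y :=
    ((contDiff_pderiv hf (k := 1) (by norm_num) i).comp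
      (contDiff_reflect p)).differentiable one_ne_zero y
  rw [h1, pderiv, fderiv_const_mul h3]
  simp only [_root_.smul_apply, smul_eq_mul]
  rw [← pderiv, h2, ← mul_assoc, rsign_mul_self, one_mul]

/-! ### Sets with a regular defining function -/

theorem eventually_pos_of_inner_pos {f : E3 → ℝ} {p v : E3} (hf : DifferentiableAt ℝ f p)
    (h0 : f p = 0) (hv : 0 < inner ℝ (∇ f p) v) : ∀ᶠ t in 𝓝[>] (0 : ℝ), 0 < f (p + t • v) := by
  have h1 : HasDerivAt (fun t : ℝ => p + t • v) v 0 := by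
    simpa using ((hasDerivAt_id (0 : ℝ)).smul_const v).const_add p
  have h2 : HasDerivAt (fun t : ℝ => f (p + t • v)) (fderiv ℝ f p v) 0 := by
    have h3 : HasFDerivAt f (fderiv ℝ f p) (p + (0 : ℝ) • v) := by simpa using hf.hasFDerivAt
    exact h3.comp_hasDerivAt 0 h1
  rw [inner_gradient_left] at hv
  have h3 := (hasDerivAt_iff_tendsto_slope.1 h2).eventually_const_lt hv
  have h4 : ∀ᶠ t in 𝓝[>] (0 : ℝ), 0 < slope (fun t : ℝ => f (p + t • v)) 0 t :=
    h3.filter_mono (nhdsWithin_mono _ fun t ht => ne_of_gt ht)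
  filter_upwards [h4, self_mem_nhdsWithin] with t ht ht0
  rw [slope_def_field] at ht
  simp only [sub_zero, zero_smul, add_zero, h0] at ht
  exact (div_pos_iff_of_pos_right ht0).1 ht

/-- A zero of `f` is a limit of points where `f > 0`: move from it in the direction of the nonzero
gradient. -/
theorem frontier_pos_eq {f : E3 → ℝ} (hf : ContDiff ℝ 1 f) (hreg : ∀ y, f y = 0 → ∇ f y ≠ 0) :
    frontier {y | 0 < f y} = {y | f y = 0} := by
  have ho : IsOpen {y | 0 < f y} := isOpen_lt continuous_const hf.continuous
  refine Subset.antisymm (fun y hy => ?_) fun y hy => ?_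
  · exact (frontier_lt_subset_eq continuous_const hf.continuous hy : (0 : ℝ) = f y).symm
  · have hy : f y = 0 := hy
    rw [ho.frontier_eq]
    refine ⟨?_, fun h => (ne_of_gt h) hy⟩
    have h1 := eventually_pos_of_inner_pos (hf.differentiable one_ne_zero y) hy (v := ∇ f y)
      (by rw [real_inner_self_eq_norm_sq]; have := norm_pos_iff.2 (hreg y hy); positivity)
    have h2 : Tendsto (fun t : ℝ => y + t • ∇ f y) (𝓝[>] 0) (𝓝 y) := by
      have : Continuous fun t : ℝ => y + t • ∇ f y := by fun_prop
      have := this.tendsto 0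
      simp only [zero_smul, add_zero] at this
      exact this.mono_left nhdsWithin_le_nhds
    exact mem_closure_of_tendsto h2 h1

/-- Used to compare two defining functions of the same domain at a common boundary point. Let `d` be
the component of `b` orthogonal to `a`. The vector `τ • a - d` is in the open half-space of `a` for
every `τ > 0`, but its product with `b` is negative for small `τ` unless `d = 0`. -/
theorem eq_pos_smul_of_halfSpace {a b : E3} (ha : a ≠ 0) (hb : b ≠ 0)
    (h : ∀ v, 0 < inner ℝ a v → 0 ≤ inner ℝ b v) : ∃ c : ℝ, 0 < c ∧ b = c • a := by
  have ha0 : 0 < ‖a‖ ^ 2 := by have := norm_pos_iff.2 ha; positivity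
  set c := inner ℝ b a / ‖a‖ ^ 2 with hc
  set d := b - c • a with hd
  have had : inner ℝ a d = 0 := by
    rw [hd, inner_sub_right, inner_smul_right, real_inner_self_eq_norm_sq, hc,
      div_mul_cancel₀ _ ha0.ne', real_inner_comm, sub_self]
  have hbd : b = c • a + d := by rw [hd]; abel
  clear_value d c
  have hd0 : d = 0 := by
    by_contra hne
    have hdp : 0 < ‖d‖ ^ 2 := by have := norm_pos_iff.2 hne; positivity
    have key : ∀ τ : ℝ, 0 < τ → 0 ≤ c * τ * ‖a‖ ^ 2 - ‖d‖ ^ 2 := by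
      intro τ hτ
      have h1 := h (τ • a - d) (by
        rw [inner_sub_right, inner_smul_right, real_inner_self_eq_norm_sq, had]
        have := mul_pos hτ ha0
        linarith)
      rw [hbd, inner_add_left, inner_smul_left, inner_sub_right, inner_sub_right, inner_smul_right,
        inner_smul_right, real_inner_self_eq_norm_sq, real_inner_self_eq_norm_sq, had,
        real_inner_comm a d, had] at h1
      simp only [conj_trivial] at h1
      linarith
    -- If `c ≤ 0`, any `τ` contradicts `key`; otherwise `τ` is chosen to make the first term equal
    -- to `‖d‖ ^ 2 / 2`.
    rcases le_or_gt c 0 with h0 | h0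
    · have := key 1 one_pos
      nlinarith
    · have := key (‖d‖ ^ 2 / (2 * c * ‖a‖ ^ 2)) (by positivity)
      have e : c * (‖d‖ ^ 2 / (2 * c * ‖a‖ ^ 2)) * ‖a‖ ^ 2 = ‖d‖ ^ 2 / 2 := by field_simp
      rw [e] at this
      linarith
  rw [hd0, add_zero] at hbd
  refine ⟨c, ?_, hbd⟩
  have h1 := h a (by rw [real_inner_self_eq_norm_sq]; exact ha0)
  rw [hbd, inner_smul_left, real_inner_self_eq_norm_sq] at h1
  have h2 : 0 ≤ c := nonneg_of_mul_nonneg_left (by simpa using h1) ha0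
  refine h2.lt_of_ne fun h0 => hb ?_
  rw [hbd, ← h0, zero_smul]

/-- Only the set where `f` is positive is symmetric, not `f` itself. At a boundary point, a
direction that enters the domain for `f` cannot leave it for the reflected function, so the two
gradients are positive multiples of each other. After normalization the factor disappears. -/
theorem outwardNormal_reflect {f : E3 → ℝ} (hf : ContDiff ℝ 1 f)
    (hreg : ∀ y, f y = 0 → ∇ f y ≠ 0) {p : Fin 3} (hpos : ∀ y, 0 < f y → 0 < f (reflect p y))
    {y : E3} (hy : f y = 0) (hy' : f (reflect p y) = 0) :
    outwardNormal f (reflect p y) = reflect p (outwardNormal f y) := by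
  have hfr : ContDiff ℝ 1 fun y => f (reflect p y) := hf.comp (contDiff_reflect p)
  have hgr := gradient_comp_reflect hf p y
  have hb : ∇ (fun y => f (reflect p y)) y ≠ 0 := by
    rw [hgr]
    intro h0
    have := norm_reflect p (∇ f (reflect p y))
    rw [h0, norm_zero] at this
    exact hreg _ hy' (norm_eq_zero.1 this.symm)
  obtain ⟨c, hc, hcb⟩ := eq_pos_smul_of_halfSpace (hreg y hy) hb fun v hv => by
    by_contra! hlt
    have h1 := eventually_pos_of_inner_pos (hf.differentiable one_ne_zero y) hy hv
    have h2 := eventually_pos_of_inner_pos (f := fun y => -f (reflect p y)) (p := y) (v := v)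
      (hfr.neg.differentiable one_ne_zero y) (by simp [hy'])
      (by
        rw [inner_gradient_left, fderiv_fun_neg, _root_.neg_apply, ← inner_gradient_left]
        linarith)
    obtain ⟨t, ht1, ht2⟩ := (h1.and h2).exists
    have := hpos _ ht1
    linarith
  have h3 : ∇ f (reflect p y) = c • reflect p (∇ f y) := by
    rw [← reflect_reflect p (∇ f (reflect p y)), ← hgr, hcb, reflect_smul]
  rw [outwardNormal, outwardNormal, h3, norm_smul, norm_reflect, ← smul_neg, ← smul_neg, ← smul_neg,
    reflect_smul, Real.norm_eq_abs, abs_of_pos hc]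
  have h4 : reflect p (-∇ f y) = -reflect p (∇ f y) := by
    rw [← coe_reflectL, map_neg]
  rw [h4, smul_smul, mul_inv, mul_comm c⁻¹, mul_assoc, inv_mul_cancel₀ hc.ne', mul_one]

/-! ### Equivariance of the potentials -/

/-- The difference between `u` composed with the reflection and `ε * u` is harmonic, of finite
energy, with zero Neumann data. By uniqueness its gradient vanishes in `Ω`, and on the closure by
continuity. -/
theorem IsPotential.gradient_reflect {Ω : Set E3} {f g u : E3 → ℝ} (hf : ContDiff ℝ ∞ f)
    (hΩ : Ω = {y | 0 < f y}) (hreg : ∀ y, f y = 0 → ∇ f y ≠ 0) (hcomp : IsCompact Ωᶜ)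
    (hu : IsPotential Ω f g u) {p : Fin 3} (hp : reflect p '' Ω = Ω) {ε : ℝ}
    (hg : ∀ y ∈ frontier Ω, g (reflect p y) = ε * g y) {y : E3} (hy : y ∈ closure Ω) :
    ∇ u (reflect p y) = ε • reflect p (∇ u y) := by
  have hf1 : ContDiff ℝ 1 f := hf.of_le (by exact_mod_cast le_top)
  have hf2 : ContDiff ℝ 2 f := hf.of_le (by norm_cast)
  have hu1 : ContDiff ℝ 1 u := hu.smooth.of_le (by exact_mod_cast le_top)
  have hu2 : ContDiff ℝ 2 u := hu.smooth.of_le (by norm_cast)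
  have hu3 : ContDiff ℝ 3 u := hu.smooth.of_le (by norm_cast)
  have hfrontier : frontier Ω = {y | f y = 0} := hΩ ▸ frontier_pos_eq hf1 hreg
  have hmem : ∀ y, y ∈ Ω → reflect p y ∈ Ω := fun y hy => hp ▸ mem_image_of_mem _ hy
  have hpre : reflect p ⁻¹' Ω = Ω := by
    ext y
    exact ⟨fun h => by simpa [reflect_reflect] using hmem _ h, hmem y⟩
  have hfr : ∀ y ∈ frontier Ω, reflect p y ∈ frontier Ω := by
    intro y hy
    have h1 := (reflectL p).toHomeomorph.preimage_frontier Ω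
    have e : ⇑(reflectL p).toHomeomorph = reflect p := coe_reflectL p
    rw [e, hpre] at h1
    rw [← h1] at hy
    exact hy
  set w : E3 → ℝ := fun y => u (reflect p y) - ε * u y with hw
  have hur : ContDiff ℝ 3 fun y => u (reflect p y) := hu3.comp (contDiff_reflect p)
  have hur1 : ContDiff ℝ 1 fun y => u (reflect p y) := hu1.comp (contDiff_reflect p)
  have hur2 : ContDiff ℝ 2 fun y => u (reflect p y) := hu2.comp (contDiff_reflect p)
  have hw3 : ContDiff ℝ 3 w := hur.sub (contDiff_const.mul hu3)
  have hgw : ∀ y, ∇ w y = reflect p (∇ u (reflect p y)) - ε • ∇ u y := by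
    intro y
    ext i
    have h1 := congrArg (fun v : E3 => v i) (gradient_comp_reflect hu1 p y)
    simp only [gradient_apply, PiLp.sub_apply, PiLp.smul_apply, smul_eq_mul] at h1 ⊢
    rw [← h1]
    simp only [pderiv, hw]
    rw [fderiv_fun_sub (hur1.differentiable one_ne_zero y)
      ((hu1.differentiable one_ne_zero y).const_mul ε),
      fderiv_const_mul (hu1.differentiable one_ne_zero y)]
    simp
  have hlap : ∀ y, 0 < f y → Laplacian.laplacian w y = 0 := by
    intro y hy
    have hyΩ : y ∈ Ω := by rw [hΩ]; exact hy
    have e : w = (fun y => u (reflect p y)) + (-ε) • u := by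
      ext z; simp [hw]; ring
    rw [e, ContDiffAt.laplacian_add (f₂ := (-ε) • u) hur2.contDiffAt
        (hu2.contDiffAt.const_smul (-ε)),
      InnerProductSpace.laplacian_smul _ hu2.contDiffAt, laplacian_comp_reflect hu2,
      (hu.harmonic y hyΩ).2.self_of_nhds, (hu.harmonic _ (hmem y hyΩ)).2.self_of_nhds]
    simp
  have hpos : ∀ y, 0 < f y → 0 < f (reflect p y) := by
    intro y hy
    have := hmem y (by rw [hΩ]; exact hy)
    rw [hΩ] at this
    exact this
  have hneu : ∀ y, f y = 0 → inner ℝ (∇ f y) (∇ w y) = 0 := by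
    intro y hy
    have hyf : y ∈ frontier Ω := by rw [hfrontier]; exact hy
    have hyf' := hfr y hyf
    have hy' : f (reflect p y) = 0 := by rw [hfrontier] at hyf'; exact hyf'
    have h1 : inner ℝ (∇ w y) (outwardNormal f y) = 0 := by
      rw [hgw, inner_sub_left, inner_smul_left, hu.neumann y hyf, ← inner_reflect_reflect p,
        reflect_reflect, ← outwardNormal_reflect hf1 hreg hpos hy hy', hu.neumann _ hyf',
        hg y hyf]
      simp
    rw [outwardNormal, inner_neg_right, inner_smul_right, neg_eq_zero] at h1
    rw [real_inner_comm]
    exact (mul_eq_zero.1 h1).resolve_left (inv_ne_zero (norm_ne_zero_iff.2 (hreg y hy)))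
  have hL2 : IntegrableOn (fun y => ‖∇ w y‖ ^ 2) {y | 0 < f y} := by
    have hmp : MeasurePreserving (reflectL p) (volume.restrict Ω) (volume.restrict Ω) := by
      have h1 := (reflectL p).measurePreserving.restrict_preimage
        (s := Ω) (by rw [hΩ]; exact (isOpen_lt continuous_const hf1.continuous).measurableSet)
      rwa [coe_reflectL, hpre, ← coe_reflectL] at h1
    have h2 : MemLp (fun y => reflectL p (∇ u (reflectL p y))) 2 (volume.restrict Ω) :=
      (reflectL p).toContinuousLinearEquiv.toContinuousLinearMap.comp_memLp'
        (hu.finite_energy.comp_measurePreserving hmp)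
    have h3 : MemLp (∇ w) 2 (volume.restrict Ω) := by
      have h4 := h2.sub (hu.finite_energy.const_smul ε)
      refine (memLp_congr_ae (Eventually.of_forall fun y => ?_)).1 h4
      rw [hgw]
      simp [coe_reflectL]
    rw [hΩ] at h3
    exact h3.integrable_norm_pow two_ne_zero
  have hreg' : ∀ y, f y = 0 → fderiv ℝ f y ≠ 0 := by
    intro y hy h0
    exact hreg y hy (by simp [gradient, h0])
  have hcomp' : IsCompact {y | f y ≤ 0} := by
    convert hcomp using 1
    ext z
    simp [hΩ]
  have hzero := gradient_eq_zero_of_neumann_zero hf2 hreg' hcomp' hw3 hlap hneu hL2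
  have hcont : Continuous (∇ w) :=
    (contDiff_gradient (k := 0) (hw3.of_le (by norm_num) : ContDiff ℝ 1 w) (by norm_num)).continuous
  have hcl : ∇ w y = 0 := by
    have : closure Ω ⊆ {y | ∇ w y = 0} :=
      closure_minimal (fun z hz => hzero z (by rw [hΩ] at hz; exact hz))
        (isClosed_eq hcont continuous_const)
    exact this hy
  rw [hgw, sub_eq_zero] at hcl
  rw [← reflect_reflect p (∇ u (reflect p y)), hcl, reflect_smul]

namespace Vehicle

variable {m : ℕ} (V : Vehicle m)

/-! ### Entries that vanish by symmetry -/

/-- Under the reflection `p`, the gradient of `u` is equivariant up to the sign `ε`. -/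
def HasParity (p : Fin 3) (ε : ℝ) (u : E3 → ℝ) : Prop :=
  ∀ y ∈ closure V.fluid, ∇ u (reflect p y) = ε • reflect p (∇ u y)

theorem fluid_eq_pos : V.fluid = {y | 0 < V.bdf y} := V.fluid_eq

theorem isOpen_fluid : IsOpen V.fluid := V.solid_compact.isClosed.isOpen_compl

theorem frontier_fluid : frontier V.fluid = {y | V.bdf y = 0} := by
  rw [fluid_eq_pos]
  exact frontier_pos_eq (V.bdf_smooth.of_le (by norm_cast)) V.bdf_regular

theorem preimage_reflect_fluid {p : Fin 3} (hp : reflect p '' V.fluid = V.fluid) :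
    reflect p ⁻¹' V.fluid = V.fluid := by
  conv_lhs => rw [← hp]
  rw [← coe_reflectL]
  exact preimage_image_eq _ (reflectL p).injective

theorem preimage_reflect_frontier {p : Fin 3} (hp : reflect p '' V.fluid = V.fluid) :
    reflect p ⁻¹' frontier V.fluid = frontier V.fluid := by
  have h1 := (reflectL p).toHomeomorph.preimage_frontier V.fluid
  have e : ⇑(reflectL p).toHomeomorph = reflect p := coe_reflectL p
  rw [e, preimage_reflect_fluid V hp] at h1
  exact h1

theorem hasParity_of_isPotential {p : Fin 3} (hp : reflect p '' V.fluid = V.fluid)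
    {g u : E3 → ℝ} (hu : IsPotential V.solidᶜ V.bdf g u) {ε : ℝ}
    (hg : ∀ y ∈ frontier V.fluid, g (reflect p y) = ε * g y) : V.HasParity p ε u := fun _ hy =>
  hu.gradient_reflect V.bdf_smooth V.fluid_eq V.bdf_regular (by simpa using V.solid_compact) hp hg hy

theorem outwardNormal_reflect_of_frontier {p : Fin 3} (hp : reflect p '' V.fluid = V.fluid) {y : E3}
    (hy : y ∈ frontier V.fluid) :
    outwardNormal V.bdf (reflect p y) = reflect p (outwardNormal V.bdf y) := by
  have hy' : reflect p y ∈ frontier V.fluid := by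
    rw [← preimage_reflect_frontier V hp] at hy
    exact hy
  rw [frontier_fluid] at hy hy'
  refine Underwater.outwardNormal_reflect (V.bdf_smooth.of_le (by norm_cast)) V.bdf_regular
    (fun z hz => ?_) hy hy'
  have h1 : reflect p z ∈ V.fluid := by
    rw [← hp]
    exact mem_image_of_mem _ (by rw [fluid_eq_pos]; exact hz)
  rw [fluid_eq_pos] at h1
  exact h1

theorem hasParity_φ {p : Fin 3} (hp : reflect p '' V.fluid = V.fluid) (i : Fin 3) :
    V.HasParity p (rsign p i) (V.φ i) :=
  V.hasParity_of_isPotential hp (V.φ_spec i) fun y hy => by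
    simp only
    rw [outwardNormal_reflect_of_frontier V hp hy, reflect_apply]

/-- The Neumann data is a component of `y × ν`, a pseudovector; hence the sign opposite to that of
the translations. -/
theorem hasParity_φr {p : Fin 3} (hp : reflect p '' V.fluid = V.fluid) (i : Fin 3) :
    V.HasParity p (-rsign p i) (V.φr i) :=
  V.hasParity_of_isPotential hp (V.φr_spec i) fun y hy => by
    simp only
    rw [outwardNormal_reflect_of_frontier V hp hy, cross_reflect]

theorem hasParity_ψ [NeZero m] {p : Fin 3} (hp : reflect p '' V.fluid = V.fluid)
    (hχ : ∀ y ∈ frontier V.fluid, V.χ 0 (reflect p y) = V.χ 0 y) :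
    V.HasParity p 1 (V.ψ 0) :=
  V.hasParity_of_isPotential hp (V.ψ_spec 0) fun y hy => by
    rw [hχ y hy, one_mul]

theorem setIntegral_fluid_eq_zero {p : Fin 3} (hp : reflect p '' V.fluid = V.fluid) {f : E3 → ℝ}
    (hf : ∀ y ∈ V.fluid, f (reflect p y) = -f y) : ∫ y in V.fluid, f y = 0 := by
  have hmp := (reflectL p).measurePreserving.setIntegral_preimage_emb
    (reflectL p).toHomeomorph.measurableEmbedding f V.fluid
  rw [coe_reflectL, preimage_reflect_fluid V hp,
    setIntegral_congr_fun V.isOpen_fluid.measurableSet hf, integral_neg] at hmp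
  linarith

/-- The reflection is an isometry, so it preserves the two-dimensional Hausdorff measure, and it
maps the boundary to itself. -/
theorem bint_eq_zero {p : Fin 3} (hp : reflect p '' V.fluid = V.fluid) {f : E3 → ℝ}
    (hf : ∀ y ∈ frontier V.fluid, f (reflect p y) = -f y) : V.bint f = 0 := by
  have hmp := ((reflectL p).toIsometryEquiv.measurePreserving_euclideanHausdorffMeasure
    2).setIntegral_preimage_emb (reflectL p).toHomeomorph.measurableEmbedding f (frontier V.fluid)
  have e : ⇑(reflectL p).toIsometryEquiv = reflect p := coe_reflectL p
  rw [e, preimage_reflect_frontier V hp,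
    setIntegral_congr_fun isClosed_frontier.measurableSet hf, integral_neg] at hmp
  rw [bint]
  linarith

theorem energy_eq_zero {p : Fin 3} (hp : reflect p '' V.fluid = V.fluid) {u v : E3 → ℝ} {ε ε' : ℝ}
    (hu : V.HasParity p ε u) (hv : V.HasParity p ε' v) (h : ε * ε' = -1) :
    ∫ y in V.fluid, inner ℝ (∇ u y) (∇ v y) = 0 :=
  V.setIntegral_fluid_eq_zero hp fun y hy => by
    rw [hu y (subset_closure hy), hv y (subset_closure hy), inner_smul_left, inner_smul_right,
      inner_reflect_reflect, ← mul_assoc]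
    simp [h]

theorem bint_gradient_eq_zero {p : Fin 3} (hp : reflect p '' V.fluid = V.fluid) {u χ : E3 → ℝ}
    {ε : ℝ} (hu : V.HasParity p ε u) (hχ : ∀ y ∈ frontier V.fluid, χ (reflect p y) = χ y)
    {i : Fin 3} (h : rsign p i * ε = -1) : V.bint (fun y => ∇ u y i * χ y) = 0 :=
  V.bint_eq_zero hp fun y hy => by
    rw [hu y (frontier_subset_closure hy), hχ y hy, PiLp.smul_apply, reflect_apply, smul_eq_mul]
    linear_combination (∇ u y i * χ y) * h

/-- The sign condition is opposite to that of `bint_gradient_eq_zero` because the cross product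
contributes one more factor `-1`. -/
theorem bint_cross_eq_zero {p : Fin 3} (hp : reflect p '' V.fluid = V.fluid) {u χ : E3 → ℝ}
    {ε : ℝ} (hu : V.HasParity p ε u) (hχ : ∀ y ∈ frontier V.fluid, χ (reflect p y) = χ y)
    {i : Fin 3} (h : rsign p i * ε = 1) : V.bint (fun y => cross y (∇ u y) i * χ y) = 0 :=
  V.bint_eq_zero hp fun y hy => by
    rw [hu y (frontier_subset_closure hy), hχ y hy, cross_smul_right, cross_reflect]
    linear_combination (-cross y (∇ u y) i * χ y) * h

/-- The entries that vanish for a body with two planes of symmetry. -/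
structure SymmetricEntries [NeZero m] (V : Vehicle m) : Prop where
  M : ∀ i j, i ≠ j → V.M i j = 0
  N₀₀ : V.N 0 0 = 0
  N₁₁ : V.N 1 1 = 0
  N₂₂ : V.N 2 2 = 0
  N₀₁ : V.N 0 1 = 0
  N₀₂ : V.N 0 2 = 0
  N₁₀ : V.N 1 0 = 0
  N₂₀ : V.N 2 0 = 0
  CM : ∀ i, i ≠ 0 → V.CM i 0 = 0
  CJ : ∀ i, V.CJ i 0 = 0
  LM : ∀ i j, i ≠ j → V.LM 0 i j = 0
  LJ : ∀ i j, (i, j) ≠ (1, 2) → (i, j) ≠ (2, 1) → V.LJ 0 i j = 0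
  RM : ∀ i j, (i, j) ≠ (1, 2) → (i, j) ≠ (2, 1) → V.RM 0 i j = 0
  RJ : ∀ i j, i ≠ j → V.RJ 0 i j = 0
  WM : ∀ i, i ≠ 0 → V.WM 0 i 0 = 0
  WJ : ∀ i, V.WJ 0 i 0 = 0

/-- Distinct indices are separated by one of the two available reflections, since at least one of
them is `1` or `2`. The next lemmas make the same kind of choice; only the pair formed by `1` and
`2` changes relative sign under both reflections. -/
theorem exists_rsign_mul_eq_neg_one {i j : Fin 3} (h : i ≠ j) :
    ∃ p : Fin 3, (p = 1 ∨ p = 2) ∧ rsign p i * rsign p j = -1 := by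
  fin_cases i <;> fin_cases j <;> simp at h <;>
    first
    | (refine ⟨1, Or.inl rfl, ?_⟩; simp [rsign]; done)
    | (refine ⟨2, Or.inr rfl, ?_⟩; simp [rsign]; done)

theorem exists_rsign_mul_eq_one {i j : Fin 3} (h : (i, j) ≠ (1, 2)) (h' : (i, j) ≠ (2, 1)) :
    ∃ p : Fin 3, (p = 1 ∨ p = 2) ∧ rsign p i * rsign p j = 1 := by
  fin_cases i <;> fin_cases j <;> simp at h h' <;>
    first
    | (refine ⟨1, Or.inl rfl, ?_⟩; simp [rsign]; done)
    | (refine ⟨2, Or.inr rfl, ?_⟩; simp [rsign]; done)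

theorem exists_rsign_eq_neg_one {i : Fin 3} (h : i ≠ 0) :
    ∃ p : Fin 3, (p = 1 ∨ p = 2) ∧ rsign p i = -1 := by
  fin_cases i <;> simp at h <;>
    first
    | (refine ⟨1, Or.inl rfl, ?_⟩; simp [rsign]; done)
    | (refine ⟨2, Or.inr rfl, ?_⟩; simp [rsign]; done)

theorem exists_rsign_eq_one (i : Fin 3) :
    ∃ p : Fin 3, (p = 1 ∨ p = 2) ∧ rsign p i = 1 := by
  fin_cases i <;>
    first
    | (refine ⟨1, Or.inl rfl, ?_⟩; simp [rsign]; done)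
    | (refine ⟨2, Or.inr rfl, ?_⟩; simp [rsign]; done)

/-- Each entry is an integral over the fluid or its boundary, and some available reflection turns
its integrand into its opposite. Which reflection does so depends on the indices and on whether the
entry contains an even or odd number of pseudovectors. -/
theorem symmetricEntries [NeZero m]
    (hΩ : ∀ p : Fin 3, p = 1 ∨ p = 2 → reflect p '' V.fluid = V.fluid)
    (hχ : ∀ p : Fin 3, p = 1 ∨ p = 2 →
      ∀ y ∈ frontier V.fluid, V.χ 0 (reflect p y) = V.χ 0 y) : V.SymmetricEntries := by
  have hN : ∀ i j, (i, j) ≠ (1, 2) → (i, j) ≠ (2, 1) → V.N i j = 0 := by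
    intro i j h h'
    obtain ⟨p, hp, hs⟩ := exists_rsign_mul_eq_one h h'
    exact V.energy_eq_zero (hΩ p hp) (V.hasParity_φ (hΩ p hp) i) (V.hasParity_φr (hΩ p hp) j)
      (by linarith)
  refine ⟨?_, hN _ _ ?_ ?_, hN _ _ ?_ ?_, hN _ _ ?_ ?_, hN _ _ ?_ ?_, hN _ _ ?_ ?_, hN _ _ ?_ ?_,
    hN _ _ ?_ ?_, ?_, ?_, ?_, ?_, ?_, ?_, ?_, ?_⟩
  · intro i j h
    obtain ⟨p, hp, hs⟩ := exists_rsign_mul_eq_neg_one h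
    exact V.energy_eq_zero (hΩ p hp) (V.hasParity_φ (hΩ p hp) i) (V.hasParity_φ (hΩ p hp) j) hs
  any_goals decide
  · intro i h
    obtain ⟨p, hp, hs⟩ := exists_rsign_eq_neg_one h
    exact V.energy_eq_zero (hΩ p hp) (V.hasParity_φ (hΩ p hp) i)
      (V.hasParity_ψ (hΩ p hp) (hχ p hp)) (by linarith)
  · intro i
    obtain ⟨p, hp, hs⟩ := exists_rsign_eq_one i
    exact V.energy_eq_zero (hΩ p hp) (V.hasParity_φr (hΩ p hp) i)
      (V.hasParity_ψ (hΩ p hp) (hχ p hp)) (by linarith)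
  · intro i j h
    obtain ⟨p, hp, hs⟩ := exists_rsign_mul_eq_neg_one h
    exact V.bint_gradient_eq_zero (hΩ p hp) (V.hasParity_φ (hΩ p hp) j) (hχ p hp) hs
  · intro i j h h'
    obtain ⟨p, hp, hs⟩ := exists_rsign_mul_eq_one h h'
    exact V.bint_cross_eq_zero (hΩ p hp) (V.hasParity_φ (hΩ p hp) j) (hχ p hp) hs
  · intro i j h h'
    obtain ⟨p, hp, hs⟩ := exists_rsign_mul_eq_one h h'
    exact V.bint_gradient_eq_zero (hΩ p hp) (V.hasParity_φr (hΩ p hp) j) (hχ p hp) (by linarith)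
  · intro i j h
    obtain ⟨p, hp, hs⟩ := exists_rsign_mul_eq_neg_one h
    exact V.bint_cross_eq_zero (hΩ p hp) (V.hasParity_φr (hΩ p hp) j) (hχ p hp) (by linarith)
  · intro i h
    obtain ⟨p, hp, hs⟩ := exists_rsign_eq_neg_one h
    exact V.bint_gradient_eq_zero (hΩ p hp) (V.hasParity_ψ (hΩ p hp) (hχ p hp)) (hχ p hp)
      (by linarith)
  · intro i
    obtain ⟨p, hp, hs⟩ := exists_rsign_eq_one i
    exact V.bint_cross_eq_zero (hΩ p hp) (V.hasParity_ψ (hΩ p hp) (hχ p hp)) (hχ p hp)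
      (by linarith)

end Vehicle

namespace Vehicle

variable {m : ℕ} (V : Vehicle m)

/-! ### The inertia matrix is positive definite -/

/-- By neutral buoyancy the mass is the volume of the body. The volume is positive because the body
contains the open set where `bdf < 0`, which is nonempty: from a point with `bdf = 0`, move against
the gradient. -/
theorem m0_pos : 0 < V.m0 := by
  rw [m0, V.buoyancy, setIntegral_const, smul_eq_mul, mul_one]
  refine ENNReal.toReal_pos ?_ V.solid_compact.measure_lt_top.ne
  have hsolid : V.solid = {y | V.bdf y ≤ 0} := by
    have := congrArg compl V.fluid_eq
    rw [compl_compl] at this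
    rw [this]
    ext y
    simp
  have hneg : ∃ y, V.bdf y < 0 := by
    obtain ⟨y, hy⟩ := V.solid_connected.nonempty
    rw [hsolid] at hy
    rcases lt_or_eq_of_le (show V.bdf y ≤ 0 from hy) with h | h
    · exact ⟨y, h⟩
    · have hd : DifferentiableAt ℝ V.bdf y := V.bdf_smooth.differentiable (by simp) y
      have h1 := eventually_pos_of_inner_pos (f := fun y => -V.bdf y) (p := y) (v := -∇ V.bdf y)
        hd.neg (by simp [h]) (by
          rw [inner_gradient_left, fderiv_fun_neg, _root_.neg_apply, map_neg, neg_neg,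
            ← inner_gradient_left, real_inner_self_eq_norm_sq]
          have := norm_pos_iff.2 (V.bdf_regular y h)
          positivity)
      obtain ⟨t, ht⟩ := h1.exists
      exact ⟨_, neg_pos.1 ht⟩
  have ho : IsOpen {y | V.bdf y < 0} := isOpen_lt V.bdf_smooth.continuous continuous_const
  have hsub : {y | V.bdf y < 0} ⊆ V.solid := by
    rw [hsolid]
    exact fun y hy => le_of_lt (show V.bdf y < 0 from hy)
  exact (lt_of_lt_of_le (ho.measure_pos volume hneg) (measure_mono hsub)).ne'

theorem integrableOn_density_mul {g : E3 → ℝ} (hg : Continuous g) :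
    IntegrableOn (fun y => V.density y * g y) V.solid :=
  V.density_integrable.mul_continuousOn hg.continuousOn V.solid_compact

theorem dotProduct_J0_mulVec (r : Fin 3 → ℝ) : r ⬝ᵥ V.J0 *ᵥ r = ∫ y in V.solid, V.density y *
    ((r ⬝ᵥ r) * ‖y‖ ^ 2 - (r ⬝ᵥ WithLp.ofLp y) ^ 2) := by
  have hi : ∀ i j : Fin 3, IntegrableOn (fun y : E3 => V.density y *
      ((if i = j then ‖y‖ ^ 2 else 0) - y i * y j)) V.solid := by
    intro i j
    refine V.integrableOn_density_mul ?_
    split_ifs <;> fun_prop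
  have e : ∀ y : E3, V.density y * ((r ⬝ᵥ r) * ‖y‖ ^ 2 - (r ⬝ᵥ WithLp.ofLp y) ^ 2) =
      ∑ i, ∑ j, r i * r j * (V.density y * ((if i = j then ‖y‖ ^ 2 else 0) - y i * y j)) := by
    intro y
    simp [Fin.sum_univ_three, dotProduct]
    ring
  simp only [e]
  rw [integral_finsetSum _ fun i _ => integrable_finsetSum _ fun j _ => (hi i j).const_mul _]
  simp only [dotProduct, Matrix.mulVec, Finset.mul_sum]
  refine Finset.sum_congr rfl fun i _ => ?_
  rw [integral_finsetSum _ fun j _ => (hi i j).const_mul _]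
  refine Finset.sum_congr rfl fun j _ => ?_
  rw [integral_const_mul, J0, Matrix.of_apply]
  ring

theorem sq_dotProduct_le (r : Fin 3 → ℝ) (y : E3) :
    (r ⬝ᵥ WithLp.ofLp y) ^ 2 ≤ (r ⬝ᵥ r) * ‖y‖ ^ 2 := by
  rw [EuclideanSpace.norm_sq_eq]
  simp only [dotProduct, Fin.sum_univ_three, Real.norm_eq_abs, sq_abs]
  nlinarith [sq_nonneg (r 0 * y 1 - r 1 * y 0), sq_nonneg (r 0 * y 2 - r 2 * y 0),
    sq_nonneg (r 1 * y 2 - r 2 * y 1)]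

/-- The quadratic form is the integral of the density times `‖r × y‖ ^ 2`. If it vanished, the
density would be zero almost everywhere off the line spanned by `r`, which is a null set, and the
mass would be zero. -/
theorem dotProduct_J0_mulVec_pos {r : Fin 3 → ℝ} (hr : r ≠ 0) : 0 < r ⬝ᵥ V.J0 *ᵥ r := by
  have hms : MeasurableSet V.solid := V.solid_compact.isClosed.measurableSet
  have hnn : 0 ≤ᵐ[volume.restrict V.solid] fun y => V.density y *
      ((r ⬝ᵥ r) * ‖y‖ ^ 2 - (r ⬝ᵥ WithLp.ofLp y) ^ 2) := by
    filter_upwards [ae_restrict_mem hms] with y hy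
    exact mul_nonneg (V.density_nonneg y hy) (sub_nonneg.2 (sq_dotProduct_le r y))
  have hcont : Continuous fun y : E3 => (r ⬝ᵥ r) * ‖y‖ ^ 2 - (r ⬝ᵥ WithLp.ofLp y) ^ 2 := by
    simp only [dotProduct]
    fun_prop
  have hint := V.integrableOn_density_mul hcont
  rw [dotProduct_J0_mulVec]
  refine (integral_nonneg_of_ae hnn).lt_of_ne fun h0 => ?_
  have hae := (integral_eq_zero_iff_of_nonneg_ae hnn hint).1 h0.symm
  have hline : ∀ᵐ y ∂(volume.restrict V.solid), y ∉ (ℝ ∙ (WithLp.toLp 2 r : E3)) := by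
    refine ae_restrict_of_ae ?_
    have : volume ((ℝ ∙ (WithLp.toLp 2 r : E3) : Submodule ℝ E3) : Set E3) = 0 := by
      refine Measure.addHaar_submodule _ _ fun htop => ?_
      have h1 := finrank_span_singleton (K := ℝ) (v := (WithLp.toLp 2 r : E3))
        (by simpa using hr)
      rw [htop, finrank_top, finrank_euclideanSpace_fin] at h1
      norm_num at h1
    exact measure_eq_zero_iff_ae_notMem.1 this
  have hρ : ∀ᵐ y ∂(volume.restrict V.solid), V.density y = 0 := by
    filter_upwards [hae, hline] with y hy hy'
    refine (mul_eq_zero.1 hy).resolve_right fun h1 => hy' ?_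
    rw [Submodule.mem_span_singleton]
    have hrr : 0 < r ⬝ᵥ r := by
      have : 0 ≤ r ⬝ᵥ r := Finset.sum_nonneg fun i _ => mul_self_nonneg (r i)
      exact this.lt_of_ne fun h => hr (dotProduct_self_eq_zero.1 h.symm)
    refine ⟨(r ⬝ᵥ WithLp.ofLp y) / (r ⬝ᵥ r), ?_⟩
    rw [EuclideanSpace.norm_sq_eq] at h1
    simp only [dotProduct, Fin.sum_univ_three, Real.norm_eq_abs, sq_abs] at h1 hrr
    have hsum : (r 0 * y 1 - r 1 * y 0) ^ 2 + (r 0 * y 2 - r 2 * y 0) ^ 2 +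
      (r 1 * y 2 - r 2 * y 1) ^ 2 = 0 := by linear_combination h1
    have k1 : r 0 * y 1 - r 1 * y 0 = 0 := by
      nlinarith [sq_nonneg (r 0 * y 1 - r 1 * y 0), sq_nonneg (r 0 * y 2 - r 2 * y 0),
        sq_nonneg (r 1 * y 2 - r 2 * y 1)]
    have k2 : r 0 * y 2 - r 2 * y 0 = 0 := by
      nlinarith [sq_nonneg (r 0 * y 1 - r 1 * y 0), sq_nonneg (r 0 * y 2 - r 2 * y 0),
        sq_nonneg (r 1 * y 2 - r 2 * y 1)]
    have k3 : r 1 * y 2 - r 2 * y 1 = 0 := by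
      nlinarith [sq_nonneg (r 0 * y 1 - r 1 * y 0), sq_nonneg (r 0 * y 2 - r 2 * y 0),
        sq_nonneg (r 1 * y 2 - r 2 * y 1)]
    ext i
    simp only [PiLp.smul_apply, smul_eq_mul, dotProduct, Fin.sum_univ_three]
    rw [div_mul_eq_mul_div, div_eq_iff hrr.ne']
    fin_cases i
    · simp; linear_combination r 1 * k1 + r 2 * k2
    · simp; linear_combination -r 0 * k1 + r 2 * k3
    · simp; linear_combination -r 0 * k2 - r 1 * k3
  have hm := V.m0_pos
  rw [m0, integral_eq_zero_of_ae hρ] at hm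
  exact lt_irrefl _ hm

theorem memLp_gradient_potential (a : I6) :
    MemLp (∇ (Sum.elim V.φ V.φr a)) 2 (volume.restrict V.fluid) := by
  rcases a with i | i
  · exact (V.φ_spec i).finite_energy
  · exact (V.φr_spec i).finite_energy

/-- The added mass is the Gram matrix in `L²` of the gradients of the six potentials, hence positive
semidefinite. -/
theorem addedMass_eq_gram : Matrix.fromBlocks V.M V.N V.Nᵀ V.J =
    Matrix.gram ℝ fun a => (V.memLp_gradient_potential a).toLp := by
  have key : ∀ a b : I6, inner ℝ (V.memLp_gradient_potential a).toLp
      (V.memLp_gradient_potential b).toLp = ∫ y in V.fluid,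
        inner ℝ (∇ (Sum.elim V.φ V.φr a) y) (∇ (Sum.elim V.φ V.φr b) y) := by
    intro a b
    rw [L2.inner_def]
    refine integral_congr_ae ?_
    filter_upwards [(V.memLp_gradient_potential a).coeFn_toLp,
      (V.memLp_gradient_potential b).coeFn_toLp] with y h1 h2
    rw [h1, h2]
  ext a b
  rw [Matrix.gram_apply, key]
  rcases a with i | i <;> rcases b with j | j
  · rfl
  · rfl
  · simp only [Matrix.fromBlocks_apply₂₁, Matrix.transpose_apply, N, Matrix.of_apply, Sum.elim_inl,
      Sum.elim_inr]
    exact integral_congr_ae (Eventually.of_forall fun y => real_inner_comm _ _)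
  · rfl

theorem dotProduct_JJ_mulVec_pos {v : I6 → ℝ} (hv : v ≠ 0) : 0 < v ⬝ᵥ V.JJ *ᵥ v := by
  have h1 : 0 ≤ v ⬝ᵥ Matrix.fromBlocks V.M V.N V.Nᵀ V.J *ᵥ v := by
    rw [addedMass_eq_gram]
    have := (Matrix.posSemidef_gram ℝ fun a =>
      (V.memLp_gradient_potential a).toLp).dotProduct_mulVec_nonneg v
    simpa using this
  set l : Fin 3 → ℝ := fun i => v (Sum.inl i) with hl
  set r : Fin 3 → ℝ := fun i => v (Sum.inr i) with hr
  have hvlr : v = Sum.elim l r := by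
    ext a; rcases a with i | i <;> rfl
  have h2 : v ⬝ᵥ Matrix.fromBlocks (V.m0 • (1 : Matrix (Fin 3) (Fin 3) ℝ)) 0 0 V.J0 *ᵥ v =
      V.m0 * (l ⬝ᵥ l) + r ⬝ᵥ V.J0 *ᵥ r := by
    rw [hvlr, Matrix.fromBlocks_mulVec]
    simp [Sum.elim_comp_inl, Sum.elim_comp_inr, Matrix.smul_mulVec]
  rw [JJ, Matrix.add_mulVec, dotProduct_add, h2]
  have hm := V.m0_pos
  have hll : 0 ≤ l ⬝ᵥ l := Finset.sum_nonneg fun i _ => mul_self_nonneg (l i)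
  by_cases hr0 : r = 0
  · have hl0 : l ≠ 0 := by
      rintro hl0
      refine hv ?_
      rw [hvlr, hl0, hr0]
      ext a; rcases a with i | i <;> rfl
    have : 0 < l ⬝ᵥ l := hll.lt_of_ne fun h => hl0 (dotProduct_self_eq_zero.1 h.symm)
    rw [hr0]
    simp only [zero_dotProduct, add_zero]
    have := mul_pos hm this
    linarith
  · have := V.dotProduct_J0_mulVec_pos hr0
    have := mul_nonneg hm.le hll
    linarith

theorem isUnit_det_JJ : IsUnit V.JJ.det := by
  rw [isUnit_iff_ne_zero]
  intro h
  obtain ⟨v, hv, hv0⟩ := Matrix.exists_mulVec_eq_zero_iff.2 h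
  have := V.dotProduct_JJ_mulVec_pos hv
  rw [hv0, dotProduct_zero] at this
  exact lt_irrefl _ this

end Vehicle

/-! ### The nonlinearity as a quadratic form, and its Jacobian matrices -/

theorem skew_add (x y : Fin 3 → ℝ) : skew (x + y) = skew x + skew y := by
  ext i j
  fin_cases i <;> fin_cases j <;> simp [skew] <;> ring

theorem skew_smul (c : ℝ) (x : Fin 3 → ℝ) : skew (c • x) = c • skew x := by
  ext i j
  fin_cases i <;> fin_cases j <;> simp [skew]

theorem skew_zero : skew 0 = 0 := by
  ext i j
  fin_cases i <;> fin_cases j <;> simp [skew]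

/-- The matrix by which the momentum is multiplied in the nonlinearity. -/
def transport (v : I6 → ℝ) : Matrix I6 I6 ℝ :=
  Matrix.fromBlocks (skew (v ∘ Sum.inr)) 0 (skew (v ∘ Sum.inl)) (skew (v ∘ Sum.inr))

theorem transport_add (v v' : I6 → ℝ) : transport (v + v') = transport v + transport v' := by
  have h : ∀ f : Fin 3 → I6, (v + v') ∘ f = v ∘ f + v' ∘ f := fun f => rfl
  simp [transport, Matrix.fromBlocks_add, h, skew_add]

theorem transport_smul (c : ℝ) (v : I6 → ℝ) : transport (c • v) = c • transport v := by
  have h : ∀ f : Fin 3 → I6, (c • v) ∘ f = c • v ∘ f := fun f => rfl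
  simp [transport, Matrix.fromBlocks_smul, h, skew_smul]

theorem sum_single_smul {ι E : Type*} [Fintype ι] [DecidableEq ι] [AddCommGroup E] [Module ℝ E]
    (j : ι) (c : ℝ) (G : ι → E) : ∑ p, (Pi.single j c : ι → ℝ) p • G p = c • G j := by
  rw [Finset.sum_eq_single j (fun b _ hb => by rw [Pi.single_eq_of_ne hb, zero_smul])
    (fun h => absurd (Finset.mem_univ j) h), Pi.single_eq_same]

namespace Vehicle

variable {m : ℕ} (V : Vehicle m)

/-- The matrix of the fluxes due to the control `p`, acting on the velocity. -/
def fluxV (p : Fin m) : Matrix I6 I6 ℝ := Matrix.fromBlocks (V.LM p) (V.RM p) (V.LJ p) (V.RJ p)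

/-- The matrix of the fluxes due to the control `p`, acting on the control. -/
def fluxW (p : Fin m) : Matrix I6 (Fin m) ℝ := Matrix.fromRows (V.WM p) (V.WJ p)

/-- The bilinear map whose quadratic form is the nonlinearity. -/
def bilin (x y : (I6 → ℝ) × (Fin m → ℝ)) : I6 → ℝ :=
  -(transport x.1 *ᵥ (V.JJ *ᵥ y.1 - V.C *ᵥ y.2)) -
    ∑ p, x.2 p • (V.fluxV p *ᵥ y.1 + V.fluxW p *ᵥ y.2)

theorem F_eq_bilin (v : I6 → ℝ) (w : Fin m → ℝ) : V.F v w = V.bilin (v, w) (v, w) := by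
  rw [F, bilin, transport]
  congr 1
  refine Finset.sum_congr rfl fun p _ => ?_
  congr 1
  ext a
  rcases a with i | i <;>
  simp [fluxV, fluxW, Matrix.fromBlocks_mulVec, Matrix.fromRows_mulVec] <;> rfl

theorem bilin_add_left (x x' y) : V.bilin (x + x') y = V.bilin x y + V.bilin x' y := by
  simp only [bilin, Prod.fst_add, Prod.snd_add, transport_add, Matrix.add_mulVec, Pi.add_apply,
    add_smul, Finset.sum_add_distrib]
  abel

theorem bilin_smul_left (c : ℝ) (x y) : V.bilin (c • x) y = c • V.bilin x y := by
  simp only [bilin, Prod.smul_fst, Prod.smul_snd, transport_smul, Matrix.smul_mulVec, Pi.smul_apply,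
    smul_sub, smul_neg, Finset.smul_sum, smul_smul, smul_eq_mul]

theorem bilin_add_right (x y y') : V.bilin x (y + y') = V.bilin x y + V.bilin x y' := by
  simp only [bilin, Prod.fst_add, Prod.snd_add, Matrix.mulVec_add, Matrix.mulVec_sub, smul_add,
    Finset.sum_add_distrib]
  abel

theorem bilin_smul_right (c : ℝ) (x y) : V.bilin x (c • y) = c • V.bilin x y := by
  simp only [bilin, Prod.smul_fst, Prod.smul_snd, Matrix.mulVec_smul, Matrix.mulVec_sub,
    smul_add, smul_sub, smul_neg, Finset.smul_sum]
  simp only [smul_comm c]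

/-- `bilin` as a continuous bilinear map. -/
def bilinL : (I6 → ℝ) × (Fin m → ℝ) →L[ℝ] (I6 → ℝ) × (Fin m → ℝ) →L[ℝ] I6 → ℝ :=
  LinearMap.toContinuousLinearMap (LinearMap.toContinuousLinearMap.toLinearMap ∘ₗ
    LinearMap.mk₂ ℝ V.bilin V.bilin_add_left V.bilin_smul_left V.bilin_add_right V.bilin_smul_right)

theorem bilinL_apply (x y) : V.bilinL x y = V.bilin x y := rfl

theorem contDiff_F {n : ℕ∞ω} :
    ContDiff ℝ n fun x : (I6 → ℝ) × (Fin m → ℝ) => V.F x.1 x.2 := by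
  have : (fun x : (I6 → ℝ) × (Fin m → ℝ) => V.F x.1 x.2) = fun x => V.bilinL x x :=
    funext fun x => V.F_eq_bilin x.1 x.2
  rw [this]
  exact (V.bilinL.contDiff).clm_apply contDiff_id

theorem hasFDerivAt_F (x : (I6 → ℝ) × (Fin m → ℝ)) :
    HasFDerivAt (fun x : (I6 → ℝ) × (Fin m → ℝ) => V.F x.1 x.2)
      (V.bilinL x + V.bilinL.flip x) x := by
  have : (fun x : (I6 → ℝ) × (Fin m → ℝ) => V.F x.1 x.2) = fun x => V.bilinL x x :=
    funext fun x => V.F_eq_bilin x.1 x.2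
  rw [this]
  have h := V.bilinL.hasFDerivAt_of_bilinear (hasFDerivAt_id x) (hasFDerivAt_id x)
  exact h.congr_fderiv (ContinuousLinearMap.ext fun y => by simp)

variable [NeZero m]

/-- The reference point. -/
def refPoint (l w : ℝ) : (I6 → ℝ) × (Fin m → ℝ) := (refVelocity l, refControl w)

theorem refVelocity_eq (l : ℝ) : refVelocity l = l • refVelocity 1 := by
  ext a
  rcases a with i | i <;> simp [refVelocity]

theorem refControl_eq (w : ℝ) : (refControl w : Fin m → ℝ) = w • refControl 1 := by
  ext a
  by_cases h : a = 0
  · subst h; simp [refControl]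
  · simp [refControl, h]

theorem refPoint_eq (l w : ℝ) :
    (refPoint l w : (I6 → ℝ) × (Fin m → ℝ)) = l • refPoint 1 0 + w • refPoint 0 1 := by
  rw [refPoint, refPoint, refPoint, refVelocity_eq l, refVelocity_eq 0, refControl_eq w,
    refControl_eq 0]
  simp

theorem linA_mulVec (l w : ℝ) (δ : I6 → ℝ) :
    V.linA l w *ᵥ δ = V.bilin (refPoint l w) (δ, 0) + V.bilin (δ, 0) (refPoint l w) := by
  have h1 : HasFDerivAt (fun v : I6 → ℝ => (v, (refControl w : Fin m → ℝ)))
      (ContinuousLinearMap.inl ℝ (I6 → ℝ) (Fin m → ℝ)) (refVelocity l) :=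
    hasFDerivAt_prodMk_left _ _
  have h2 := ((V.hasFDerivAt_F (refPoint l w)).comp (refVelocity l) h1).fderiv
  simp only [Function.comp_def] at h2
  rw [linA, LinearMap.toMatrix'_mulVec, h2]
  simp [bilinL_apply]

theorem linB_mulVec (l w : ℝ) (δ : Fin m → ℝ) :
    V.linB l w *ᵥ δ = V.bilin (refPoint l w) (0, δ) + V.bilin (0, δ) (refPoint l w) := by
  have h1 : HasFDerivAt (fun u : Fin m → ℝ => (refVelocity l, u))
      (ContinuousLinearMap.inr ℝ (I6 → ℝ) (Fin m → ℝ)) (refControl w) :=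
    hasFDerivAt_prodMk_right _ _
  have h2 := ((V.hasFDerivAt_F (refPoint l w)).comp (refControl w) h1).fderiv
  simp only [Function.comp_def] at h2
  rw [linB, LinearMap.toMatrix'_mulVec, h2]
  simp [bilinL_apply]

theorem fderiv_F_refPoint (l w : ℝ) (δ : (I6 → ℝ) × (Fin m → ℝ)) :
    fderiv ℝ (fun x : (I6 → ℝ) × (Fin m → ℝ) => V.F x.1 x.2) (refPoint l w) δ =
      V.linA l w *ᵥ δ.1 + V.linB l w *ᵥ δ.2 := by
  have e : δ = (δ.1, 0) + (0, δ.2) := by simp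
  rw [(V.hasFDerivAt_F _).fderiv, linA_mulVec, linB_mulVec]
  conv_lhs => rw [e]
  simp only [_root_.add_apply, ContinuousLinearMap.flip_apply, bilinL_apply,
    bilin_add_left, bilin_add_right]
  abel

/-- The nonlinearity is quadratic, so its Jacobian depends linearly on the base point. This
separates the contributions of the reference velocity and of the reference control. -/
theorem linA_eq (l w : ℝ) : V.linA l w = l • V.linA 1 0 + w • V.linA 0 1 := by
  refine Matrix.ext_of_mulVec_single fun j => ?_
  rw [Matrix.add_mulVec, Matrix.smul_mulVec, Matrix.smul_mulVec, linA_mulVec, linA_mulVec,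
    linA_mulVec, refPoint_eq l w]
  simp only [bilin_add_left, bilin_add_right, bilin_smul_left, bilin_smul_right, smul_add]
  abel

theorem linB_eq (l w : ℝ) : V.linB l w = l • V.linB 1 0 + w • V.linB 0 1 := by
  refine Matrix.ext_of_mulVec_single fun j => ?_
  rw [Matrix.add_mulVec, Matrix.smul_mulVec, Matrix.smul_mulVec, linB_mulVec, linB_mulVec,
    linB_mulVec, refPoint_eq l w]
  simp only [bilin_add_left, bilin_add_right, bilin_smul_left, bilin_smul_right, smul_add]
  abel

theorem linD_eq (l : ℝ) : linD l = l • linD 1 := by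
  simp [linD, skew_smul, Matrix.fromBlocks_smul]

theorem linD_α : linD V.α = V.boldD := by
  simp [linD, boldD, skew_smul]

theorem add_mass_ne_zero {V : Vehicle m} (hα : V.α ≠ 0) : V.m0 + V.M 0 0 ≠ 0 := by
  intro h
  exact hα (by rw [α, h, div_zero])

theorem α_mul_mass {V : Vehicle m} (hα : V.α ≠ 0) : V.α * (V.m0 + V.M 0 0) = -V.CM 0 0 := by
  rw [α, div_mul_cancel₀ _ (add_mass_ne_zero hα)]

/-- The momentum along the reference trajectory. -/
theorem SymmetricEntries.momentum {V : Vehicle m} (hV : V.SymmetricEntries) (l w : ℝ) :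
    V.JJ *ᵥ refVelocity l - V.C *ᵥ refControl w =
      refVelocity (l * (V.m0 + V.M 0 0) + w * V.CM 0 0) := by
  have h1 : V.C *ᵥ refControl w = -Sum.elim (fun i => w * V.CM i 0) (fun i => w * V.CJ i 0) := by
    rw [C, Matrix.neg_mulVec, refControl, Matrix.fromRows_mulVec]
    congr 1
    ext a
    rcases a with i | i <;> simp [mul_comm]
  rw [h1]
  ext a
  rcases a with i | i
  · have := hV.M i 0
    have := hV.CM i
    fin_cases i <;>
      simp_all [JJ, refVelocity, e1, Matrix.mulVec, dotProduct, Fin.sum_univ_three,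
        Matrix.one_apply] <;> ring
  · have := hV.CJ i
    have := hV.N₀₀
    have := hV.N₀₁
    have := hV.N₀₂
    fin_cases i <;>
      simp_all [JJ, refVelocity, e1, Matrix.mulVec, dotProduct, Fin.sum_univ_three,
        Matrix.one_apply]

theorem refVelocity_zero : refVelocity 0 = 0 := by
  ext a
  rcases a with i | i <;> simp [refVelocity]

theorem transport_refVelocity (l : ℝ) :
    transport (refVelocity l) = Matrix.fromBlocks 0 0 (skew (l • e1)) 0 := by
  have h1 : refVelocity l ∘ Sum.inr = 0 := rfl
  have h2 : refVelocity l ∘ Sum.inl = l • e1 := rfl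
  rw [transport, h1, h2, skew_zero]

/-- At the base point given by `α` and `1` the total momentum vanishes, by the very definition of
`α`. The variation of the transport matrix therefore contributes nothing, and only the momentum of
the variation and the fluxes remain. -/
theorem SymmetricEntries.linA_α {V : Vehicle m} (hV : V.SymmetricEntries) (hα : V.α ≠ 0) :
    V.linA V.α 1 = V.boldA := by
  have key : V.linA V.α 1 =
      -(Matrix.fromBlocks 0 0 (skew (V.α • e1)) 0 * V.JJ) - V.fluxV 0 := by
    refine Matrix.ext_of_mulVec_single fun j => ?_
    rw [linA_mulVec, bilin, bilin, refPoint]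
    simp only
    rw [hV.momentum, one_mul, α_mul_mass hα, neg_add_cancel, refVelocity_zero,
      transport_refVelocity]
    rw [refControl, sum_single_smul, Matrix.sub_mulVec, Matrix.neg_mulVec, ← Matrix.mulVec_mulVec]
    simp
  rw [key]
  have hm := α_mul_mass hα
  ext a b
  rcases a with i | i <;> rcases b with j | j
  · have h1 := hV.LM i j
    fin_cases i <;> fin_cases j <;> simp [boldA, boldAL, boldAR, fluxV, Matrix.mul_apply] at h1 ⊢ <;>
      exact h1
  · have h1 := hV.RM i j
    fin_cases i <;> fin_cases j <;>
      simp [boldA, boldAL, boldAR, fluxV, Matrix.mul_apply] at h1 ⊢ <;> exact h1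
  · have h1 := hV.LJ i j
    have h2 := hV.M 1 2 (by decide)
    have h3 := hV.M 2 1 (by decide)
    have h4 := hV.M 1 0 (by decide)
    have h5 := hV.M 2 0 (by decide)
    fin_cases i <;> fin_cases j <;>
      simp [boldA, boldAL, boldAR, fluxV, Matrix.mul_apply, JJ, skew, e1, Fin.sum_univ_three,
        h2, h3, h4, h5] at h1 ⊢ <;> first | exact h1 | linear_combination hm | linear_combination -hm
  · have h1 := hV.RJ i j
    have h2 := hV.N₁₁
    have h3 := hV.N₂₂
    have h4 := hV.N₁₀
    have h5 := hV.N₂₀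
    fin_cases i <;> fin_cases j <;>
      simp [boldA, boldAL, boldAR, fluxV, Matrix.mul_apply, JJ, skew, e1, Fin.sum_univ_three,
        h2, h3, h4, h5] at h1 ⊢ <;> exact h1

theorem linB_α : V.linB V.α 1 = V.boldB := by
  refine Matrix.ext_of_mulVec_single fun j => ?_
  rw [linB_mulVec, bilin, bilin, refPoint]
  simp only
  rw [transport_refVelocity]
  have h0 : transport 0 = 0 := by
    have := transport_smul 0 0
    simpa using this
  rw [h0, refControl, sum_single_smul, sum_single_smul]
  ext a
  rcases a with i | i
  · simp [boldB, fluxV, fluxW, Matrix.fromBlocks_mulVec, refVelocity_eq V.α, Matrix.mulVec_smul]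
    simp [refVelocity, Matrix.mulVec, dotProduct]
    ring
  · simp [boldB, fluxV, fluxW, Matrix.fromBlocks_mulVec, refVelocity_eq V.α, Matrix.mulVec_smul, C]
    simp [refVelocity, Matrix.mulVec, dotProduct, skew_smul, Matrix.mul_apply, Finset.mul_sum]
    ring

/-- The nonlinearity along the reference trajectory. -/
theorem SymmetricEntries.F_refPoint {V : Vehicle m} (hV : V.SymmetricEntries) (l w : ℝ) :
    V.F (refVelocity l) (refControl w) =
      refVelocity (-(w * (l * V.LM 0 0 0 + w * V.WM 0 0 0))) := by
  rw [F_eq_bilin, bilin]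
  simp only
  rw [hV.momentum, transport_refVelocity, refControl, sum_single_smul]
  ext a
  rcases a with i | i
  · have h1 := hV.LM i 0
    have h2 := hV.WM i
    fin_cases i <;> simp_all [fluxV, fluxW, Matrix.fromBlocks_mulVec,
      Matrix.fromRows_mulVec, refVelocity, e1, Matrix.mulVec, dotProduct, Fin.sum_univ_three] <;>
      ring
  · have h1 := hV.LJ i 0 (by simp) (by simp)
    have h2 := hV.WJ i
    fin_cases i <;> simp_all [fluxV, fluxW, Matrix.fromBlocks_mulVec,
      Matrix.fromRows_mulVec, refVelocity, e1, Matrix.mulVec, dotProduct, Fin.sum_univ_three, skew]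

end Vehicle

/-! ### The rank condition along the reference trajectory -/

theorem vecMul_eq_zero_of_rank_eq {ι κ : Type*} [Fintype ι] [Fintype κ] {K : Matrix ι κ ℝ}
    (h : K.rank = Fintype.card ι) {p : ι → ℝ} (hp : p ᵥ* K = 0) : p = 0 := by
  classical
  have h1 : Kᵀ.rank = Fintype.card ι := by rw [Matrix.rank_transpose, h]
  have h2 := LinearMap.finrank_range_add_finrank_ker Kᵀ.mulVecLin
  rw [Matrix.rank] at h1
  rw [h1, Module.finrank_fintype_fun_eq_card] at h2
  have h3 : LinearMap.ker Kᵀ.mulVecLin = ⊥ := Submodule.finrank_eq_zero.1 (by omega)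
  have h4 : p ∈ LinearMap.ker Kᵀ.mulVecLin := by
    rw [LinearMap.mem_ker, Matrix.mulVecLin_apply, Matrix.mulVec_transpose, hp]
  rw [h3] at h4
  simpa using h4

theorem vecMul_fromCols_eq_zero_iff {ι κ κ' : Type*} [Fintype ι] {K : Matrix ι κ ℝ}
    {K' : Matrix ι κ' ℝ} {p : ι → ℝ} :
    p ᵥ* Matrix.fromCols K K' = 0 ↔ p ᵥ* K = 0 ∧ p ᵥ* K' = 0 := by
  rw [Matrix.vecMul_fromCols]
  constructor
  · intro h
    exact ⟨funext fun i => congrFun h (Sum.inl i), funext fun i => congrFun h (Sum.inr i)⟩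
  · rintro ⟨h, h'⟩
    rw [h, h']
    ext (i | i) <;> rfl

/-- The Gram determinant expresses the absence of left annihilators as the nonvanishing of a
continuous function, that is, as an open condition on the matrix. -/
theorem det_mul_transpose_ne_zero_iff {ι κ : Type*} [Fintype ι] [DecidableEq ι] [Fintype κ]
    (K : Matrix ι κ ℝ) : (K * Kᵀ).det ≠ 0 ↔ ∀ p : ι → ℝ, p ᵥ* K = 0 → p = 0 := by
  constructor
  · intro h p hp
    by_contra hne
    exact h (Matrix.exists_vecMul_eq_zero_iff.1
      ⟨p, hne, by rw [← Matrix.vecMul_vecMul, hp, Matrix.zero_vecMul]⟩)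
  · intro h h0
    obtain ⟨p, hp, hp0⟩ := Matrix.exists_vecMul_eq_zero_iff.2 h0
    refine hp (h p ?_)
    have h1 : (p ᵥ* K) ⬝ᵥ (p ᵥ* K) = 0 := by
      rw [← Matrix.vecMul_vecMul, Matrix.vecMul_transpose] at hp0
      rw [← Matrix.dotProduct_mulVec, hp0, dotProduct_zero]
    exact dotProduct_self_eq_zero.1 h1

theorem hasDerivWithinAt_matrix_mul {ι κ τ : Type*} [Fintype κ] {X : ℝ → Matrix ι κ ℝ}
    {Y : ℝ → Matrix κ τ ℝ} {X' : Matrix ι κ ℝ} {Y' : Matrix κ τ ℝ} {s : Set ℝ} {t : ℝ}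
    (hX : ∀ a c, HasDerivWithinAt (fun t => X t a c) (X' a c) s t)
    (hY : ∀ c b, HasDerivWithinAt (fun t => Y t c b) (Y' c b) s t) (a : ι) (b : τ) :
    HasDerivWithinAt (fun t => (X t * Y t) a b) ((X' * Y t + X t * Y') a b) s t := by
  simp only [Matrix.mul_apply, Matrix.add_apply, ← Finset.sum_add_distrib]
  exact HasDerivWithinAt.fun_sum fun c _ => (hX a c).mul (hY c b)

namespace Vehicle

variable {m : ℕ} [NeZero m] (V : Vehicle m)

/-- The part of `calA` that does not depend on the reference trajectory. -/
def drift₀ : Matrix (I6 ⊕ I6) (I6 ⊕ I6) ℝ := Matrix.fromBlocks 0 1 0 0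

/-- The coefficient of the reference velocity in `calA`. -/
def driftL : Matrix (I6 ⊕ I6) (I6 ⊕ I6) ℝ :=
  Matrix.fromBlocks (linD 1) 0 0 (V.JJ⁻¹ * V.linA 1 0)

/-- The coefficient of the reference control in `calA`. -/
def driftW : Matrix (I6 ⊕ I6) (I6 ⊕ I6) ℝ :=
  Matrix.fromBlocks 0 0 0 (V.JJ⁻¹ * V.linA 0 1)

theorem calA_eq (l w : ℝ) : V.calA l w = drift₀ + l • V.driftL + w • V.driftW := by
  rw [calA, linA_eq, linD_eq, drift₀, driftL, driftW]
  simp [Matrix.fromBlocks_add, Matrix.fromBlocks_smul, Matrix.mul_add]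

theorem calB_eq (l w : ℝ) : V.calB l w = l • V.calB 1 0 + w • V.calB 0 1 := by
  rw [calB, calB, calB, linB_eq]
  ext (a | a) b <;> simp [Matrix.mul_add]

/-- The part of `ℳ₀` that does not depend on the reference trajectory. -/
def inp₀ : Matrix (I6 ⊕ I6) (Fin m) ℝ := drift₀ * V.calC

/-- The coefficient of the reference velocity in `ℳ₀`. -/
def inpL : Matrix (I6 ⊕ I6) (Fin m) ℝ := V.calB 1 0 + V.driftL * V.calC

/-- The coefficient of the reference control in `ℳ₀`. -/
def inpW : Matrix (I6 ⊕ I6) (Fin m) ℝ := V.calB 0 1 + V.driftW * V.calC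

/-- `ℳ₀` as a function of the reference velocity and control. -/
def brk₀ (l w : ℝ) : Matrix (I6 ⊕ I6) (Fin m) ℝ := V.inp₀ + l • V.inpL + w • V.inpW

/-- `ℳ₁` as a function of the reference velocity and control and their derivatives. -/
def brk₁ (l w l' w' : ℝ) : Matrix (I6 ⊕ I6) (Fin m) ℝ :=
  l' • V.inpL + w' • V.inpW - V.calA l w * V.brk₀ l w

/-- `ℳ₂` as a function of the reference velocity and control and their derivatives. -/
def brk₂ (l w l' w' l'' w'' : ℝ) : Matrix (I6 ⊕ I6) (Fin m) ℝ :=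
  l'' • V.inpL + w'' • V.inpW - ((l' • V.driftL + w' • V.driftW) * V.brk₀ l w
    + V.calA l w * (l' • V.inpL + w' • V.inpW)) - V.calA l w * V.brk₁ l w l' w'

theorem brk₀_eq (l w : ℝ) : V.calB l w + V.calA l w * V.calC = V.brk₀ l w := by
  rw [calB_eq, calA_eq, brk₀, inp₀, inpL, inpW]
  simp only [Matrix.add_mul, Matrix.smul_mul, smul_add]
  abel

section derivatives

variable {V} {l w : ℝ → ℝ} {l' w' : ℝ} {s : Set ℝ} {t : ℝ}

theorem hasDerivWithinAt_smul_add (X Y : Matrix (I6 ⊕ I6) (Fin m) ℝ)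
    (hl : HasDerivWithinAt l l' s t) (hw : HasDerivWithinAt w w' s t) (a b) :
    HasDerivWithinAt (fun t => (l t • X + w t • Y) a b) ((l' • X + w' • Y) a b) s t := by
  simpa using (hl.mul_const (X a b)).fun_add (hw.mul_const (Y a b))

theorem hasDerivWithinAt_brk₀ (hl : HasDerivWithinAt l l' s t) (hw : HasDerivWithinAt w w' s t)
    (a b) : HasDerivWithinAt (fun t => V.brk₀ (l t) (w t) a b)
      ((l' • V.inpL + w' • V.inpW) a b) s t := by
  simpa [brk₀, add_assoc] using ((hl.mul_const (V.inpL a b)).add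
    (hw.mul_const (V.inpW a b))).const_add (V.inp₀ a b)

theorem hasDerivWithinAt_calA (hl : HasDerivWithinAt l l' s t) (hw : HasDerivWithinAt w w' s t)
    (a b) : HasDerivWithinAt (fun t => V.calA (l t) (w t) a b)
      ((l' • V.driftL + w' • V.driftW) a b) s t := by
  simpa [calA_eq, add_assoc] using ((hl.mul_const (V.driftL a b)).add
    (hw.mul_const (V.driftW a b))).const_add (drift₀ a b)

theorem hasDerivWithinAt_brk₁ {dl dw : ℝ → ℝ} {l'' w'' : ℝ}
    (hl : HasDerivWithinAt l (dl t) s t) (hw : HasDerivWithinAt w (dw t) s t)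
    (hl' : HasDerivWithinAt dl l'' s t) (hw' : HasDerivWithinAt dw w'' s t) (a b) :
    HasDerivWithinAt (fun t => V.brk₁ (l t) (w t) (dl t) (dw t) a b)
      ((l'' • V.inpL + w'' • V.inpW - ((dl t • V.driftL + dw t • V.driftW) * V.brk₀ (l t) (w t)
        + V.calA (l t) (w t) * (dl t • V.inpL + dw t • V.inpW))) a b) s t :=
  (hasDerivWithinAt_smul_add V.inpL V.inpW hl' hw' a b).sub
    (hasDerivWithinAt_matrix_mul (hasDerivWithinAt_calA hl hw) (hasDerivWithinAt_brk₀ hl hw) a b)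

end derivatives

theorem calM_zero (T : ℝ) (l w : ℝ → ℝ) (t : ℝ) : V.calM T l w 0 t = V.brk₀ (l t) (w t) := by
  rw [calM, brk₀_eq]

theorem calM_one {T : ℝ} (hT : 0 < T) {l w dl dw : ℝ → ℝ}
    (hl : ∀ t ∈ Icc 0 T, HasDerivWithinAt l (dl t) (Icc 0 T) t)
    (hw : ∀ t ∈ Icc 0 T, HasDerivWithinAt w (dw t) (Icc 0 T) t) {t : ℝ} (ht : t ∈ Icc 0 T) :
    V.calM T l w 1 t = V.brk₁ (l t) (w t) (dl t) (dw t) := by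
  rw [calM, brk₁, calM_zero]
  congr 1
  ext a b
  simp only [calM_zero, Matrix.of_apply]
  exact (hasDerivWithinAt_brk₀ (hl t ht) (hw t ht) a b).derivWithin (uniqueDiffOn_Icc hT t ht)

theorem calM_two {T : ℝ} (hT : 0 < T) {l w dl dw : ℝ → ℝ}
    (hl : ∀ t ∈ Icc 0 T, HasDerivWithinAt l (dl t) (Icc 0 T) t)
    (hw : ∀ t ∈ Icc 0 T, HasDerivWithinAt w (dw t) (Icc 0 T) t) {t l'' w'' : ℝ} (ht : t ∈ Icc 0 T)
    (hl' : HasDerivWithinAt dl l'' (Icc 0 T) t) (hw' : HasDerivWithinAt dw w'' (Icc 0 T) t) :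
    V.calM T l w 2 t = V.brk₂ (l t) (w t) (dl t) (dw t) l'' w'' := by
  rw [calM, brk₂, calM_one V hT hl hw ht]
  congr 1
  ext a b
  simp only [Matrix.of_apply]
  refine HasDerivWithinAt.derivWithin ?_ (uniqueDiffOn_Icc hT t ht)
  exact (hasDerivWithinAt_brk₁ (hl t ht) (hw t ht) hl' hw' a b).congr_of_mem
    (fun s hs => by rw [calM_one V hT hl hw hs]) ht

/-- No nonzero covector annihilates the columns of `𝒞`, `ℳ₀`, `ℳ₁` and `ℳ₂`. -/
def SpansAt (l w l' w' l'' w'' : ℝ) : Prop :=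
  ∀ p : I6 ⊕ I6 → ℝ, p ᵥ* V.calC = 0 → p ᵥ* V.brk₀ l w = 0 → p ᵥ* V.brk₁ l w l' w' = 0 →
    p ᵥ* V.brk₂ l w l' w' l'' w'' = 0 → p = 0

theorem vecMul_eq_zero_of_range_le {ι κ : Type*} [Fintype ι] [Fintype κ] {K : Matrix ι κ ℝ}
    {p : ι → ℝ} (h : ∀ x ∈ LinearMap.range K.mulVecLin, p ⬝ᵥ x = 0) : p ᵥ* K = 0 := by
  classical
  refine dotProduct_eq_zero _ fun v => ?_
  rw [← Matrix.dotProduct_mulVec]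
  exact h _ ⟨v, rfl⟩

theorem eq_top_of_dotProduct {ι : Type*} [Fintype ι] {S : Submodule ℝ (ι → ℝ)}
    (h : ∀ p : ι → ℝ, (∀ x ∈ S, p ⬝ᵥ x = 0) → p = 0) : S = ⊤ := by
  classical
  by_contra hne
  obtain ⟨f, hf, hfS⟩ := Submodule.exists_le_ker_of_lt_top S (lt_top_iff_ne_top.2 hne)
  refine hf ?_
  have hfp : ∀ x, f x = (fun i => f (Pi.single i 1)) ⬝ᵥ x := by
    intro x
    rw [LinearMap.pi_apply_eq_sum_univ f x]
    simp only [dotProduct, smul_eq_mul]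
    refine Finset.sum_congr rfl fun i _ => ?_
    rw [mul_comm]
    congr 2
    ext j
    simp [Pi.single_apply, eq_comm]
  have h0 := h (fun i => f (Pi.single i 1)) fun x hx => by rw [← hfp]; exact hfS hx
  refine LinearMap.ext fun x => ?_
  rw [hfp, h0, zero_dotProduct, LinearMap.zero_apply]

/-- The dual formulation: a subspace whose only annihilator is `0` is the whole space. The brackets
up to order two are enough, so no higher derivative of the reference trajectory is needed. -/
theorem rankCondition_of_spansAt {T : ℝ} (hT : 0 < T) {l w dl dw : ℝ → ℝ}
    (hl : ∀ t ∈ Icc 0 T, HasDerivWithinAt l (dl t) (Icc 0 T) t)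
    (hw : ∀ t ∈ Icc 0 T, HasDerivWithinAt w (dw t) (Icc 0 T) t) {l'' w'' : ℝ}
    (hl' : HasDerivWithinAt dl l'' (Icc 0 T) T) (hw' : HasDerivWithinAt dw w'' (Icc 0 T) T)
    (h : V.SpansAt (l T) (w T) (dl T) (dw T) l'' w'') : V.RankCondition T l w := by
  have hTm : T ∈ Icc 0 T := ⟨hT.le, le_rfl⟩
  rw [RankCondition]
  have htop : LinearMap.range V.calC.mulVecLin ⊔
      ⨆ i : ℕ, LinearMap.range (V.calM T l w i T).mulVecLin = ⊤ := by
    refine eq_top_of_dotProduct fun p hp => ?_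
    have hi : ∀ i, p ᵥ* V.calM T l w i T = 0 := fun i => vecMul_eq_zero_of_range_le fun x hx =>
      hp x (Submodule.mem_sup_right (Submodule.mem_iSup_of_mem i hx))
    refine h p (vecMul_eq_zero_of_range_le fun x hx => hp x (Submodule.mem_sup_left hx)) ?_ ?_ ?_
    · rw [← calM_zero V T l w T]; exact hi 0
    · rw [← calM_one V hT hl hw hTm]; exact hi 1
    · rw [← calM_two V hT hl hw hTm hl' hw']; exact hi 2
  rw [htop, finrank_top, Module.finrank_fintype_fun_eq_card]
  rfl

/-! ### The brackets at the final time, rescaled by `lam` -/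

/-- Derivative of the reference control at the final time, divided by `lam`. -/
def endRate (lam s : ℝ) : ℝ := V.α⁻¹ * (2 - V.γ * lam * s ^ 2)

/-- Second derivative of the reference control at the final time, divided by `lam`. -/
def endRate₂ (lam s : ℝ) : ℝ := V.α⁻¹ * (-2 * V.β * lam * s - 2 * V.γ * lam * s * V.endRate lam s)

/-- `ℳ₁ / lam` at the final time. -/
def endBrk₁ (lam s : ℝ) : Matrix (I6 ⊕ I6) (Fin m) ℝ :=
  (2 : ℝ) • V.inpL + V.endRate lam s • V.inpW - s • (drift₀ * V.inpW + V.driftW * V.inp₀)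
    - (lam * s ^ 2) • (V.driftW * V.inpW)

/-- `ℳ₂ / lam` at the final time. -/
def endBrk₂ (lam s : ℝ) : Matrix (I6 ⊕ I6) (Fin m) ℝ :=
  V.endRate₂ lam s • V.inpW -
    (((2 : ℝ) • V.driftL + V.endRate lam s • V.driftW) * (V.inp₀ + (lam * s) • V.inpW)
      + (drift₀ + (lam * s) • V.driftW) * ((2 : ℝ) • V.inpL + V.endRate lam s • V.inpW))
    - (drift₀ + (lam * s) • V.driftW) * V.endBrk₁ lam s

/-- The constant part of the drift has square zero. Hence the term of order zero in `lam` drops out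
of the first bracket, which makes the division by `lam` possible. -/
theorem drift₀_mul_inp₀ : drift₀ * V.inp₀ = 0 := by
  rw [inp₀, ← Matrix.mul_assoc, drift₀, Matrix.fromBlocks_multiply]
  simp

theorem brk₀_end (lam s : ℝ) : V.brk₀ 0 (lam * s) = V.inp₀ + (lam * s) • V.inpW := by
  simp [brk₀]

theorem calA_end (lam s : ℝ) : V.calA 0 (lam * s) = drift₀ + (lam * s) • V.driftW := by
  simp [calA_eq]

theorem brk₁_end (lam s : ℝ) :
    V.brk₁ 0 (lam * s) (2 * lam) (lam * V.endRate lam s) = lam • V.endBrk₁ lam s := by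
  rw [brk₁, brk₀_end, calA_end, endBrk₁]
  simp only [Matrix.add_mul, Matrix.mul_add, Matrix.smul_mul, Matrix.mul_smul, drift₀_mul_inp₀]
  module

theorem brk₂_end (lam s : ℝ) : V.brk₂ 0 (lam * s) (2 * lam) (lam * V.endRate lam s) 0
    (lam * V.endRate₂ lam s) = lam • V.endBrk₂ lam s := by
  rw [brk₂, brk₁_end, brk₀_end, calA_end, endBrk₂]
  simp only [Matrix.add_mul, Matrix.mul_add, Matrix.smul_mul, Matrix.mul_smul]
  module

/-- The matrix whose columns are those of `𝒞`, `ℳ₀`, `ℳ₁ / lam`, `ℳ₂ / lam`. -/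
def endMatrix (lam s : ℝ) : Matrix (I6 ⊕ I6) ((Fin m ⊕ Fin m) ⊕ (Fin m ⊕ Fin m)) ℝ :=
  Matrix.fromCols (Matrix.fromCols V.calC (V.inp₀ + (lam * s) • V.inpW))
    (Matrix.fromCols (V.endBrk₁ lam s) (V.endBrk₂ lam s))

theorem spansAt_of_endMatrix {lam s : ℝ} (hlam : lam ≠ 0)
    (h : ∀ p, p ᵥ* V.endMatrix lam s = 0 → p = 0) :
    V.SpansAt 0 (lam * s) (2 * lam) (lam * V.endRate lam s) 0 (lam * V.endRate₂ lam s) := by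
  intro p h1 h2 h3 h4
  rw [brk₀_end] at h2
  rw [brk₁_end, Matrix.vecMul_smul] at h3
  rw [brk₂_end, Matrix.vecMul_smul] at h4
  refine h p ?_
  rw [endMatrix, vecMul_fromCols_eq_zero_iff, vecMul_fromCols_eq_zero_iff,
    vecMul_fromCols_eq_zero_iff]
  exact ⟨⟨h1, h2⟩, (smul_eq_zero.1 h3).resolve_left hlam, (smul_eq_zero.1 h4).resolve_left hlam⟩

/-- For `s = 0` every occurrence of `lam` is multiplied by `s`. This is what allows arbitrary `lam`
in the exact case. -/
theorem endMatrix_zero (lam : ℝ) : V.endMatrix lam 0 = V.endMatrix 0 0 := by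
  simp [endMatrix, endBrk₁, endBrk₂, endRate, endRate₂]

theorem continuous_endMatrix : Continuous fun x : ℝ × ℝ => V.endMatrix x.1 x.2 := by
  have h1 : Continuous fun x : ℝ × ℝ => V.endRate x.1 x.2 := by unfold endRate; fun_prop
  have h2 : Continuous fun x : ℝ × ℝ => V.endRate₂ x.1 x.2 := by unfold endRate₂; fun_prop
  have h3 : Continuous fun x : ℝ × ℝ => V.endBrk₁ x.1 x.2 := by unfold endBrk₁; fun_prop
  have h4 : Continuous fun x : ℝ × ℝ => V.endBrk₂ x.1 x.2 := by
    have c1 : Continuous fun x : ℝ × ℝ =>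
      (2 : ℝ) • V.driftL + V.endRate x.1 x.2 • V.driftW := by fun_prop
    have c2 : Continuous fun x : ℝ × ℝ => V.inp₀ + (x.1 * x.2) • V.inpW := by fun_prop
    have c3 : Continuous fun x : ℝ × ℝ => drift₀ + (x.1 * x.2) • V.driftW := by fun_prop
    have c4 : Continuous fun x : ℝ × ℝ =>
      (2 : ℝ) • V.inpL + V.endRate x.1 x.2 • V.inpW := by fun_prop
    unfold endBrk₂
    refine ((h2.smul continuous_const).sub ?_).sub ?_
    · exact (c1.matrix_mul c2).add (c3.matrix_mul c4)
    · exact c3.matrix_mul h3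
  refine continuous_matrix fun a b => ?_
  rcases b with (b | b) | (b | b)
  · exact continuous_const
  · simp only [endMatrix, Matrix.fromCols_apply_inl, Matrix.fromCols_apply_inr, Matrix.add_apply,
      Matrix.smul_apply]
    fun_prop
  · exact h3.matrix_elem a b
  · exact h4.matrix_elem a b

theorem SymmetricEntries.drift_α {V : Vehicle m} (hV : V.SymmetricEntries) (hα : V.α ≠ 0) :
    V.α • V.driftL + V.driftW = Matrix.fromBlocks V.boldD 0 0 (V.JJ⁻¹ * V.boldA) := by
  have h := V.calA_eq V.α 1
  rw [calA, hV.linA_α hα, linD_α] at h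
  have h1 : V.α • V.driftL + V.driftW =
      Matrix.fromBlocks V.boldD 1 0 (V.JJ⁻¹ * V.boldA) - drift₀ := by
    rw [h]; simp [add_assoc]
  rw [h1, drift₀]
  ext (a | a) (b | b) <;> simp

theorem SymmetricEntries.inp_α {V : Vehicle m} (hV : V.SymmetricEntries) (hα : V.α ≠ 0) :
    V.α • V.inpL + V.inpW =
      Matrix.fromRows 0 (V.JJ⁻¹ * (V.boldB + V.boldA * V.JJ⁻¹ * V.C)) := by
  have h1 : V.α • V.inpL + V.inpW =
      V.calB V.α 1 + (V.α • V.driftL + V.driftW) * V.calC := by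
    rw [calB_eq V V.α 1, inpL, inpW, Matrix.add_mul, Matrix.smul_mul]
    module
  rw [h1, hV.drift_α hα, calB, linB_α, calC, Matrix.fromBlocks_mul_fromRows]
  ext (a | a) b <;> simp [Matrix.mul_add, Matrix.mul_assoc]

theorem inp₀_eq : V.inp₀ = Matrix.fromRows (V.JJ⁻¹ * V.C) 0 := by
  rw [inp₀, drift₀, calC, Matrix.fromBlocks_mul_fromRows]
  simp

/-- Split the covector into a position half `a` and a velocity half `b`. Then `𝒞` and `ℳ₁` only
involve `b`, and say that `b ᵥ* V.JJ⁻¹` annihilates the matrix of the first rank hypothesis.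
Likewise `ℳ₀` and `ℳ₂` only involve `a`, and lead to the matrix of the second one. -/
theorem SymmetricEntries.endMatrix_zero_zero {V : Vehicle m} (hV : V.SymmetricEntries)
    (hα : V.α ≠ 0)
    (hrank₁ : (Matrix.fromCols V.C (V.boldB + V.boldA * V.JJ⁻¹ * V.C)).rank = 6)
    (hrank₂ : (Matrix.fromCols V.C
      ((1 / 2 : ℝ) • (V.JJ * V.boldD * V.JJ⁻¹ * V.C) + V.boldB + V.boldA * V.JJ⁻¹ * V.C)).rank = 6)
    (p : I6 ⊕ I6 → ℝ) (hp : p ᵥ* V.endMatrix 0 0 = 0) : p = 0 := by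
  rw [endMatrix, vecMul_fromCols_eq_zero_iff, vecMul_fromCols_eq_zero_iff,
    vecMul_fromCols_eq_zero_iff] at hp
  obtain ⟨⟨h1, h2⟩, h3, h4⟩ := hp
  set X := V.boldB + V.boldA * V.JJ⁻¹ * V.C with hX
  have e1 : V.endBrk₁ 0 0 = (2 * V.α⁻¹) • (V.α • V.inpL + V.inpW) := by
    have h : (2 : ℝ) = 2 * V.α⁻¹ * V.α := by field_simp
    rw [smul_add, smul_smul, ← h]
    simp [endBrk₁, endRate, mul_comm]
  -- The constant drift acts on the input twice: once through the derivative of the product in `ℳ₁`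
  -- and once through the new bracket. Hence the factor `2`, which becomes the `1 / 2` in the second
  -- rank hypothesis.
  have e2 : V.endBrk₂ 0 0 = -(2 * V.α⁻¹) • ((V.α • V.driftL + V.driftW) * V.inp₀ +
      (2 : ℝ) • (drift₀ * (V.α • V.inpL + V.inpW))) := by
    have hr : V.endRate 0 0 = 2 * V.α⁻¹ := by simp [endRate, mul_comm]
    have e3 : (2 : ℝ) • V.driftL + (2 * V.α⁻¹) • V.driftW =
        (2 * V.α⁻¹) • (V.α • V.driftL + V.driftW) := by
      rw [smul_add, smul_smul]
      congr 2
      field_simp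
    have e4 : (2 : ℝ) • V.inpL + (2 * V.α⁻¹) • V.inpW =
        (2 * V.α⁻¹) • (V.α • V.inpL + V.inpW) := by
      rw [smul_add, smul_smul]
      congr 2
      field_simp
    rw [endBrk₂, e1, hr, e3, e4]
    simp only [endRate₂, mul_zero, zero_mul, zero_smul, add_zero, Matrix.mul_smul, Matrix.smul_mul]
    simp only [sub_zero, mul_zero, zero_smul]
    module
  have h2α : (2 * V.α⁻¹) ≠ 0 := by positivity
  rw [e1, hV.inp_α hα, Matrix.vecMul_smul] at h3
  rw [e2, hV.inp_α hα, hV.drift_α hα, Matrix.vecMul_smul, inp₀_eq, drift₀] at h4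
  have h3 := (smul_eq_zero.1 h3).resolve_left h2α
  have h4 := (smul_eq_zero.1 h4).resolve_left (neg_ne_zero.2 h2α)
  simp only [mul_zero, zero_smul, add_zero] at h2
  rw [inp₀_eq] at h2
  rw [calC] at h1
  obtain ⟨a, b, rfl⟩ : ∃ a b : I6 → ℝ, p = Sum.elim a b :=
    ⟨p ∘ Sum.inl, p ∘ Sum.inr, (Sum.elim_comp_inl_inr p).symm⟩
  rw [Matrix.fromBlocks_mul_fromRows, Matrix.fromBlocks_mul_fromRows] at h4
  simp only [Matrix.vecMul_add, Matrix.vecMul_smul, Matrix.sumElim_vecMul_fromRows,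
    Matrix.vecMul_zero, zero_add, add_zero, Matrix.zero_mul, Matrix.mul_zero, Matrix.one_mul]
    at h1 h2 h3 h4
  have hJ : ∀ q : I6 → ℝ, q ᵥ* V.JJ⁻¹ = 0 → q = 0 := by
    intro q hq
    have := congrArg (fun v => v ᵥ* V.JJ) hq
    simpa [Matrix.vecMul_vecMul, Matrix.nonsing_inv_mul _ V.isUnit_det_JJ] using this
  have hb : b ᵥ* V.JJ⁻¹ = 0 := by
    refine vecMul_eq_zero_of_rank_eq (by simpa using hrank₁) ?_
    rw [vecMul_fromCols_eq_zero_iff, Matrix.vecMul_vecMul, Matrix.vecMul_vecMul]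
    exact ⟨h1, h3⟩
  have ha : a ᵥ* V.JJ⁻¹ = 0 := by
    refine vecMul_eq_zero_of_rank_eq (by simpa using hrank₂) ?_
    rw [vecMul_fromCols_eq_zero_iff, Matrix.vecMul_vecMul, add_assoc, Matrix.vecMul_add,
      Matrix.vecMul_smul, Matrix.vecMul_vecMul, Matrix.vecMul_vecMul]
    refine ⟨h2, ?_⟩
    have e5 : V.JJ⁻¹ * (V.JJ * V.boldD * V.JJ⁻¹ * V.C) = V.boldD * (V.JJ⁻¹ * V.C) := by
      rw [Matrix.mul_assoc, Matrix.mul_assoc, ← Matrix.mul_assoc V.JJ⁻¹,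
        Matrix.nonsing_inv_mul _ V.isUnit_det_JJ, Matrix.one_mul]
    rw [e5]
    have h5 := congrArg (fun v => (1 / 2 : ℝ) • v) h4
    simp only [smul_zero, smul_add, smul_smul] at h5
    norm_num at h5
    simpa using h5
  rw [hJ a ha, hJ b hb]
  ext (i | i) <;> rfl

end Vehicle

/-! ### The reference velocity -/

section referenceVelocity

variable {T : ℝ} {ξ : ℝ → ℝ} (lam : ℝ)

theorem IsCutoff.contDiff_hbar (hξ : IsCutoff T ξ) : ContDiff ℝ ∞ (hbar T ξ lam) := by
  have := hξ.1
  unfold hbar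
  fun_prop

theorem IsCutoff.contDiff_lbar (hξ : IsCutoff T ξ) : ContDiff ℝ ∞ (lbar T ξ lam) :=
  ((contDiff_infty_iff_deriv).1 (hξ.contDiff_hbar lam)).2

theorem IsCutoff.hasDerivAt_hbar (hξ : IsCutoff T ξ) (t : ℝ) :
    HasDerivAt (hbar T ξ lam) (lbar T ξ lam t) t :=
  ((hξ.contDiff_hbar lam).differentiable (by simp) t).hasDerivAt

theorem IsCutoff.hasDerivAt_lbar (hξ : IsCutoff T ξ) (t : ℝ) :
    HasDerivAt (lbar T ξ lam) (deriv (lbar T ξ lam) t) t :=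
  ((hξ.contDiff_lbar lam).differentiable (by simp) t).hasDerivAt

theorem IsCutoff.lbar_of_lt (hξ : IsCutoff T ξ) {t : ℝ} (ht : t < T / 3) :
    lbar T ξ lam t = 0 := by
  have h : hbar T ξ lam =ᶠ[𝓝 t] fun _ => 0 := by
    filter_upwards [eventually_lt_nhds ht] with s hs
    rw [hbar, hξ.2.2.1 s hs, mul_zero, zero_mul]
  rw [lbar, h.deriv_eq, deriv_const]

theorem IsCutoff.hbar_of_lt (hξ : IsCutoff T ξ) {t : ℝ} (ht : t < T / 3) :
    hbar T ξ lam t = 0 := by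
  rw [hbar, hξ.2.2.1 t ht, mul_zero, zero_mul]

theorem IsCutoff.lbar_of_gt (hξ : IsCutoff T ξ) {t : ℝ} (ht : 2 * T / 3 < t) :
    lbar T ξ lam t = 2 * lam * (t - T) := by
  have h : hbar T ξ lam =ᶠ[𝓝 t] fun s => lam * (s - T) ^ 2 := by
    filter_upwards [eventually_gt_nhds ht] with s hs
    rw [hbar, hξ.2.2.2 s hs, mul_one]
  have h2 : HasDerivAt (fun s : ℝ => lam * (s - T) ^ 2) (2 * lam * (t - T)) t := by
    have := (((hasDerivAt_id t).sub_const T).pow 2).const_mul lam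
    refine this.congr_deriv ?_
    simp only [id, Nat.cast_ofNat, pow_one, Nat.add_one_sub_one, mul_one]
    ring
  rw [lbar, h.deriv_eq, h2.deriv]

theorem IsCutoff.deriv_lbar_of_gt (hξ : IsCutoff T ξ) {t : ℝ} (ht : 2 * T / 3 < t) :
    deriv (lbar T ξ lam) t = 2 * lam := by
  have h : lbar T ξ lam =ᶠ[𝓝 t] fun s => 2 * lam * (s - T) := by
    filter_upwards [eventually_gt_nhds ht] with s hs
    exact hξ.lbar_of_gt lam hs
  have h2 : HasDerivAt (fun s : ℝ => 2 * lam * (s - T)) (2 * lam) t := by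
    simpa using ((hasDerivAt_id t).sub_const T).const_mul (2 * lam)
  rw [h.deriv_eq, h2.deriv]

theorem IsCutoff.hasDerivAt_deriv_lbar (hξ : IsCutoff T ξ) {t : ℝ} (ht : 2 * T / 3 < t) :
    HasDerivAt (deriv (lbar T ξ lam)) 0 t := by
  refine (hasDerivAt_const t (2 * lam)).congr_of_eventuallyEq ?_
  filter_upwards [eventually_gt_nhds ht] with s hs
  exact hξ.deriv_lbar_of_gt lam hs

theorem lbar_eq_mul (T : ℝ) (ξ : ℝ → ℝ) (lam t : ℝ) : lbar T ξ lam t = lam * lbar T ξ 1 t := by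
  have h : hbar T ξ lam = fun t => lam * hbar T ξ 1 t := by ext t; simp only [hbar]; ring
  rw [lbar, lbar, h, deriv_const_mul_field]

theorem IsCutoff.exists_bound_lbar (hξ : IsCutoff T ξ) :
    ∃ K : ℝ, 0 ≤ K ∧ ∀ lam, ∀ t ∈ Icc 0 T, |lbar T ξ lam t| ≤ |lam| * K := by
  obtain ⟨K, hK⟩ := isCompact_Icc.exists_bound_of_continuousOn
    (hξ.contDiff_lbar 1).continuous.continuousOn (s := Icc 0 T)
  refine ⟨|K|, abs_nonneg _, fun lam t ht => ?_⟩
  rw [lbar_eq_mul, abs_mul]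
  exact mul_le_mul_of_nonneg_left ((hK t ht).trans (le_abs_self K)) (abs_nonneg _)

end referenceVelocity

/-! ### Existence, uniqueness and size of the reference control -/

namespace Vehicle

variable {m : ℕ} [NeZero m] (V : Vehicle m) {T : ℝ} {ξ : ℝ → ℝ} {lam : ℝ}

theorem IsReferenceControl.continuousOn {V : Vehicle m} {w : ℝ → ℝ}
    (hw : V.IsReferenceControl T ξ lam w) : ContinuousOn w (Icc 0 T) :=
  fun t ht => (hw.2 t ht).continuousWithinAt

/-- The reference control is unique. -/
theorem IsReferenceControl.eqOn {V : Vehicle m} (hξ : IsCutoff T ξ) {w₁ w₂ : ℝ → ℝ}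
    (h₁ : V.IsReferenceControl T ξ lam w₁) (h₂ : V.IsReferenceControl T ξ lam w₂) :
    EqOn w₁ w₂ (Icc 0 T) := by
  obtain ⟨K, hK0, hK⟩ := hξ.exists_bound_lbar
  obtain ⟨b₁, hb₁⟩ := isCompact_Icc.exists_bound_of_continuousOn h₁.continuousOn
  obtain ⟨b₂, hb₂⟩ := isCompact_Icc.exists_bound_of_continuousOn h₂.continuousOn
  set b := max b₁ b₂
  set c : ℝ := |V.α⁻¹| * (|V.β| * (|lam| * K) + |V.γ| * (|b| + |b|)) with hc
  have hc0 : 0 ≤ c := by positivity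
  -- The right-hand side is quadratic in `w`, hence only locally Lipschitz; both solutions are
  -- bounded on `[0, T]`, so a common closed ball of radius `b` suffices.
  refine ODE_solution_unique_of_mem_Icc_right (K := ⟨c, hc0⟩) (s := fun _ => Metric.closedBall 0 b)
    (v := fun t w => V.α⁻¹ * (deriv (lbar T ξ lam) t - V.β * lbar T ξ lam t * w - V.γ * w ^ 2))
    ?_ h₁.continuousOn ?_ ?_ h₂.continuousOn ?_ ?_ (by rw [h₁.1, h₂.1])
  · intro t ht
    refine LipschitzOnWith.of_dist_le_mul fun x hx y hy => ?_
    rw [mem_closedBall_zero_iff, Real.norm_eq_abs] at hx hy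
    rw [Real.dist_eq, Real.dist_eq]
    have e : V.α⁻¹ * (deriv (lbar T ξ lam) t - V.β * lbar T ξ lam t * x - V.γ * x ^ 2) -
        V.α⁻¹ * (deriv (lbar T ξ lam) t - V.β * lbar T ξ lam t * y - V.γ * y ^ 2) =
        -(V.α⁻¹ * (V.β * lbar T ξ lam t + V.γ * (x + y))) * (x - y) := by ring
    rw [e, abs_mul, abs_neg, abs_mul]
    change _ ≤ c * _
    rw [hc]
    gcongr
    refine (abs_add_le _ _).trans ?_
    rw [abs_mul, abs_mul]
    gcongr
    · exact hK lam t ⟨ht.1, ht.2.le⟩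
    · exact (abs_add_le _ _).trans
        (add_le_add (hx.trans (le_abs_self b)) (hy.trans (le_abs_self b)))
  · exact fun t ht => (h₁.2 t ⟨ht.1, ht.2.le⟩).mono_of_mem_nhdsWithin
      (Icc_mem_nhdsGE_of_mem ht)
  · exact fun t ht => mem_closedBall_zero_iff.2 ((hb₁ t ⟨ht.1, ht.2.le⟩).trans (le_max_left _ _))
  · exact fun t ht => (h₂.2 t ⟨ht.1, ht.2.le⟩).mono_of_mem_nhdsWithin
      (Icc_mem_nhdsGE_of_mem ht)
  · exact fun t ht => mem_closedBall_zero_iff.2 ((hb₂ t ⟨ht.1, ht.2.le⟩).trans (le_max_right _ _))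

/-- The solution is taken as a fixed point of the Picard operator itself, because the bound on it,
and not just its existence, is needed to control the final value. -/
theorem exists_solution_mem_closedBall {f : ℝ → ℝ → ℝ} (hT : 0 ≤ T) {a L K : NNReal}
    (hf : IsPicardLindelof f (⟨0, left_mem_Icc.2 hT⟩ : Icc 0 T) 0 a 0 L K) :
    ∃ z : ℝ → ℝ, z 0 = 0 ∧ (∀ t ∈ Icc 0 T, HasDerivWithinAt z (f t (z t)) (Icc 0 T) t) ∧
      ∀ t, |z t| ≤ a := by
  obtain ⟨z, hz⟩ := ODE.FunSpace.exists_isFixedPt_next hf (Metric.mem_closedBall_self le_rfl)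
  have hz' := (ODE.FunSpace.isFixedPt_next_iff hf (Metric.mem_closedBall_self le_rfl)).1 hz
  have hmem : ∀ t, z.compProj t ∈ Metric.closedBall (0 : ℝ) a :=
    fun t => ODE.FunSpace.compProj_mem_closedBall z hf.mul_max_le
  refine ⟨z.compProj, ?_, fun t ht => ?_, fun t => ?_⟩
  · rw [ODE.FunSpace.compProj_val (t := ⟨0, left_mem_Icc.2 hT⟩), hz' ⟨0, left_mem_Icc.2 hT⟩]
    simp
  · refine (ODE.hasDerivWithinAt_picard_Icc (left_mem_Icc.2 hT) hf.continuousOn_uncurry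
      z.continuous_compProj.continuousOn (fun t' _ => hmem t') 0 ht).congr_of_mem ?_ ht
    intro t' ht'
    rw [ODE.FunSpace.compProj_of_mem ht', hz']
  · simpa using hmem t

/-- The substitution `w = z + l / α` removes the derivative of the velocity from the equation. What
is left for `z` is quadratic in small quantities, and `z = 0` is a solution when `γ + α β = 0`. -/
theorem isReferenceControl_of_add_div {V : Vehicle m} (hT : 0 < T)
    (hξ : IsCutoff T ξ) {z : ℝ → ℝ} (h0 : z 0 = 0)
    (hz : ∀ t ∈ Icc 0 T, HasDerivWithinAt z (-(V.α⁻¹ * (V.β * lbar T ξ lam t *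
      (z t + lbar T ξ lam t / V.α) + V.γ * (z t + lbar T ξ lam t / V.α) ^ 2))) (Icc 0 T) t) :
    V.IsReferenceControl T ξ lam fun t => z t + lbar T ξ lam t / V.α := by
  refine ⟨by simp [h0, hξ.lbar_of_lt lam (show 0 < T / 3 by linarith)], fun t ht => ?_⟩
  refine ((hz t ht).fun_add
    ((hξ.hasDerivAt_lbar lam t).hasDerivWithinAt.div_const V.α)).congr_deriv ?_
  ring

/-- The reference control exists, and at the final time it is `lam * s` where `s` is small, or zero
in the exact case. -/
theorem exists_isReferenceControl (hα : V.α ≠ 0) (hT : 0 < T) (hξ : IsCutoff T ξ) {ε : ℝ}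
    (hε : 0 < ε) : ∃ lam₀ > 0, ∀ lam : ℝ, (V.γ + V.α * V.β = 0 ∨ |lam| ≤ lam₀) →
      ∃ w : ℝ → ℝ, V.IsReferenceControl T ξ lam w ∧
        ∃ s : ℝ, w T = lam * s ∧ (s = 0 ∨ |lam| < ε ∧ |s| < ε) := by
  obtain ⟨K, hK0, hK⟩ := hξ.exists_bound_lbar
  have hlT : ∀ lam, lbar T ξ lam T = 0 := fun lam => by
    rw [hξ.lbar_of_gt lam (by linarith)]; ring
  -- As long as `|z| ≤ |lam|`, the control is at most `|lam| * Q`, and the derivative of `z` at most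
  -- `P * lam ^ 2`.
  set Q : ℝ := 1 + K / |V.α| with hQ
  have hQ0 : 0 < Q := by positivity
  set P : ℝ := |V.α⁻¹| * (|V.β| * (K * Q) + |V.γ| * Q ^ 2) with hP
  have hP0 : 0 ≤ P := by positivity
  -- The first bound gives `P * lam ^ 2 * T ≤ |lam|`, so the Picard ball stays in the range of the
  -- estimates. The second gives `|lam| < ε`. The third makes the final value of `z`, divided by
  -- `lam`, smaller than `ε`.
  refine ⟨min (1 / (P * T + 1)) (min (ε / 2) (ε / (2 * (P * T + 1)))), by positivity,
    fun lam hlam => ?_⟩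
  rcases eq_or_ne lam 0 with rfl | hlam0
  · refine ⟨fun t => 0 + lbar T ξ 0 t / V.α,
      isReferenceControl_of_add_div hT hξ rfl fun t ht => ?_, 0, by simp [hlT], Or.inl rfl⟩
    have : lbar T ξ 0 t = 0 := by rw [lbar_eq_mul, zero_mul]
    simpa [this] using hasDerivWithinAt_const t (Icc 0 T) (0 : ℝ)
  rcases hlam with h | h
  · refine ⟨fun t => 0 + lbar T ξ lam t / V.α,
      isReferenceControl_of_add_div hT hξ rfl fun t ht => ?_, 0, by simp [hlT], Or.inl rfl⟩
    refine (hasDerivWithinAt_const t (Icc 0 T) (0 : ℝ)).congr_deriv ?_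
    have h' : V.γ = -(V.α * V.β) := by linarith
    rw [h']
    field_simp
    ring
  obtain ⟨h1, h2, h3⟩ : |lam| ≤ 1 / (P * T + 1) ∧ |lam| ≤ ε / 2 ∧ |lam| ≤ ε / (2 * (P * T + 1)) :=
    ⟨h.trans (min_le_left _ _), h.trans ((min_le_right _ _).trans (min_le_left _ _)),
      h.trans ((min_le_right _ _).trans (min_le_right _ _))⟩
  have hPT : 0 ≤ P * T := by positivity
  have hl0 : 0 < |lam| := abs_pos.2 hlam0
  have ha : P * lam ^ 2 * T ≤ |lam| := by
    rw [le_div_iff₀ (by positivity)] at h1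
    rw [← sq_abs]
    nlinarith
  set f : ℝ → ℝ → ℝ := fun t z => -(V.α⁻¹ * (V.β * lbar T ξ lam t *
      (z + lbar T ξ lam t / V.α) + V.γ * (z + lbar T ξ lam t / V.α) ^ 2)) with hf
  have hw : ∀ t ∈ Icc 0 T, ∀ z, |z| ≤ |lam| → |z + lbar T ξ lam t / V.α| ≤ |lam| * Q := by
    intro t ht z hz
    refine (abs_add_le _ _).trans ?_
    rw [abs_div, hQ, mul_add, mul_one, ← mul_div_assoc]
    gcongr
    exact hK lam t ht
  have hPL : IsPicardLindelof f (⟨0, left_mem_Icc.2 hT.le⟩ : Icc 0 T) 0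
      (⟨P * lam ^ 2 * T, by positivity⟩ : NNReal) 0 (⟨P * lam ^ 2, by positivity⟩ : NNReal)
      (⟨|V.α⁻¹| * (|V.β| * (|lam| * K) + |V.γ| * (|lam| * Q + |lam| * Q)), by positivity⟩ :
        NNReal) := by
    have hball : ∀ z ∈ Metric.closedBall (0 : ℝ) (P * lam ^ 2 * T), |z| ≤ |lam| := fun z hz =>
      (mem_closedBall_zero_iff.1 hz).trans ha
    constructor
    · intro t ht
      refine LipschitzOnWith.of_dist_le_mul fun x hx y hy => ?_
      have hx := hw t ht x (hball x hx)
      have hy := hw t ht y (hball y hy)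
      rw [Real.dist_eq, Real.dist_eq]
      have e : f t x - f t y = -(V.α⁻¹ * (V.β * lbar T ξ lam t +
          V.γ * ((x + lbar T ξ lam t / V.α) + (y + lbar T ξ lam t / V.α)))) * (x - y) := by
        simp only [hf]; ring
      rw [e, abs_mul, abs_neg, abs_mul]
      change _ ≤ |V.α⁻¹| * (|V.β| * (|lam| * K) + |V.γ| * (|lam| * Q + |lam| * Q)) * _
      gcongr
      refine (abs_add_le _ _).trans ?_
      rw [abs_mul, abs_mul]
      gcongr
      · exact hK lam t ht
      · exact (abs_add_le _ _).trans (add_le_add hx hy)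
    · intro z hz
      have := (hξ.contDiff_lbar lam).continuous
      exact Continuous.continuousOn (by simp only [hf]; fun_prop)
    · intro t ht z hz
      have hz := hw t ht z (hball z hz)
      change _ ≤ P * lam ^ 2
      have e : P * lam ^ 2 = |V.α⁻¹| * ((|V.β| * (K * Q) + |V.γ| * Q ^ 2) * |lam| ^ 2) := by
        rw [hP, sq_abs, mul_assoc]
      rw [Real.norm_eq_abs, hf, abs_neg, abs_mul, e]
      refine mul_le_mul_of_nonneg_left ?_ (abs_nonneg _)
      calc |V.β * lbar T ξ lam t * (z + lbar T ξ lam t / V.α) +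
            V.γ * (z + lbar T ξ lam t / V.α) ^ 2|
          ≤ |V.β| * (|lam| * K) * (|lam| * Q) + |V.γ| * (|lam| * Q) ^ 2 := by
            refine (abs_add_le _ _).trans ?_
            rw [abs_mul, abs_mul, abs_mul, abs_pow]
            gcongr
            exact hK lam t ht
        _ = _ := by ring
    · change P * lam ^ 2 * max (T - 0) (0 - 0) ≤ P * lam ^ 2 * T - 0
      rw [sub_zero, sub_zero, sub_zero, max_eq_left hT.le]
  obtain ⟨z, hz0, hz, hzb⟩ := exists_solution_mem_closedBall hT.le hPL
  refine ⟨_, isReferenceControl_of_add_div hT hξ hz0 hz, z T / lam, ?_, Or.inr ⟨?_, ?_⟩⟩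
  · simp only [hlT, zero_div, add_zero]
    field_simp
  · linarith
  · have hzT : |z T| ≤ P * lam ^ 2 * T := hzb T
    rw [abs_div, div_lt_iff₀ hl0]
    rw [le_div_iff₀ (by positivity)] at h3
    rw [← sq_abs] at hzT
    nlinarith

/-- Near the parameters `(0, 0)` the end matrices have no annihilator. -/
theorem exists_forall_endMatrix (h : ∀ p, p ᵥ* V.endMatrix 0 0 = 0 → p = 0) :
    ∃ ε > 0, ∀ lam s : ℝ, (s = 0 ∨ |lam| < ε ∧ |s| < ε) →
      ∀ p, p ᵥ* V.endMatrix lam s = 0 → p = 0 := by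
  have hc : Continuous fun x : ℝ × ℝ => (V.endMatrix x.1 x.2 * (V.endMatrix x.1 x.2)ᵀ).det :=
    (V.continuous_endMatrix.matrix_mul V.continuous_endMatrix.matrix_transpose).matrix_det
  have hev := hc.continuousAt.eventually_ne (x := ((0 : ℝ), (0 : ℝ)))
    ((det_mul_transpose_ne_zero_iff _).2 h)
  obtain ⟨ε, hε, hball⟩ := Metric.eventually_nhds_iff_ball.1 hev
  refine ⟨ε, hε, fun lam s hls => ?_⟩
  rcases hls with rfl | ⟨h1, h2⟩
  · rwa [endMatrix_zero]
  · have hmem : (lam, s) ∈ Metric.ball ((0 : ℝ), (0 : ℝ)) ε := by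
      rw [Metric.mem_ball, Prod.dist_eq, max_lt_iff, Real.dist_eq, Real.dist_eq]
      simpa using ⟨h1, h2⟩
    have hdet : (V.endMatrix lam s * (V.endMatrix lam s)ᵀ).det ≠ 0 := hball (lam, s) hmem
    exact (det_mul_transpose_ne_zero_iff (V.endMatrix lam s)).1 hdet

/-- The right-hand side of the equation of the reference control. -/
def refRate (T : ℝ) (ξ : ℝ → ℝ) (lam : ℝ) (w : ℝ → ℝ) (t : ℝ) : ℝ :=
  V.α⁻¹ * (deriv (lbar T ξ lam) t - V.β * lbar T ξ lam t * w t - V.γ * w t ^ 2)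

theorem IsReferenceControl.hasDerivWithinAt_refRate {V : Vehicle m} (hξ : IsCutoff T ξ) {w : ℝ → ℝ}
    (hw : V.IsReferenceControl T ξ lam w) {t : ℝ} (ht : t ∈ Icc 0 T) :
    HasDerivWithinAt (V.refRate T ξ lam w)
      (V.α⁻¹ * (deriv (deriv (lbar T ξ lam)) t - V.β * (deriv (lbar T ξ lam) t * w t +
        lbar T ξ lam t * V.refRate T ξ lam w t) - 2 * V.γ * w t * V.refRate T ξ lam w t))
      (Icc 0 T) t := by
  have h1 := hw.2 t ht
  have h2 := (hξ.hasDerivAt_lbar lam t).hasDerivWithinAt (s := Icc 0 T)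
  have h3 : HasDerivWithinAt (deriv (lbar T ξ lam)) (deriv (deriv (lbar T ξ lam)) t) (Icc 0 T) t :=
    ((((contDiff_infty_iff_deriv).1 (hξ.contDiff_lbar lam)).2.differentiable (by simp))
      t).hasDerivAt.hasDerivWithinAt
  refine (((h3.sub ((h2.const_mul V.β).mul h1)).sub ((h1.pow 2).const_mul V.γ)).const_mul
    V.α⁻¹).congr_deriv ?_
  simp only [refRate]
  push_cast
  ring

/-- Along the reference trajectories the columns of `𝒞`, `ℳ₀`, `ℳ₁` and `ℳ₂` at the final time
span. -/
theorem exists_spansAt (hα : V.α ≠ 0) (hT : 0 < T) (hξ : IsCutoff T ξ)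
    (h : ∀ p, p ᵥ* V.endMatrix 0 0 = 0 → p = 0) :
    ∃ lam₀ > 0, ∀ lam : ℝ, lam ≠ 0 → (V.γ + V.α * V.β = 0 ∨ |lam| ≤ lam₀) →
      ∃ w : ℝ → ℝ, V.IsReferenceControl T ξ lam w ∧ ∃ l'' w'' : ℝ,
        HasDerivWithinAt (deriv (lbar T ξ lam)) l'' (Icc 0 T) T ∧
        HasDerivWithinAt (V.refRate T ξ lam w) w'' (Icc 0 T) T ∧
        V.SpansAt (lbar T ξ lam T) (w T) (deriv (lbar T ξ lam) T) (V.refRate T ξ lam w T)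
          l'' w'' := by
  obtain ⟨ε, hε, hspan⟩ := V.exists_forall_endMatrix h
  obtain ⟨lam₀, hlam₀, hex⟩ := V.exists_isReferenceControl hα hT hξ hε
  refine ⟨lam₀, hlam₀, fun lam hlam hsmall => ?_⟩
  obtain ⟨w, hw, s, hs, hls⟩ := hex lam hsmall
  have hTm : T ∈ Icc 0 T := ⟨hT.le, le_rfl⟩
  have hgt : 2 * T / 3 < T := by linarith
  have hl : lbar T ξ lam T = 0 := by rw [hξ.lbar_of_gt lam hgt, sub_self, mul_zero]
  have hl' := hξ.deriv_lbar_of_gt lam hgt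
  -- At the final time the velocity is `0` and its derivative `2 * lam`; the factor `lam` comes out
  -- because `w T = lam * s`.
  have hr : V.refRate T ξ lam w T = lam * V.endRate lam s := by
    rw [refRate, hl, hl', hs, endRate]; ring
  refine ⟨w, hw, 0, _, (hξ.hasDerivAt_deriv_lbar lam hgt).hasDerivWithinAt,
    hw.hasDerivWithinAt_refRate hξ hTm, ?_⟩
  have h2 := V.spansAt_of_endMatrix hlam (hspan lam s hls)
  rw [(hξ.hasDerivAt_deriv_lbar lam hgt).deriv, hr, hl, hl', hs]
  convert h2 using 1
  rw [endRate₂]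
  ring

theorem rankCondition_of_isReferenceControl (hT : 0 < T) (hξ : IsCutoff T ξ) {w : ℝ → ℝ}
    (hw : V.IsReferenceControl T ξ lam w) {l'' w'' : ℝ}
    (hl'' : HasDerivWithinAt (deriv (lbar T ξ lam)) l'' (Icc 0 T) T)
    (hw'' : HasDerivWithinAt (V.refRate T ξ lam w) w'' (Icc 0 T) T)
    (h : V.SpansAt (lbar T ξ lam T) (w T) (deriv (lbar T ξ lam) T) (V.refRate T ξ lam w T)
      l'' w'') : V.RankCondition T (lbar T ξ lam) w :=
  V.rankCondition_of_spansAt hT (fun t _ => (hξ.hasDerivAt_lbar lam t).hasDerivWithinAt) hw.2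
    hl'' hw'' h

/-- The rank condition holds along the reference trajectories. -/
theorem exists_rankCondition (hα : V.α ≠ 0) (hT : 0 < T) (hξ : IsCutoff T ξ)
    (h : ∀ p, p ᵥ* V.endMatrix 0 0 = 0 → p = 0) :
    ∃ lam₀ > 0, ∀ lam : ℝ, lam ≠ 0 → (V.γ + V.α * V.β = 0 ∨ |lam| ≤ lam₀) →
      (∃ w : ℝ → ℝ, V.IsReferenceControl T ξ lam w) ∧
      ∀ w : ℝ → ℝ, V.IsReferenceControl T ξ lam w → V.RankCondition T (lbar T ξ lam) w := by
  obtain ⟨lam₀, hlam₀, hex⟩ := V.exists_spansAt hα hT hξ h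
  refine ⟨lam₀, hlam₀, fun lam hlam hsmall => ?_⟩
  obtain ⟨w, hw, l'', w'', hl'', hw'', hs⟩ := hex lam hlam hsmall
  -- Any other reference control agrees with `w` on `[0, T]` by uniqueness, so it has the same
  -- derivatives within the interval.
  refine ⟨⟨w, hw⟩, fun w₁ hw₁ => ?_⟩
  have heq := hw₁.eqOn hξ hw
  have hTm : T ∈ Icc 0 T := ⟨hT.le, le_rfl⟩
  have hr : EqOn (V.refRate T ξ lam w₁) (V.refRate T ξ lam w) (Icc 0 T) := fun t ht => by
    rw [refRate, refRate, heq ht]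
  refine V.rankCondition_of_isReferenceControl hT hξ hw₁ hl''
    (hw''.congr_of_mem hr hTm) ?_
  rw [heq hTm, hr hTm]
  exact hs

end Vehicle

/-! ### Composition operators on spaces of continuous functions -/

section composition

variable {K Y F : Type*} [TopologicalSpace K] [CompactSpace K]
  [NormedAddCommGroup Y] [NormedSpace ℝ Y] [NormedAddCommGroup F] [NormedSpace ℝ F]

/-- Pointwise evaluation of continuous families of linear maps. -/
def pointwiseApply : C(K, Y →L[ℝ] F) →L[ℝ] C(K, Y) →L[ℝ] C(K, F) :=
  LinearMap.mkContinuous₂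
    (LinearMap.mk₂ ℝ (fun (L : C(K, Y →L[ℝ] F)) (h : C(K, Y)) =>
        (⟨fun t => L t (h t), by fun_prop⟩ : C(K, F)))
      (fun L L' h => by ext; simp) (fun c L h => by ext; simp) (fun L h h' => by ext; simp)
      (fun c L h => by ext; simp)) 1 fun L h => by
    rw [ContinuousMap.norm_le _ (by positivity), one_mul]
    intro t
    exact ((L t).le_opNorm (h t)).trans (by
      gcongr
      · exact L.norm_coe_le_norm t
      · exact h.norm_coe_le_norm t)

@[simp]
theorem pointwiseApply_apply (L : C(K, Y →L[ℝ] F)) (h : C(K, Y)) (t : K) :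
    pointwiseApply L h t = L t (h t) := rfl

/-- The derivative of a `C¹` function, as a continuous map. -/
def fderivMap (G : Y → F) (hG : ContDiff ℝ 1 G) : C(Y, Y →L[ℝ] F) :=
  ⟨fderiv ℝ G, hG.continuous_fderiv one_ne_zero⟩

/-- The mean value inequality is applied at each `t`. It is uniform in `t` because composition with
the derivative of `G` is continuous for the uniform norm, `K` being compact. -/
theorem hasFDerivAt_comp_continuousMap {G : Y → F} (hG : ContDiff ℝ 1 G) (x : C(K, Y)) :
    HasFDerivAt (fun x : C(K, Y) => (⟨G, hG.continuous⟩ : C(Y, F)).comp x)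
      (pointwiseApply ((fderivMap G hG).comp x)) x := by
  rw [hasFDerivAt_iff_isLittleO_nhds_zero, Asymptotics.isLittleO_iff]
  intro c hc
  have hcont : Continuous fun x : C(K, Y) => (fderivMap G hG).comp x :=
    ContinuousMap.continuous_postcomp _
  obtain ⟨δ, hδ, h0⟩ := (Metric.continuousAt_iff
    (f := fun x : C(K, Y) => (fderivMap G hG).comp x)).1 (by exact hcont.continuousAt (x := x)) c hc
  filter_upwards [Metric.ball_mem_nhds (0 : C(K, Y)) hδ] with h hh
  rw [mem_ball_zero_iff] at hh
  rw [ContinuousMap.norm_le _ (by positivity)]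
  intro t
  have key : ‖G (x t + h t) - G (x t) - fderiv ℝ G (x t) (x t + h t - x t)‖ ≤
      c * ‖x t + h t - x t‖ := by
    refine Convex.norm_image_sub_le_of_norm_fderiv_le' (𝕜 := ℝ) (s := segment ℝ (x t) (x t + h t))
      (fun y _ => hG.differentiable one_ne_zero y) ?_ (convex_segment _ _)
      (left_mem_segment _ _ _) (right_mem_segment _ _ _)
    intro y hy
    rw [segment_eq_image'] at hy
    obtain ⟨θ, hθ, rfl⟩ := hy
    have h1 : dist (x + θ • h) x < δ := by
      rw [dist_eq_norm, add_sub_cancel_left, norm_smul, Real.norm_eq_abs, abs_of_nonneg hθ.1]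
      calc θ * ‖h‖ ≤ 1 * ‖h‖ := by gcongr; exact hθ.2
        _ < δ := by rwa [one_mul]
    have h2 := (ContinuousMap.dist_apply_le_dist (f := (fderivMap G hG).comp (x + θ • h))
      (g := (fderivMap G hG).comp x) t).trans (h0 h1).le
    rw [dist_eq_norm] at h2
    simpa [fderivMap] using h2
  rw [add_sub_cancel_left] at key
  exact key.trans (by gcongr; exact h.norm_coe_le_norm t)

theorem contDiff_comp_continuousMap {G : Y → F} (hG : ContDiff ℝ 1 G) :
    ContDiff ℝ 1 fun x : C(K, Y) => (⟨G, hG.continuous⟩ : C(Y, F)).comp x := by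
  rw [contDiff_one_iff_fderiv]
  refine ⟨fun x => (hasFDerivAt_comp_continuousMap hG x).differentiableAt, ?_⟩
  have h : fderiv ℝ (fun x : C(K, Y) => (⟨G, hG.continuous⟩ : C(Y, F)).comp x) =
      fun x => pointwiseApply ((fderivMap G hG).comp x) :=
    funext fun x => (hasFDerivAt_comp_continuousMap hG x).fderiv
  rw [h]
  exact pointwiseApply.continuous.comp (ContinuousMap.continuous_postcomp _)

/-- Continuous maps into a product. -/
def prodMkMap (Z : Type*) [NormedAddCommGroup Z] [NormedSpace ℝ Z] :
    C(K, Y) × C(K, Z) →L[ℝ] C(K, Y × Z) :=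
  (ContinuousLinearMap.compLeftContinuous ℝ K (ContinuousLinearMap.inl ℝ Y Z)).coprod
    (ContinuousLinearMap.compLeftContinuous ℝ K (ContinuousLinearMap.inr ℝ Y Z))

@[simp]
theorem prodMkMap_apply {Z : Type*} [NormedAddCommGroup Z] [NormedSpace ℝ Z]
    (x : C(K, Y) × C(K, Z)) (t : K) : prodMkMap Z x t = (x.1 t, x.2 t) := by
  simp [prodMkMap]

end composition

/-! ### Volterra operators -/

section volterra

variable {E : Type*} [NormedAddCommGroup E] [NormedSpace ℝ E] {T : ℝ} (hT : 0 ≤ T)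

theorem continuous_IccExtend_map (z : C(Icc 0 T, E)) : Continuous (IccExtend hT z) :=
  z.continuous.Icc_extend'

theorem norm_IccExtend_le (z : C(Icc 0 T, E)) (s : ℝ) : ‖IccExtend hT z s‖ ≤ ‖z‖ :=
  z.norm_coe_le_norm _

/-- The primitive that vanishes at `0`. -/
def primitive : C(Icc 0 T, E) →L[ℝ] C(Icc 0 T, E) :=
  LinearMap.mkContinuous
    { toFun := fun z => ⟨fun t => ∫ s in (0 : ℝ)..t, IccExtend hT z s,
        (intervalIntegral.continuous_primitive (fun a b =>
          (continuous_IccExtend_map hT z).intervalIntegrable a b) 0).comp continuous_subtype_val⟩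
      map_add' := fun z z' => by
        ext t
        simp only [ContinuousMap.coe_mk, ContinuousMap.add_apply]
        rw [← intervalIntegral.integral_add
          ((continuous_IccExtend_map hT z).intervalIntegrable _ _)
          ((continuous_IccExtend_map hT z').intervalIntegrable _ _)]
        rfl
      map_smul' := fun c z => by
        ext t
        simp only [ContinuousMap.coe_mk, ContinuousMap.smul_apply, RingHom.id_apply]
        rw [← intervalIntegral.integral_smul]
        rfl } T fun z => by
    rw [ContinuousMap.norm_le _ (by positivity)]
    intro t
    refine (intervalIntegral.norm_integral_le_of_norm_le_const fun s _ =>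
      norm_IccExtend_le hT z s).trans ?_
    rw [sub_zero, abs_of_nonneg t.2.1, mul_comm]
    exact mul_le_mul_of_nonneg_right t.2.2 (norm_nonneg _)

theorem primitive_apply (z : C(Icc 0 T, E)) (t : Icc 0 T) :
    primitive hT z t = ∫ s in (0 : ℝ)..t, IccExtend hT z s := rfl

theorem primitive_zero (z : C(Icc 0 T, E)) : primitive hT z ⟨0, left_mem_Icc.2 hT⟩ = 0 := by
  simp [primitive_apply]

theorem hasDerivWithinAt_of_eq_primitive [CompleteSpace E] {x z : C(Icc 0 T, E)} {c : E}
    (h : ∀ t, x t = c + primitive hT z t) (t : ℝ) (ht : t ∈ Icc 0 T) :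
    HasDerivWithinAt (IccExtend hT x) (z ⟨t, ht⟩) (Icc 0 T) t := by
  have hz := continuous_IccExtend_map hT z
  have h1 : HasDerivAt (fun t => c + ∫ s in (0 : ℝ)..t, IccExtend hT z s) (IccExtend hT z t) t :=
    (intervalIntegral.integral_hasDerivAt_right (hz.intervalIntegrable _ _)
      hz.aestronglyMeasurable.stronglyMeasurableAtFilter hz.continuousAt).const_add c
  rw [IccExtend_of_mem hT z ht] at h1
  refine h1.hasDerivWithinAt.congr_of_mem (fun s hs => ?_) ht
  rw [IccExtend_of_mem hT x hs, h ⟨s, hs⟩]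
  rfl

/-- The Volterra operator `x ↦ ∫₀ A x`. -/
def volterra (A : C(Icc 0 T, E →L[ℝ] E)) : C(Icc 0 T, E) →L[ℝ] C(Icc 0 T, E) :=
  primitive hT ∘L pointwiseApply A

/-- Induction: each iteration integrates a power of `t`, which produces the factorial. -/
theorem volterra_pow_apply_le (A : C(Icc 0 T, E →L[ℝ] E)) (x : C(Icc 0 T, E)) (n : ℕ) :
    ∀ t : Icc 0 T, ‖(volterra hT A ^ n) x t‖ ≤ (‖A‖ * t) ^ n / n.factorial * ‖x‖ := by
  induction n with
  | zero => intro t; simpa using x.norm_coe_le_norm t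
  | succ n ih =>
    intro t
    set y := (volterra hT A ^ n) x with hy
    have e : (volterra hT A ^ (n + 1)) x = volterra hT A y := by
      rw [pow_succ']; rfl
    rw [e]
    have hb : ∀ s ∈ Ioc (0 : ℝ) t, ‖IccExtend hT (pointwiseApply A y) s‖ ≤
        (‖A‖ ^ (n + 1) / n.factorial * ‖x‖) * s ^ n := by
      intro s hs
      have hs' : s ∈ Icc 0 T := ⟨hs.1.le, hs.2.trans t.2.2⟩
      rw [IccExtend_of_mem hT _ hs', pointwiseApply_apply]
      calc ‖A ⟨s, hs'⟩ (y ⟨s, hs'⟩)‖ ≤ ‖A‖ * ((‖A‖ * s) ^ n / n.factorial * ‖x‖) :=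
            ((A ⟨s, hs'⟩).le_opNorm _).trans (by
              gcongr
              · exact A.norm_coe_le_norm _
              · exact ih ⟨s, hs'⟩)
        _ = _ := by rw [mul_pow, pow_succ]; ring
    have h1 := intervalIntegral.norm_integral_le_of_norm_le (μ := volume) t.2.1
      (ae_of_all _ hb) ((continuous_const.mul (continuous_pow n)).intervalIntegrable _ _)
    refine h1.trans_eq ?_
    rw [intervalIntegral.integral_const_mul, integral_pow, Nat.factorial_succ]
    push_cast
    have : (n.factorial : ℝ) ≠ 0 := by positivity
    field_simp
    simp only [sub_zero, ne_eq, Nat.add_eq_zero_iff, one_ne_zero, and_false, not_false_eq_true,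
      zero_pow, mul_pow]
    ring

/-- Some power of the operator has norm less than `1`. The geometric sum factors `1 - X ^ n` through
`1 - X`, and a factor of a unit is a unit when the factors commute. Thus linear equations are solved
on all of `[0, T]` without smallness of `T`. -/
theorem isUnit_one_sub_volterra [CompleteSpace E] (A : C(Icc 0 T, E →L[ℝ] E)) :
    IsUnit (1 - volterra hT A) := by
  have hlim := FloorSemiring.tendsto_pow_div_factorial_atTop (‖A‖ * T)
  obtain ⟨n, hn⟩ := (hlim.eventually_lt_const one_pos).exists
  have hnorm : ‖volterra hT A ^ n‖ < 1 := by
    refine lt_of_le_of_lt (ContinuousLinearMap.opNorm_le_bound _ (by positivity) fun x => ?_) hn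
    rw [ContinuousMap.norm_le _ (by positivity)]
    intro t
    refine (volterra_pow_apply_le hT A x n t).trans ?_
    have := t.2.1
    have := t.2.2
    gcongr
  have h1 : IsUnit (1 - volterra hT A ^ n) := 
    isUnit_one_sub_of_norm_lt_one (x := volterra hT A ^ n) (by exact hnorm)
  have hc : Commute (1 - volterra hT A) (∑ i ∈ Finset.range n, volterra hT A ^ i) :=
    Commute.sum_right _ _ _ fun i _ =>
      (Commute.one_left _).sub_left ((Commute.refl _).pow_right i)
  rw [← mul_neg_geom_sum] at h1
  exact (hc.isUnit_mul_iff.1 h1).1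

end volterra

/-! ### Steering by the inverse function theorem -/

section steering

variable {E Y U : Type*} [NormedAddCommGroup E] [NormedSpace ℝ E] [NormedAddCommGroup Y]
  [NormedSpace ℝ Y] [NormedAddCommGroup U] [NormedSpace ℝ U] {T : ℝ} (hT : 0 ≤ T)

/-- Constant functions. -/
def constMap (T : ℝ) (E : Type*) [NormedAddCommGroup E] [NormedSpace ℝ E] :
    E →L[ℝ] C(Icc 0 T, E) :=
  LinearMap.mkContinuous
    { toFun := fun e => ContinuousMap.const _ e
      map_add' := fun _ _ => rfl
      map_smul' := fun _ _ => rfl } 1 fun e => by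
    rw [ContinuousMap.norm_le _ (by positivity), one_mul]
    exact fun _ => le_rfl

/-- Evaluation at the final time. -/
def endEval (E : Type*) [NormedAddCommGroup E] [NormedSpace ℝ E] : C(Icc 0 T, E) →L[ℝ] E :=
  ContinuousMap.evalCLM ℝ ⟨T, right_mem_Icc.2 hT⟩

theorem endEval_apply (x : C(Icc 0 T, E)) : endEval hT E x = x ⟨T, right_mem_Icc.2 hT⟩ := rfl

/-- The linearized end-point map is bijective when the linearized system is controllable by a space
of controls with the dimension of the state space. -/
theorem bijective_linearized [CompleteSpace E] [FiniteDimensional ℝ E] [FiniteDimensional ℝ U]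
    (D : C(Icc 0 T, E × Y →L[ℝ] E)) (L : U →L[ℝ] C(Icc 0 T, Y))
    (hfin : Module.finrank ℝ U = Module.finrank ℝ E)
    (hcontrol : ∀ e : E, ∃ (u : U) (x : C(Icc 0 T, E)),
      x = primitive hT (pointwiseApply D (prodMkMap Y (x, L u))) ∧ endEval hT E x = e) :
    Function.Bijective (((ContinuousLinearMap.fst ℝ C(Icc 0 T, E) U) -
      (primitive hT ∘L pointwiseApply D ∘L prodMkMap Y) ∘L
        ((ContinuousLinearMap.fst ℝ C(Icc 0 T, E) U).prod
          (L ∘L ContinuousLinearMap.snd ℝ C(Icc 0 T, E) U))).prod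
      (endEval hT E ∘L ContinuousLinearMap.fst ℝ C(Icc 0 T, E) U)) := by
  set A : C(Icc 0 T, E →L[ℝ] E) :=
    ⟨fun t => (D t).comp (ContinuousLinearMap.inl ℝ E Y), by fun_prop⟩ with hA
  set b : U →L[ℝ] C(Icc 0 T, E) := (primitive hT ∘L pointwiseApply D ∘L prodMkMap Y) ∘L
    (ContinuousLinearMap.inr ℝ C(Icc 0 T, E) C(Icc 0 T, Y)) ∘L L with hb
  -- The linearized integral equation separates into an invertible Volterra part acting on the state
  -- and a forcing by the control.
  have hsplit : ∀ x u, x - primitive hT (pointwiseApply D (prodMkMap Y (x, L u))) =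
      (1 - volterra hT A) x - b u := by
    intro x u
    have e1 : pointwiseApply D (prodMkMap Y (x, L u)) =
        pointwiseApply A x + pointwiseApply D (prodMkMap Y (0, L u)) := by
      ext t
      simp only [pointwiseApply_apply, prodMkMap_apply, ContinuousMap.add_apply, hA,
        ContinuousMap.coe_mk, ContinuousLinearMap.comp_apply, ContinuousLinearMap.inl_apply,
        ← map_add]
      simp
    rw [e1, map_add, ← sub_sub]
    rfl
  obtain ⟨R, hR1, hR2⟩ := isUnit_iff_exists.1 (isUnit_one_sub_volterra hT A)
  have hR1' : ∀ y, (1 - volterra hT A) (R y) = y := fun y => by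
    rw [← mul_apply_eq_comp, hR1, one_apply_eq_self]
  have hR2' : ∀ y, R ((1 - volterra hT A) y) = y := fun y => by
    rw [← mul_apply_eq_comp, hR2, one_apply_eq_self]
  -- The map from a control to the final state of the solution starting at `0`. It is surjective by
  -- controllability, hence bijective by equality of dimensions.
  set Θ : U →ₗ[ℝ] E := (endEval hT E ∘L R ∘L b).toLinearMap with hΘ
  have hΘa : ∀ u, Θ u = endEval hT E (R (b u)) := fun u => rfl
  have hsurj : Function.Surjective Θ := by
    intro e
    obtain ⟨u, x, hx, hxe⟩ := hcontrol e
    refine ⟨u, ?_⟩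
    have h1 := hsplit x u
    rw [← hx, sub_self, eq_comm, sub_eq_zero] at h1
    rw [hΘa, ← h1, hR2', hxe]
  have hinj : Function.Injective Θ :=
    (LinearMap.injective_iff_surjective_of_finrank_eq_finrank hfin).2 hsurj
  constructor
  · rw [injective_iff_map_eq_zero]
    rintro ⟨x, u⟩ h
    obtain ⟨h1, h2⟩ := Prod.ext_iff.1 h
    have h1 : x - primitive hT (pointwiseApply D (prodMkMap Y (x, L u))) = 0 := h1
    have h2 : endEval hT E x = 0 := h2
    rw [hsplit, sub_eq_zero] at h1
    have h3 : x = R (b u) := by rw [← h1, hR2']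
    have h4 : u = 0 := hinj (by rw [hΘa, ← h3, h2, map_zero])
    rw [h3, h4, map_zero, map_zero]
    rfl
  · rintro ⟨y, e⟩
    obtain ⟨u, hu⟩ := hsurj (e - endEval hT E (R y))
    refine ⟨(R (y + b u), u), Prod.ext ?_ ?_⟩
    · change R (y + b u) - primitive hT (pointwiseApply D (prodMkMap Y (R (y + b u), L u))) = y
      rw [hsplit, hR1', add_sub_cancel_right]
    · change endEval hT E (R (y + b u)) = e
      rw [map_add, map_add, ← hΘa, hu, add_sub_cancel]

/-- Local steering, with a control that depends in a `C¹` way on the two end points, around a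
reference trajectory from `0` to `0` along which the linearized system is controllable. -/
theorem exists_steering [FiniteDimensional ℝ E] [FiniteDimensional ℝ U] {G : E × Y → E}
    (hG : ContDiff ℝ 1 G) (x₀ : C(Icc 0 T, E)) (c : C(Icc 0 T, Y)) (L : U →L[ℝ] C(Icc 0 T, Y))
    (href : x₀ = primitive hT ((⟨G, hG.continuous⟩ : C(E × Y, E)).comp (prodMkMap Y (x₀, c))))
    (hend : endEval hT E x₀ = 0)
    (hfin : Module.finrank ℝ U = Module.finrank ℝ E)
    (hcontrol : ∀ e : E, ∃ (u : U) (x : C(Icc 0 T, E)),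
      x = primitive hT (pointwiseApply ((fderivMap G hG).comp (prodMkMap Y (x₀, c)))
        (prodMkMap Y (x, L u))) ∧ endEval hT E x = e) :
    ∃ Φ : E × E → C(Icc 0 T, E) × U, ContDiffAt ℝ 1 Φ (0, 0) ∧ Φ (0, 0) = (x₀, 0) ∧
      ∀ᶠ p in 𝓝 ((0, 0) : E × E), (∀ t, (Φ p).1 t = p.1 + primitive hT
        ((⟨G, hG.continuous⟩ : C(E × Y, E)).comp (prodMkMap Y ((Φ p).1, c + L (Φ p).2))) t) ∧
        endEval hT E (Φ p).1 = p.2 := by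
  have hE : CompleteSpace E := FiniteDimensional.complete ℝ E
  have hU : CompleteSpace U := FiniteDimensional.complete ℝ U
  set pairing : C(Icc 0 T, E) × U →L[ℝ] C(Icc 0 T, E) × C(Icc 0 T, Y) :=
    (ContinuousLinearMap.fst ℝ C(Icc 0 T, E) U).prod
      (L ∘L ContinuousLinearMap.snd ℝ C(Icc 0 T, E) U) with hpair
  set I : C(Icc 0 T, E) × U → C(Icc 0 T, E × Y) := fun p => prodMkMap Y (p.1, c + L p.2) with hI
  have hIeq : I = fun p => prodMkMap Y (0, c) + (prodMkMap Y ∘L pairing) p := by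
    ext1 p
    rw [ContinuousLinearMap.comp_apply, ← map_add]
    simp only [hI, hpair]
    congr 1
    exact Prod.ext (zero_add _).symm rfl
  have hId : ∀ p, HasFDerivAt I (prodMkMap Y ∘L pairing) p := fun p => by
    rw [hIeq]
    exact (prodMkMap Y ∘L pairing).hasFDerivAt.const_add _
  have hIc : ContDiff ℝ 1 I := by
    rw [hIeq]
    exact contDiff_const.add (prodMkMap Y ∘L pairing).contDiff
  -- The unknowns are the whole trajectory and the control parameter. The first component is the
  -- trajectory minus the primitive of the field along it, equal to a constant function exactly for
  -- solutions; the second is the final state.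
  set 𝒢 : C(Icc 0 T, E) × U → C(Icc 0 T, E) × E := fun p =>
    (p.1 - primitive hT ((⟨G, hG.continuous⟩ : C(E × Y, E)).comp (I p)), endEval hT E p.1) with h𝒢
  have hprim : ContDiff ℝ 1 fun z : C(Icc 0 T, E) => primitive hT z :=
    (primitive (E := E) hT).contDiff
  have h𝒢c : ContDiff ℝ 1 𝒢 :=
    (contDiff_fst.sub (hprim.comp ((contDiff_comp_continuousMap hG).comp hIc))).prodMk
      ((endEval hT E).contDiff.comp contDiff_fst)
  have hI0 : I (x₀, 0) = prodMkMap Y (x₀, c) := by simp only [hI, map_zero, add_zero]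
  set D := (fderivMap G hG).comp (prodMkMap Y (x₀, c)) with hD
  have hder := (hasFDerivAt_fst (𝕜 := ℝ) (p := (x₀, (0 : U)))).sub
    ((primitive hT).hasFDerivAt.comp (x₀, (0 : U))
      ((hasFDerivAt_comp_continuousMap hG (I (x₀, 0))).comp (x₀, (0 : U)) (hId (x₀, 0))))
  have hder2 := hder.prodMk ((endEval hT E).hasFDerivAt.comp (x₀, (0 : U)) hasFDerivAt_fst)
  rw [hI0] at hder2
  have hbij := bijective_linearized hT D L hfin hcontrol
  set e := ContinuousLinearEquiv.ofBijective _ (LinearMap.ker_eq_bot.2 hbij.1)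
    (LinearMap.range_eq_top.2 hbij.2) with he
  have hder3 : HasFDerivAt 𝒢 (e : C(Icc 0 T, E) × U →L[ℝ] C(Icc 0 T, E) × E) (x₀, 0) := by
    rw [he, ContinuousLinearEquiv.coe_ofBijective]
    exact hder2
  have h0 : 𝒢 (x₀, 0) = (0, 0) := by
    simp only [h𝒢, hI0, ← href, sub_self, hend]
  have hstrict := (h𝒢c.contDiffAt (x := (x₀, 0))).hasStrictFDerivAt' hder3 one_ne_zero
  have hinv := (h𝒢c.contDiffAt (x := (x₀, 0))).to_localInverse hder3 one_ne_zero
  have hright := hstrict.eventually_right_inverse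
  have himg := hstrict.localInverse_apply_image
  rw [h0] at hinv hright himg
  -- The initial state enters as the constant function to be attained by the first component.
  set data : E × E →L[ℝ] C(Icc 0 T, E) × E :=
    (constMap T E).prodMap (ContinuousLinearMap.id ℝ E) with hdata
  have hd0 : data (0, 0) = (0, 0) := by simp [hdata]
  refine ⟨fun p => hstrict.localInverse 𝒢 e (x₀, 0) (data p), ?_, ?_, ?_⟩
  · refine ContDiffAt.comp _ ?_ data.contDiff.contDiffAt
    rw [hd0]
    exact hinv
  · simp only [hd0, himg]
  · have ht : Tendsto data (𝓝 (0, 0)) (𝓝 (0, 0)) := by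
      have := data.continuous.tendsto (0, 0)
      rwa [hd0] at this
    filter_upwards [ht.eventually hright] with p hp
    obtain ⟨h1, h2⟩ := Prod.ext_iff.1 hp
    refine ⟨fun t => ?_, h2⟩
    have h3 := DFunLike.congr_fun h1 t
    exact sub_eq_iff_eq_add.1 h3

end steering

/-! ### Controllability of linear systems -/

section linear

variable {ι κ : Type*} [Fintype ι] [Fintype κ] {T : ℝ}

/-- The continuous linear map of a matrix. -/
def matCLM (ι κ : Type*) [Fintype ι] [Fintype κ] :
    Matrix ι κ ℝ →ₗ[ℝ] (κ → ℝ) →L[ℝ] (ι → ℝ) :=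
  LinearMap.toContinuousLinearMap.toLinearMap ∘ₗ Matrix.mulVecBilin ℝ ℝ

@[simp]
theorem matCLM_apply (X : Matrix ι κ ℝ) (v : κ → ℝ) : matCLM ι κ X v = X *ᵥ v := rfl

theorem continuous_matCLM : Continuous (matCLM ι κ) :=
  LinearMap.continuous_of_finiteDimensional _

/-- The solution is the inverse of `1 - volterra` applied to the initial value plus the primitive of
`b`. -/
theorem exists_linear_ode_inhomogeneous {E : Type*} [NormedAddCommGroup E] [NormedSpace ℝ E]
    [CompleteSpace E] (hT : 0 ≤ T) (A : C(Icc 0 T, E →L[ℝ] E)) (b : C(Icc 0 T, E)) (c : E) :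
    ∃ x : ℝ → E, x 0 = c ∧ ∀ t (ht : t ∈ Icc 0 T),
      HasDerivWithinAt x (A ⟨t, ht⟩ (x t) + b ⟨t, ht⟩) (Icc 0 T) t := by
  obtain ⟨R, hR, -⟩ := isUnit_iff_exists.1 (isUnit_one_sub_volterra hT A)
  set x := R (ContinuousMap.const _ c + primitive hT b) with hx
  have hxe : ∀ t, x t = c + primitive hT (pointwiseApply A x + b) t := by
    intro t
    have h := congrArg (fun S : C(Icc 0 T, E) →L[ℝ] C(Icc 0 T, E) =>
      S (ContinuousMap.const _ c + primitive hT b) t) hR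
    simp only [mul_apply_eq_comp, one_apply_eq_self, _root_.sub_apply, ContinuousMap.sub_apply,
      ContinuousMap.add_apply, ContinuousMap.const_apply] at h
    rw [sub_eq_iff_eq_add] at h
    rw [map_add, ContinuousMap.add_apply, add_comm (primitive hT (pointwiseApply A x) t),
      ← add_assoc]
    exact h
  refine ⟨IccExtend hT x, ?_, fun t ht => ?_⟩
  · rw [IccExtend_of_mem hT x (left_mem_Icc.2 hT), hxe, primitive_zero, add_zero]
  · have := hasDerivWithinAt_of_eq_primitive hT hxe t ht
    rwa [ContinuousMap.add_apply, pointwiseApply_apply, ← IccExtend_of_mem hT x ht] at this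

theorem continuousOn_mulVec {X : ℝ → Matrix ι κ ℝ} {v : ℝ → κ → ℝ} {s : Set ℝ}
    (hX : ContinuousOn X s) (hv : ContinuousOn v s) : ContinuousOn (fun t => X t *ᵥ v t) s :=
  (continuous_fst.matrix_mulVec continuous_snd).comp_continuousOn (hX.prodMk hv)

theorem continuousOn_vecMul {X : ℝ → Matrix ι κ ℝ} {v : ℝ → ι → ℝ} {s : Set ℝ}
    (hv : ContinuousOn v s) (hX : ContinuousOn X s) : ContinuousOn (fun t => v t ᵥ* X t) s :=
  (continuous_fst.matrix_vecMul continuous_snd).comp_continuousOn (hv.prodMk hX)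

theorem continuousOn_dotProduct {v v' : ℝ → ι → ℝ} {s : Set ℝ}
    (hv : ContinuousOn v s) (hv' : ContinuousOn v' s) : ContinuousOn (fun t => v t ⬝ᵥ v' t) s :=
  (continuous_fst.dotProduct continuous_snd).comp_continuousOn (hv.prodMk hv')

theorem exists_matrix_ode (hT : 0 ≤ T) {A : ℝ → Matrix ι ι ℝ} {b : ℝ → ι → ℝ}
    (hA : ContinuousOn A (Icc 0 T)) (hb : ContinuousOn b (Icc 0 T)) (c : ι → ℝ) :
    ∃ x : ℝ → ι → ℝ, x 0 = c ∧ ∀ t ∈ Icc 0 T,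
      HasDerivWithinAt x (A t *ᵥ x t + b t) (Icc 0 T) t :=
  exists_linear_ode_inhomogeneous hT
    ⟨fun t : Icc 0 T => matCLM ι ι (A t), continuous_matCLM.comp hA.domRestrict⟩
    ⟨fun t : Icc 0 T => b t, hb.domRestrict⟩ c

/-- Solutions of the adjoint equation with a given final value. -/
theorem exists_adjoint (hT : 0 ≤ T) {A : ℝ → Matrix ι ι ℝ} (hA : ContinuousOn A (Icc 0 T))
    (p : ι → ℝ) : ∃ z : ℝ → ι → ℝ, z T = p ∧ ∀ t ∈ Icc 0 T,
      HasDerivWithinAt z (-(z t ᵥ* A t)) (Icc 0 T) t := by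
  have hmaps : MapsTo (fun t => T - t) (Icc 0 T) (Icc 0 T) := fun t ht =>
    ⟨by linarith [ht.2], by linarith [ht.1]⟩
  -- The adjoint equation has a final condition; reversing time turns it into an initial value
  -- problem.
  have hA' : ContinuousOn (fun t => (A (T - t))ᵀ) (Icc 0 T) :=
    Continuous.comp_continuousOn (g := Matrix.transpose) (by fun_prop) (hA.comp (by fun_prop) hmaps)
  obtain ⟨y, hy0, hy⟩ := exists_matrix_ode hT hA' (continuousOn_const (c := 0)) p
  refine ⟨fun t => y (T - t), by simp [hy0], fun t ht => ?_⟩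
  have h1 := (hy (T - t) (hmaps ht)).scomp t
    (((hasDerivAt_id t).const_sub T).hasDerivWithinAt (s := Icc 0 T)) hmaps
  refine h1.congr_deriv ?_
  simp [Matrix.mulVec_transpose]

/-- The adjoint equation cancels the term `A * N`. Along an adjoint solution, differentiation thus
replaces a bracket by the next one. -/
theorem hasDerivWithinAt_vecMul {z : ℝ → ι → ℝ} {N : ℝ → Matrix ι κ ℝ} {A : Matrix ι ι ℝ}
    {N' : Matrix ι κ ℝ} {s : Set ℝ} {t : ℝ} (hz : HasDerivWithinAt z (-(z t ᵥ* A)) s t)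
    (hN : ∀ a b, HasDerivWithinAt (fun t => N t a b) ((N' + A * N t) a b) s t) (b : κ) :
    HasDerivWithinAt (fun t => (z t ᵥ* N t) b) ((z t ᵥ* N') b) s t := by
  have h : HasDerivWithinAt (fun t => ∑ a, z t a * N t a b)
      (∑ a, ((-(z t ᵥ* A)) a * N t a b + z t a * (N' + A * N t) a b)) s t :=
    HasDerivWithinAt.fun_sum fun a _ => (hasDerivWithinAt_pi.1 hz a).mul (hN a b)
  refine h.congr_deriv ?_
  rw [Finset.sum_add_distrib]
  change (-(z t ᵥ* A) ᵥ* N t) b + (z t ᵥ* (N' + A * N t)) b = _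
  rw [Matrix.vecMul_add, ← Matrix.vecMul_vecMul, Matrix.neg_vecMul]
  simp

theorem hasDerivWithinAt_dotProduct {x y : ℝ → ι → ℝ} {x' y' : ι → ℝ} {s : Set ℝ} {t : ℝ}
    (hx : HasDerivWithinAt x x' s t) (hy : HasDerivWithinAt y y' s t) :
    HasDerivWithinAt (fun t => x t ⬝ᵥ y t) (x' ⬝ᵥ y t + x t ⬝ᵥ y') s t := by
  simp only [dotProduct, ← Finset.sum_add_distrib]
  exact HasDerivWithinAt.fun_sum fun a _ =>
    (hasDerivWithinAt_pi.1 hx a).mul (hasDerivWithinAt_pi.1 hy a)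

/-- The control `f` steers the linear system from `0` to `e`. -/
def LinearSteers (T : ℝ) (A : ℝ → Matrix ι ι ℝ) (B : ℝ → Matrix ι κ ℝ) (R : Matrix ι κ ℝ)
    (f : ℝ → κ → ℝ) (e : ι → ℝ) : Prop :=
  ContDiff ℝ ∞ f ∧ f 0 = 0 ∧ ∃ x : ℝ → ι → ℝ, x 0 = 0 ∧ x T = e ∧ ∀ t ∈ Icc 0 T,
    HasDerivWithinAt x (A t *ᵥ x t + B t *ᵥ f t + R *ᵥ deriv f t) (Icc 0 T) t

variable {A : ℝ → Matrix ι ι ℝ} {B : ℝ → Matrix ι κ ℝ} {R : Matrix ι κ ℝ}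

theorem linearSteers_zero : LinearSteers T A B R 0 0 :=
  ⟨contDiff_const, rfl, fun _ => 0, rfl, rfl, fun t _ =>
    (hasDerivWithinAt_const t (Icc 0 T) (0 : ι → ℝ)).congr_deriv (by simp)⟩

theorem LinearSteers.add {f f' : ℝ → κ → ℝ} {e e' : ι → ℝ} (h : LinearSteers T A B R f e)
    (h' : LinearSteers T A B R f' e') : LinearSteers T A B R (f + f') (e + e') := by
  obtain ⟨hf, hf0, x, hx0, hxT, hx⟩ := h
  obtain ⟨hf', hf0', x', hx0', hxT', hx'⟩ := h'
  refine ⟨hf.add hf', by simp [hf0, hf0'], x + x',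
    by simp [hx0, hx0'], by simp [hxT, hxT'], fun t ht => ?_⟩
  refine ((hx t ht).add (hx' t ht)).congr_deriv ?_
  rw [deriv_add (hf.differentiable (by simp) t) (hf'.differentiable (by simp) t)]
  simp only [Matrix.mulVec_add, Pi.add_apply]
  abel

theorem LinearSteers.smul {f : ℝ → κ → ℝ} {e : ι → ℝ} (c : ℝ) (h : LinearSteers T A B R f e) :
    LinearSteers T A B R (c • f) (c • e) := by
  obtain ⟨hf, hf0, x, hx0, hxT, hx⟩ := h
  refine ⟨hf.const_smul c, by simp [hf0], c • x, by simp [hx0], by simp [hxT], fun t ht => ?_⟩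
  refine ((hx t ht).const_smul c).congr_deriv ?_
  rw [deriv_const_smul c (hf.differentiable (by simp) t)]
  simp only [Matrix.mulVec_smul, smul_add, Pi.smul_apply]

theorem LinearSteers.sum {τ : Type*} (s : Finset τ) {f : τ → ℝ → κ → ℝ} {e : τ → ι → ℝ} (c : τ → ℝ)
    (h : ∀ k, LinearSteers T A B R (f k) (e k)) :
    LinearSteers T A B R (∑ k ∈ s, c k • f k) (∑ k ∈ s, c k • e k) := by
  classical
  induction s using Finset.induction_on with
  | empty => simpa using linearSteers_zero
  | insert k s hk ih =>
    rw [Finset.sum_insert hk, Finset.sum_insert hk]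
    exact ((h k).smul (c k)).add ih

variable (T A B R) in
/-- The reachable space of a linear system. -/
def reachable : Submodule ℝ (ι → ℝ) where
  carrier := {e | ∃ f, LinearSteers T A B R f e}
  zero_mem' := ⟨0, linearSteers_zero⟩
  add_mem' := by
    rintro e e' ⟨f, hf⟩ ⟨f', hf'⟩
    exact ⟨f + f', hf.add hf'⟩
  smul_mem' := by
    rintro c e ⟨f, hf⟩
    exact ⟨c • f, hf.smul c⟩

theorem exists_linearSteers (hT : 0 ≤ T) {A : ℝ → Matrix ι ι ℝ} {B : ℝ → Matrix ι κ ℝ}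
    (R : Matrix ι κ ℝ) (hA : ContinuousOn A (Icc 0 T)) (hB : ContinuousOn B (Icc 0 T))
    {f : ℝ → κ → ℝ} (hf : ContDiff ℝ ∞ f) (hf0 : f 0 = 0) : ∃ e, LinearSteers T A B R f e := by
  have hf' : Continuous (deriv f) := (hf.of_le (m := 1) (by norm_cast)).continuous_deriv le_rfl
  have hb : ContinuousOn (fun t => B t *ᵥ f t + R *ᵥ deriv f t) (Icc 0 T) :=
    (continuousOn_mulVec hB hf.continuous.continuousOn).add
      (continuousOn_mulVec continuousOn_const hf'.continuousOn)
  obtain ⟨x, hx0, hx⟩ := exists_matrix_ode hT hA hb 0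
  exact ⟨x T, hf, hf0, x, hx0, rfl, fun t ht => by simpa only [add_assoc] using hx t ht⟩

/-- Subtracting `R *ᵥ f` from the state removes the derivative of the control from the equation, at
the price of replacing `B` by `B + A * R`. The pairing with the adjoint solution then has derivative
`(z ᵥ* N) ⬝ᵥ f`, which is integrated. -/
theorem integral_adjoint (hT : 0 ≤ T) {A : ℝ → Matrix ι ι ℝ} {B N : ℝ → Matrix ι κ ℝ}
    {R : Matrix ι κ ℝ} (hN : ∀ t ∈ Icc 0 T, N t = B t + A t * R)
    (hNc : ContinuousOn N (Icc 0 T)) {f : ℝ → κ → ℝ}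
    {e : ι → ℝ} (hf : LinearSteers T A B R f e) {z : ℝ → ι → ℝ}
    (hz : ∀ t ∈ Icc 0 T, HasDerivWithinAt z (-(z t ᵥ* A t)) (Icc 0 T) t) :
    ∫ t in (0 : ℝ)..T, (z t ᵥ* N t) ⬝ᵥ f t = z T ⬝ᵥ (e - R *ᵥ f T) := by
  obtain ⟨hfs, hf0, x, hx0, hxT, hx⟩ := hf
  have hzc : ContinuousOn z (Icc 0 T) := fun t ht => (hz t ht).continuousWithinAt
  have hd : ∀ t ∈ Icc 0 T, HasDerivWithinAt (fun t => z t ⬝ᵥ (x t - R *ᵥ f t))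
      ((z t ᵥ* N t) ⬝ᵥ f t) (Icc 0 T) t := by
    intro t ht
    have h1 : HasDerivWithinAt (fun t => R *ᵥ f t) (R *ᵥ deriv f t) (Icc 0 T) t :=
      ((matCLM ι κ R).hasFDerivAt.comp_hasDerivAt t
        (hfs.differentiable (by simp) t).hasDerivAt).hasDerivWithinAt
    refine (hasDerivWithinAt_dotProduct (hz t ht) ((hx t ht).fun_sub h1)).congr_deriv ?_
    rw [hN t ht, neg_dotProduct, ← Matrix.dotProduct_mulVec, ← Matrix.dotProduct_mulVec,
      ← dotProduct_neg, ← dotProduct_add]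
    congr 1
    rw [Matrix.add_mulVec, Matrix.mulVec_sub, ← Matrix.mulVec_mulVec]
    abel
  have h := intervalIntegral.integral_eq_sub_of_hasDerivAt_of_le hT
    (fun t ht => (hd t ht).continuousWithinAt)
    (fun t ht => (hd t (Ioo_subset_Icc_self ht)).hasDerivAt (Icc_mem_nhds ht.1 ht.2))
    (ContinuousOn.intervalIntegrable (by
      rw [uIcc_of_le hT]
      exact continuousOn_dotProduct (continuousOn_vecMul hzc hNc) hfs.continuous.continuousOn))
  rw [h, hx0, hf0, hxT]
  simp

/-- Controllability of `x' = A x + B f + R f'` from the brackets of order at most two at the final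
time. -/
theorem exists_linearSteers_of_span (hT : 0 < T) {A : ℝ → Matrix ι ι ℝ} {B N₀ N₁ : ℝ → Matrix ι κ ℝ}
    {R N₂ : Matrix ι κ ℝ} (hA : ContinuousOn A (Icc 0 T)) (hB : ContinuousOn B (Icc 0 T))
    (hN₀ : ∀ t ∈ Icc 0 T, N₀ t = B t + A t * R)
    (hN₁ : ∀ t ∈ Icc 0 T, ∀ a b,
      HasDerivWithinAt (fun t => N₀ t a b) ((N₁ t + A t * N₀ t) a b) (Icc 0 T) t)
    (hN₂ : ∀ a b, HasDerivWithinAt (fun t => N₁ t a b) ((N₂ + A T * N₁ T) a b) (Icc 0 T) T)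
    (hspan : ∀ p : ι → ℝ, p ᵥ* R = 0 → p ᵥ* N₀ T = 0 → p ᵥ* N₁ T = 0 → p ᵥ* N₂ = 0 → p = 0)
    (e : ι → ℝ) : ∃ f, LinearSteers T A B R f e := by
  classical
  suffices h : reachable T A B R = ⊤ by
    have : e ∈ reachable T A B R := by rw [h]; trivial
    exact this
  refine Vehicle.eq_top_of_dotProduct fun p hp => ?_
  obtain ⟨z, hzT, hz⟩ := exists_adjoint hT.le hA p
  have hTm : T ∈ Icc 0 T := ⟨hT.le, le_rfl⟩
  have hzc : ContinuousOn z (Icc 0 T) := fun t ht => (hz t ht).continuousWithinAt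
  have hNc : ContinuousOn N₀ (Icc 0 T) := continuousOn_pi.2 fun a => continuousOn_pi.2 fun b =>
    fun t ht => (hN₁ t ht a b).continuousWithinAt
  have hgc : ∀ b, ContinuousOn (fun t => (z t ᵥ* N₀ t) b) (Icc 0 T) := fun b =>
    continuousOn_pi.1 (continuousOn_vecMul hzc hNc) b
  -- A covector `p` orthogonal to the reachable space is propagated backwards by the adjoint
  -- equation, and orthogonality becomes an identity valid for every admissible control.
  have key : ∀ f : ℝ → κ → ℝ, ContDiff ℝ ∞ f → f 0 = 0 →
      ∫ t in (0 : ℝ)..T, (z t ᵥ* N₀ t) ⬝ᵥ f t = -(p ᵥ* R) ⬝ᵥ f T := by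
    intro f hf hf0
    obtain ⟨e, he⟩ := exists_linearSteers hT.le R hA hB hf hf0
    rw [integral_adjoint hT.le hN₀ hNc he hz, hzT, dotProduct_sub, hp e ⟨f, he⟩,
      Matrix.dotProduct_mulVec, zero_sub, neg_dotProduct]
  have hdir : ∀ (θ : ℝ → ℝ) (b : κ), ContDiff ℝ ∞ θ → θ 0 = 0 →
      ∫ t in (0 : ℝ)..T, θ t • (z t ᵥ* N₀ t) b = -((p ᵥ* R) b * θ T) := by
    intro θ b hθ hθ0
    have h := key (fun t => θ t • Pi.single b 1) (hθ.smul contDiff_const) (by simp [hθ0])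
    simpa [mul_comm] using h
  -- Controls supported inside `(0, T)` remove the final term, and the fundamental lemma of the
  -- calculus of variations applies; continuity covers the whole closed interval.
  have hzero : ∀ t ∈ Icc 0 T, z t ᵥ* N₀ t = 0 := by
    intro t ht
    ext b
    have hae : ∀ᵐ t ∂(volume : Measure ℝ), t ∈ Ioo 0 T → (z t ᵥ* N₀ t) b = 0 := by
      refine isOpen_Ioo.ae_eq_zero_of_integral_contDiff_smul_eq_zero
        (((hgc b).mono Ioo_subset_Icc_self).locallyIntegrableOn measurableSet_Ioo) ?_
      intro θ hθ _ hsupp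
      have h0 : ∀ t, t ∉ Ioo 0 T → θ t = 0 := fun t ht =>
        image_eq_zero_of_notMem_tsupport fun h => ht (hsupp h)
      have h1 := hdir θ b hθ (h0 0 (by simp))
      rw [h0 T (by simp), mul_zero, neg_zero, intervalIntegral.integral_of_le hT.le,
        setIntegral_eq_integral_of_forall_compl_eq_zero] at h1
      · exact h1
      · intro t ht
        rw [h0 t (fun h => ht (Ioo_subset_Ioc_self h)), zero_smul]
    have hres : (fun t => (z t ᵥ* N₀ t) b) =ᵐ[volume.restrict (Icc 0 T)] fun _ => 0 := by
      rw [← restrict_Ioo_eq_restrict_Icc]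
      exact (ae_restrict_iff' measurableSet_Ioo).2 hae
    exact Measure.eqOn_Icc_of_ae_eq _ hT.ne hres (hgc b) continuousOn_const ht
  -- Differentiating the identity `z ᵥ* N = 0` yields the same identity for the next bracket.
  -- Derivatives within `[0, T]` are unique at the end points too.
  have hderiv : ∀ {N N' : ℝ → Matrix ι κ ℝ} {M' : Matrix ι κ ℝ} {t : ℝ}, t ∈ Icc 0 T →
      (∀ s ∈ Icc 0 T, z s ᵥ* N s = 0) →
      (∀ a b, HasDerivWithinAt (fun t => N t a b) ((M' + A t * N t) a b) (Icc 0 T) t) →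
      z t ᵥ* M' = 0 := by
    intro N N' M' t ht h0 hd
    ext b
    have h1 := hasDerivWithinAt_vecMul (hz t ht) hd b
    have h2 : HasDerivWithinAt (fun t => (z t ᵥ* N t) b) 0 (Icc 0 T) t :=
      (hasDerivWithinAt_const t (Icc 0 T) (0 : ℝ)).congr_of_mem
        (fun s hs => by rw [h0 s hs]; rfl) ht
    exact (uniqueDiffOn_Icc hT t ht).eq_deriv _ h1 h2
  have hzero₁ : ∀ t ∈ Icc 0 T, z t ᵥ* N₁ t = 0 := fun t ht =>
    hderiv (N' := N₁) ht hzero (hN₁ t ht)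
  refine hspan p ?_ ?_ ?_ ?_
  · ext b
    -- A control that does not vanish at the final time isolates the term with `R`, since the
    -- integral is already known to be `0`.
    have h := hdir (fun t => t) b contDiff_id rfl
    rw [intervalIntegral.integral_congr (g := fun _ => (0 : ℝ)), intervalIntegral.integral_zero] at h
    · have h' : (p ᵥ* R) b * T = 0 := by linarith
      exact (mul_eq_zero.1 h').resolve_right hT.ne'
    · intro t ht
      rw [uIcc_of_le hT.le] at ht
      simp [hzero t ht]
  · rw [← hzT]; exact hzero T hTm
  · rw [← hzT]; exact hzero₁ T hTm
  · rw [← hzT]; exact hderiv (N' := N₁) hTm hzero₁ hN₂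

end linear

/-! ### The control system in linear coordinates -/

/-- The coordinates `(h, 2 q, l, r)` on the state space. -/
def ofState : State →ₗ[ℝ] I6 ⊕ I6 → ℝ where
  toFun x := Sum.elim (Sum.elim x.1 ((2 : ℝ) • x.2.1)) (Sum.elim x.2.2.1 x.2.2.2)
  map_add' x y := by ext ((a | a) | (a | a)) <;> simp
  map_smul' c x := by
    ext ((a | a) | (a | a)) <;> simp
    ring

/-- The state with given coordinates `(h, 2 q, l, r)`. -/
def toState : (I6 ⊕ I6 → ℝ) →ₗ[ℝ] State where
  toFun y := (fun i => y (Sum.inl (Sum.inl i)), fun i => 1 / 2 * y (Sum.inl (Sum.inr i)),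
    fun i => y (Sum.inr (Sum.inl i)), fun i => y (Sum.inr (Sum.inr i)))
  map_add' x y := by
    refine Prod.ext rfl (Prod.ext (funext fun i => ?_) rfl)
    simp [mul_add]
  map_smul' c x := by
    refine Prod.ext rfl (Prod.ext (funext fun i => ?_) rfl)
    simp
    ring

theorem toState_ofState (x : State) : toState (ofState x) = x := by
  refine Prod.ext rfl (Prod.ext (funext fun i => ?_) rfl)
  simp [toState, ofState]

theorem contDiff_ofState {n : ℕ∞ω} : ContDiff ℝ n ofState :=
  (LinearMap.toContinuousLinearMap ofState).contDiff

theorem contDiff_toState {n : ℕ∞ω} : ContDiff ℝ n toState :=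
  (LinearMap.toContinuousLinearMap toState).contDiff

/-- A smooth function on the line that is equal to `√(1 - s)` for `s ≤ 1 / 2`. -/
def cutSqrt (s : ℝ) : ℝ := Real.sqrt (1 - s * Real.smoothTransition (3 - 4 * s))

theorem cutSqrt_of_le {s : ℝ} (hs : s ≤ 1 / 2) : cutSqrt s = Real.sqrt (1 - s) := by
  rw [cutSqrt, Real.smoothTransition.one_of_one_le (by linarith), mul_one]

theorem contDiff_cutSqrt {n : ℕ∞} : ContDiff ℝ n cutSqrt := by
  have h : ContDiff ℝ n fun s : ℝ => Real.smoothTransition (3 - 4 * s) :=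
    Real.smoothTransition.contDiff.comp (by fun_prop)
  refine ContDiff.sqrt (by fun_prop) fun s => ne_of_gt ?_
  have h0 := Real.smoothTransition.nonneg (3 - 4 * s)
  have h1 := Real.smoothTransition.le_one (3 - 4 * s)
  -- The radicand stays positive: for `s ≤ 3 / 4` it is at least `1 / 4`, and beyond that the
  -- transition function vanishes and the radicand is `1`.
  rcases le_total s (3 / 4) with hs | hs
  · rcases le_total 0 s with hs0 | hs0 <;> nlinarith
  · rw [Real.smoothTransition.zero_of_nonpos (by linarith)]
    norm_num

theorem contDiff_crossProduct {X : Type*} [NormedAddCommGroup X] [NormedSpace ℝ X] {n : ℕ∞ω}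
    {a b : X → Fin 3 → ℝ} (ha : ContDiff ℝ n a) (hb : ContDiff ℝ n b) :
    ContDiff ℝ n fun x => crossProduct (a x) (b x) := by
  have ha' := contDiff_pi.1 ha
  have hb' := contDiff_pi.1 hb
  refine contDiff_pi.2 fun i => ?_
  have := ha' 0; have := ha' 1; have := ha' 2
  have := hb' 0; have := hb' 1; have := hb' 2
  fin_cases i <;> simp [cross_apply] <;> fun_prop

theorem contDiff_dotProduct {X : Type*} [NormedAddCommGroup X] [NormedSpace ℝ X] {n : ℕ∞ω}
    {a b : X → Fin 3 → ℝ} (ha : ContDiff ℝ n a) (hb : ContDiff ℝ n b) :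
    ContDiff ℝ n fun x => a x ⬝ᵥ b x := by
  have ha' := contDiff_pi.1 ha
  have hb' := contDiff_pi.1 hb
  exact ContDiff.sum fun i _ => (ha' i).mul (hb' i)

/-- The kinematic part of the vector field, for an arbitrary real part `σ` of the quaternion. -/
def kinematics (σ : ℝ) (q l r : Fin 3 → ℝ) : I6 → ℝ :=
  Sum.elim ((1 - q ⬝ᵥ q) • l + (2 * σ) • crossProduct q l + (l ⬝ᵥ q) • q
      - crossProduct (crossProduct q l) q) (σ • r + crossProduct q r)

namespace Vehicle

variable {m : ℕ} (V : Vehicle m)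

/-- The dynamical part of the vector field. -/
def dynamics (v : I6 → ℝ) (w w' : Fin m → ℝ) : I6 → ℝ := V.JJ⁻¹ *ᵥ (V.C *ᵥ w' + V.F v w)

/-- The vector field in coordinates, made smooth by a cut-off of the square root. -/
def coordField (y : (I6 ⊕ I6 → ℝ) × (Fin m → ℝ) × (Fin m → ℝ)) : I6 ⊕ I6 → ℝ :=
  let x := toState y.1
  Sum.elim (kinematics (cutSqrt (x.2.1 ⬝ᵥ x.2.1)) x.2.1 x.2.2.1 x.2.2.2)
    (V.dynamics (fun a => y.1 (Sum.inr a)) y.2.1 y.2.2)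

theorem toState_coordField {y : I6 ⊕ I6 → ℝ} (hy : (toState y).2.1 ⬝ᵥ (toState y).2.1 ≤ 1 / 2)
    (w w' : Fin m → ℝ) : toState (V.coordField (y, w, w')) = V.field (toState y) w w' := by
  have hv : (fun a => y (Sum.inr a)) = Sum.elim (toState y).2.2.1 (toState y).2.2.2 := by
    ext (a | a) <;> rfl
  rw [coordField, cutSqrt_of_le hy, hv]
  rfl

theorem contDiff_sumElim {X α β : Type*} [Fintype α] [Fintype β] [NormedAddCommGroup X]
    [NormedSpace ℝ X] {n : ℕ∞ω} {a : X → α → ℝ} {b : X → β → ℝ} (ha : ContDiff ℝ n a)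
    (hb : ContDiff ℝ n b) : ContDiff ℝ n fun x => (Sum.elim (a x) (b x) : α ⊕ β → ℝ) :=
  contDiff_pi.2 fun i => Sum.rec (fun i => contDiff_pi.1 ha i) (fun i => contDiff_pi.1 hb i) i

theorem contDiff_mulVec {X ι κ : Type*} [Fintype ι] [Fintype κ] [NormedAddCommGroup X]
    [NormedSpace ℝ X] {n : ℕ∞ω} (K : Matrix ι κ ℝ) {a : X → κ → ℝ} (ha : ContDiff ℝ n a) :
    ContDiff ℝ n fun x => K *ᵥ a x :=
  (matCLM ι κ K).contDiff.comp ha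

theorem contDiff_kinematics {X : Type*} [NormedAddCommGroup X] [NormedSpace ℝ X] {n : ℕ∞ω}
    {σ : X → ℝ} {q l r : X → Fin 3 → ℝ} (hσ : ContDiff ℝ n σ) (hq : ContDiff ℝ n q)
    (hl : ContDiff ℝ n l) (hr : ContDiff ℝ n r) :
    ContDiff ℝ n fun x => kinematics (σ x) (q x) (l x) (r x) := by
  have h1 := (contDiff_const (c := (1 : ℝ)).sub (contDiff_dotProduct hq hq)).smul hl
  have h2 := (contDiff_const (c := (2 : ℝ)).mul hσ).smul (contDiff_crossProduct hq hl)
  have h3 := (contDiff_dotProduct hl hq).smul hq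
  have h4 := contDiff_crossProduct (contDiff_crossProduct hq hl) hq
  exact contDiff_sumElim (((h1.add h2).add h3).sub h4)
    ((hσ.smul hr).add (contDiff_crossProduct hq hr))

theorem contDiff_dynamics {X : Type*} [NormedAddCommGroup X] [NormedSpace ℝ X] {n : ℕ∞ω}
    {v : X → I6 → ℝ} {w w' : X → Fin m → ℝ} (hv : ContDiff ℝ n v) (hw : ContDiff ℝ n w)
    (hw' : ContDiff ℝ n w') : ContDiff ℝ n fun x => V.dynamics (v x) (w x) (w' x) := by
  have h1 : ContDiff ℝ n fun x => V.F (v x) (w x) :=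
    ContDiff.comp (g := fun x : (I6 → ℝ) × (Fin m → ℝ) => V.F x.1 x.2) (f := fun x => (v x, w x))
      V.contDiff_F (hv.prodMk hw)
  have h2 : ContDiff ℝ n fun x => V.C *ᵥ w' x := contDiff_mulVec V.C hw'
  have h3 : ContDiff ℝ n fun x => V.C *ᵥ w' x + V.F (v x) (w x) := h2.add h1
  simp only [dynamics]
  exact contDiff_mulVec V.JJ⁻¹ h3

theorem contDiff_coordField : ContDiff ℝ 1 V.coordField := by
  have hx : ContDiff ℝ 1 fun y : (I6 ⊕ I6 → ℝ) × (Fin m → ℝ) × (Fin m → ℝ) => toState y.1 :=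
    contDiff_toState.comp contDiff_fst
  have hv : ContDiff ℝ 1 fun y : (I6 ⊕ I6 → ℝ) × (Fin m → ℝ) × (Fin m → ℝ) =>
      (fun a => y.1 (Sum.inr a) : I6 → ℝ) := by fun_prop
  have hσ := (contDiff_cutSqrt (n := 1)).comp (contDiff_dotProduct hx.snd.fst hx.snd.fst)
  exact contDiff_sumElim
    (contDiff_kinematics hσ hx.snd.fst hx.snd.snd.fst hx.snd.snd.snd)
    (V.contDiff_dynamics hv contDiff_snd.fst contDiff_snd.snd)

end Vehicle

/-! ### Linearization of the control system along the reference trajectory -/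

/-- Continuity of `g` is enough for this derivative at `0`, so the square root of the kinematics
need not be differentiated. -/
theorem hasDerivAt_add_smul {E : Type*} [NormedAddCommGroup E] [NormedSpace ℝ E] {g : ℝ → E}
    (hg : ContinuousAt g 0) (c : E) : HasDerivAt (fun s : ℝ => c + s • g s) (g 0) 0 := by
  rw [hasDerivAt_iff_tendsto_slope_zero]
  refine (hg.tendsto.mono_left nhdsWithin_le_nhds).congr' ?_
  filter_upwards [self_mem_nhdsWithin] with s hs
  have hs : s ≠ 0 := hs
  simp [smul_smul, hs]

theorem hasDerivAt_sumElim {α β : Type*} [Fintype α] [Fintype β] {a : ℝ → α → ℝ} {b : ℝ → β → ℝ}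
    {a' : α → ℝ} {b' : β → ℝ} {t : ℝ} (ha : HasDerivAt a a' t) (hb : HasDerivAt b b' t) :
    HasDerivAt (fun t => (Sum.elim (a t) (b t) : α ⊕ β → ℝ)) (Sum.elim a' b') t :=
  hasDerivAt_pi.2 fun i => Sum.rec (fun i => hasDerivAt_pi.1 ha i) (fun i => hasDerivAt_pi.1 hb i) i

theorem cutSqrt_zero : cutSqrt 0 = 1 := by simp [cutSqrt]

theorem skew_mulVec (a b : Fin 3 → ℝ) : skew a *ᵥ b = crossProduct a b := by
  ext i
  fin_cases i <;> simp [skew, cross_apply, Matrix.mulVec, dotProduct, Fin.sum_univ_three] <;> ring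

/-- Only the terms of first order in `s` survive: the square root is replaced by `1`, and quadratic
terms in the attitude disappear. The coordinate `2 • q` absorbs the factor `2` of the cross product
and the factor `1 / 2` of the quaternion equation. -/
theorem hasDerivAt_kinematics (l₀ q l r : Fin 3 → ℝ) :
    HasDerivAt (fun s : ℝ => kinematics (cutSqrt ((s • q) ⬝ᵥ (s • q))) (s • q) (l₀ + s • l) (s • r))
      (Sum.elim (l - skew l₀ *ᵥ ((2 : ℝ) • q)) r) 0 := by
  have hσ : Continuous cutSqrt := (contDiff_cutSqrt (n := 1)).continuous
  refine hasDerivAt_sumElim ?_ ?_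
  · set g : ℝ → Fin 3 → ℝ := fun s => l - (s * (q ⬝ᵥ q)) • (l₀ + s • l) +
      (2 * cutSqrt ((s • q) ⬝ᵥ (s • q))) • (crossProduct q l₀ + s • crossProduct q l) +
      (s * ((l₀ + s • l) ⬝ᵥ q)) • q -
      s • crossProduct (crossProduct q l₀ + s • crossProduct q l) q with hg
    have hgc : Continuous g := by
      have h1 : Continuous fun s : ℝ => (s • q) ⬝ᵥ (s • q) := by
        simp only [smul_dotProduct, dotProduct_smul]; fun_prop
      have h2 : Continuous fun s : ℝ => (l₀ + s • l) ⬝ᵥ q := by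
        simp only [add_dotProduct, smul_dotProduct]; fun_prop
      have h3 : Continuous fun s : ℝ =>
          crossProduct (crossProduct q l₀ + s • crossProduct q l) q := by
        simp only [map_add, map_smul, LinearMap.add_apply, LinearMap.smul_apply]; fun_prop
      have h4 := hσ.comp h1
      simp only [Function.comp_def] at h4
      simp only [hg]
      fun_prop
    have h := hasDerivAt_add_smul hgc.continuousAt l₀
    have hg0 : g 0 = l - skew l₀ *ᵥ ((2 : ℝ) • q) := by
      simp only [hg, zero_mul, zero_smul, sub_zero, add_zero, dotProduct_zero, cutSqrt_zero,
        skew_mulVec, map_smul, mul_one]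
      rw [← neg_cross q l₀, smul_neg, sub_neg_eq_add]
    rw [hg0] at h
    refine h.congr_of_eventuallyEq (Eventually.of_forall fun s => ?_)
    simp only [hg, map_add, map_smul, LinearMap.add_apply, LinearMap.smul_apply, smul_dotProduct,
      dotProduct_smul, smul_eq_mul, add_dotProduct]
    module
  · set g : ℝ → Fin 3 → ℝ := fun s => cutSqrt ((s • q) ⬝ᵥ (s • q)) • r + s • crossProduct q r with hg
    have hgc : Continuous g := by
      have h1 : Continuous fun s : ℝ => (s • q) ⬝ᵥ (s • q) := by
        simp only [smul_dotProduct, dotProduct_smul]; fun_prop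
      have h4 := hσ.comp h1
      simp only [Function.comp_def] at h4
      simp only [hg]
      fun_prop
    have h := hasDerivAt_add_smul hgc.continuousAt 0
    have hg0 : g 0 = r := by simp [hg, cutSqrt_zero]
    rw [hg0] at h
    refine h.congr_of_eventuallyEq (Eventually.of_forall fun s => ?_)
    simp only [hg, map_smul, LinearMap.smul_apply]
    module

namespace Vehicle

variable {m : ℕ} [NeZero m] (V : Vehicle m)

/-- The reference state in coordinates. -/
def refCoord (h l : ℝ) : I6 ⊕ I6 → ℝ := Sum.elim (refVelocity h) (refVelocity l)

theorem toState_refCoord (h l : ℝ) : toState (refCoord h l) = (h • e1, 0, l • e1, 0) := by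
  refine Prod.ext (funext fun i => ?_) (Prod.ext (funext fun i => ?_)
    (Prod.ext (funext fun i => ?_) (funext fun i => ?_))) <;>
  simp [toState, refCoord, refVelocity]

theorem hasDerivAt_dynamics (l w : ℝ) (w₁ : Fin m → ℝ) (v : I6 → ℝ) (f f' : Fin m → ℝ) :
    HasDerivAt (fun s : ℝ => V.dynamics (refVelocity l + s • v) (refControl w + s • f) (w₁ + s • f'))
      (V.JJ⁻¹ *ᵥ (V.C *ᵥ f' + (V.linA l w *ᵥ v + V.linB l w *ᵥ f))) 0 := by
  have hline : ∀ {E : Type} [NormedAddCommGroup E] [NormedSpace ℝ E] (a b : E),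
      HasDerivAt (fun s : ℝ => a + s • b) b 0 := fun a b => by
    simpa using ((hasDerivAt_id (0 : ℝ)).smul_const b).const_add a
  have hF : HasDerivAt (fun s : ℝ => V.F (refVelocity l + s • v) (refControl w + s • f))
      (V.linA l w *ᵥ v + V.linB l w *ᵥ f) 0 := by
    rw [← V.fderiv_F_refPoint l w (v, f)]
    have h1 := (V.contDiff_F (n := 1)).differentiable one_ne_zero (refPoint l w)
    have h2 := hline (refPoint l w) (v, f)
    have h3 : refPoint l w = refPoint l w + (0 : ℝ) • (v, f) := by simp
    rw [h3] at h1
    have h4 := h1.hasFDerivAt.comp_hasDerivAt (0 : ℝ) h2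
    rw [← h3] at h4
    exact h4
  exact (matCLM _ _ V.JJ⁻¹).hasFDerivAt.comp_hasDerivAt (0 : ℝ)
    (((matCLM _ _ V.C).hasFDerivAt.comp_hasDerivAt (0 : ℝ) (hline w₁ f')).add hF)

/-- The linearization of the control system. -/
theorem fderiv_coordField (h l w : ℝ) (w₁ : Fin m → ℝ) (y : I6 ⊕ I6 → ℝ) (f f' : Fin m → ℝ) :
    fderiv ℝ V.coordField (refCoord h l, refControl w, w₁) (y, f, f') =
      V.calA l w *ᵥ y + V.calB l w *ᵥ f + V.calC *ᵥ f' := by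
  set P : (I6 ⊕ I6 → ℝ) × (Fin m → ℝ) × (Fin m → ℝ) := (refCoord h l, refControl w, w₁) with hP
  set d : (I6 ⊕ I6 → ℝ) × (Fin m → ℝ) × (Fin m → ℝ) := (y, f, f') with hd
  have h1 := V.contDiff_coordField.differentiable one_ne_zero P
  have hline : HasDerivAt (fun s : ℝ => P + s • d) d 0 := by
    simpa using ((hasDerivAt_id (0 : ℝ)).smul_const d).const_add P
  have h3 : P = P + (0 : ℝ) • d := by simp
  rw [h3] at h1
  have h4 := h1.hasFDerivAt.comp_hasDerivAt (0 : ℝ) hline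
  rw [← h3] at h4
  obtain ⟨v, hv⟩ : ∃ v : I6 → ℝ, v = fun a => y (Sum.inr a) := ⟨_, rfl⟩
  have h5 := hasDerivAt_sumElim (hasDerivAt_kinematics (l • e1) (toState y).2.1 (toState y).2.2.1
    (toState y).2.2.2) (V.hasDerivAt_dynamics l w w₁ v f f')
  have heq : (V.coordField ∘ fun s : ℝ => P + s • d) = fun s : ℝ =>
      Sum.elim (kinematics (cutSqrt ((s • (toState y).2.1) ⬝ᵥ (s • (toState y).2.1)))
        (s • (toState y).2.1) (l • e1 + s • (toState y).2.2.1) (s • (toState y).2.2.2))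
        (V.dynamics (refVelocity l + s • v) (refControl w + s • f) (w₁ + s • f')) := by
    funext s
    have hs : toState (refCoord h l + s • y) =
        (h • e1 + s • (toState y).1, s • (toState y).2.1, l • e1 + s • (toState y).2.2.1,
          s • (toState y).2.2.2) := by
      rw [map_add, map_smul, toState_refCoord]
      simp [Prod.ext_iff]
    change V.coordField (refCoord h l + s • y, refControl w + s • f, w₁ + s • f') = _
    rw [coordField]
    simp only [hs]
    congr 2
    rw [hv]
    rfl
  rw [heq] at h4
  have hA : V.calA l w *ᵥ y = Sum.elim (linD l *ᵥ (y ∘ Sum.inl) + v) ((V.JJ⁻¹ * V.linA l w) *ᵥ v) := by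
    rw [calA, Matrix.fromBlocks_mulVec, hv]
    simp [Function.comp_def]
  have hD : linD l *ᵥ (y ∘ Sum.inl) =
      Sum.elim (-(skew (l • e1) *ᵥ ((2 : ℝ) • (toState y).2.1))) 0 := by
    have h2q : (2 : ℝ) • (toState y).2.1 = (y ∘ Sum.inl) ∘ Sum.inr := by
      ext i
      simp [toState]
    rw [linD, Matrix.fromBlocks_mulVec, h2q, Matrix.neg_mulVec]
    simp
  have hB : V.calB l w *ᵥ f = Sum.elim (0 : I6 → ℝ) ((V.JJ⁻¹ * V.linB l w) *ᵥ f) := by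
    rw [calB, Matrix.fromRows_mulVec, Matrix.zero_mulVec]
  have hC : V.calC *ᵥ f' = Sum.elim (0 : I6 → ℝ) ((V.JJ⁻¹ * V.C) *ᵥ f') := by
    rw [calC, Matrix.fromRows_mulVec, Matrix.zero_mulVec]
  rw [h4.unique h5, hA, hD, hB, hC, Matrix.mulVec_add, Matrix.mulVec_add, Matrix.mulVec_mulVec,
    Matrix.mulVec_mulVec, Matrix.mulVec_mulVec, hv]
  ext ((a | a) | a)
  · simp only [Sum.elim_inl, Pi.add_apply, Pi.sub_apply, Pi.neg_apply, Pi.zero_apply, toState,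
      LinearMap.coe_mk, AddHom.coe_mk]
    ring
  · simp [toState]
  · simp only [Sum.elim_inr, Pi.add_apply]
    ring

/-- The reference trajectory solves the control system. -/
theorem SymmetricEntries.coordField_ref {V : Vehicle m} (hV : V.SymmetricEntries) (hα : V.α ≠ 0)
    (h l l' w : ℝ) :
    V.coordField (refCoord h l, refControl w,
      refControl (V.α⁻¹ * (l' - V.β * l * w - V.γ * w ^ 2))) = refCoord l l' := by
  have hd : V.dynamics (refVelocity l) (refControl w)
      (refControl (V.α⁻¹ * (l' - V.β * l * w - V.γ * w ^ 2))) = refVelocity l' := by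
    have h1 := hV.momentum l' (V.α⁻¹ * (l' - V.β * l * w - V.γ * w ^ 2))
    -- The scalar equation of the reference control is the first component of the momentum balance
    -- divided by `V.m0 + V.M 0 0`; all other components vanish by symmetry.
    have h2 : l' * (V.m0 + V.M 0 0) + V.α⁻¹ * (l' - V.β * l * w - V.γ * w ^ 2) * V.CM 0 0 =
        -(w * (l * V.LM 0 0 0 + w * V.WM 0 0 0)) := by
      have hm := add_mass_ne_zero hα
      have hC : V.CM 0 0 = -(V.α * (V.m0 + V.M 0 0)) := by rw [α_mul_mass hα, neg_neg]
      have hL : V.β * (V.m0 + V.M 0 0) = -V.LM 0 0 0 := by rw [β, div_mul_cancel₀ _ hm]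
      have hW : V.γ * (V.m0 + V.M 0 0) = -V.WM 0 0 0 := by rw [γ, div_mul_cancel₀ _ hm]
      have hinv := inv_mul_cancel₀ hα
      rw [hC]
      linear_combination l * w * hL + w ^ 2 * hW -
        (l' - V.β * l * w - V.γ * w ^ 2) * (V.m0 + V.M 0 0) * hinv
    rw [h2, ← hV.F_refPoint, sub_eq_iff_eq_add'] at h1
    rw [dynamics, ← h1, Matrix.mulVec_mulVec, Matrix.nonsing_inv_mul _ V.isUnit_det_JJ,
      Matrix.one_mulVec]
  rw [coordField]
  simp only [toState_refCoord]
  have hv : (fun a => refCoord h l (Sum.inr a)) = refVelocity l := rfl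
  rw [hv, hd, refCoord]
  congr 1
  ext (a | a) <;> simp [kinematics, refVelocity]

end Vehicle

/-! ### Elements of the Sobolev space -/

section sobolev

variable {m : ℕ} {T : ℝ}

theorem isWeakDeriv_of_hasDerivWithinAt (hT : 0 ≤ T) {f g : ℝ → EuclideanSpace ℝ (Fin m)}
    (hf : ∀ t ∈ Icc 0 T, HasDerivWithinAt f (g t) (Icc 0 T) t) (hg : ContinuousOn g (Icc 0 T)) :
    IsWeakDeriv T f g := by
  intro θ hθ _ hsupp
  have hfc : ContinuousOn f (Icc 0 T) := fun t ht => (hf t ht).continuousWithinAt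
  have hθ' : Continuous (deriv θ) := (hθ.of_le (m := 1) (by norm_cast)).continuous_deriv le_rfl
  have h0 : ∀ t, t ∉ Ioo 0 T → θ t = 0 := fun t ht =>
    image_eq_zero_of_notMem_tsupport fun h => ht (hsupp h)
  have hi1 : IntervalIntegrable (fun t => deriv θ t • f t) volume 0 T :=
    ContinuousOn.intervalIntegrable (by rw [uIcc_of_le hT]; exact hθ'.continuousOn.smul hfc)
  have hi2 : IntervalIntegrable (fun t => θ t • g t) volume 0 T :=
    ContinuousOn.intervalIntegrable (by
      rw [uIcc_of_le hT]; exact hθ.continuous.continuousOn.smul hg)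
  have h := intervalIntegral.integral_eq_sub_of_hasDerivAt_of_le hT
    (f := fun t => θ t • f t) (f' := fun t => deriv θ t • f t + θ t • g t)
    (hθ.continuous.continuousOn.smul hfc) (fun t ht => ?_) (hi1.add hi2)
  · rw [intervalIntegral.integral_add hi1 hi2, h0 0 (by simp), h0 T (by simp), zero_smul, zero_smul,
      sub_zero, intervalIntegral.integral_of_le hT, intervalIntegral.integral_of_le hT,
      integral_Ioc_eq_integral_Ioo, integral_Ioc_eq_integral_Ioo] at h
    exact eq_neg_of_add_eq_zero_left h
  · rw [add_comm]
    exact ((hθ.differentiable (by simp) t).hasDerivAt).smul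
      ((hf t (Ioo_subset_Icc_self ht)).hasDerivAt (Icc_mem_nhds ht.1 ht.2))

theorem IsWeakDeriv.congr_ae {f f' g g' : ℝ → EuclideanSpace ℝ (Fin m)} (h : IsWeakDeriv T f g)
    (hf : f' =ᵐ[volume.restrict (Ioo 0 T)] f) (hg : g' =ᵐ[volume.restrict (Ioo 0 T)] g) :
    IsWeakDeriv T f' g' := by
  intro θ hθ hc hs
  rw [integral_congr_ae (g := fun t => deriv θ t • f t),
    integral_congr_ae (f := fun t => θ t • g' t) (g := fun t => θ t • g t), h θ hθ hc hs]
  · filter_upwards [hg] with t ht; rw [ht]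
  · filter_upwards [hf] with t ht; rw [ht]

theorem memLp_of_continuousOn {f : ℝ → EuclideanSpace ℝ (Fin m)} (hf : ContinuousOn f (Icc 0 T)) :
    MemLp f 2 (volume.restrict (Ioo 0 T)) := by
  obtain ⟨K, hK⟩ := isCompact_Icc.exists_bound_of_continuousOn hf
  refine MemLp.of_bound ((hf.mono Ioo_subset_Icc_self).aestronglyMeasurable measurableSet_Ioo) K ?_
  exact (ae_restrict_iff' measurableSet_Ioo).2 (ae_of_all _ fun t ht => hK t (Ioo_subset_Icc_self ht))

/-- A `C²` function on `[0, T]` defines an element of `H²`. -/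
theorem exists_H2 (hT : 0 ≤ T) {w w₁ w₂ : ℝ → Fin m → ℝ}
    (h₁ : ∀ t ∈ Icc 0 T, HasDerivWithinAt w (w₁ t) (Icc 0 T) t)
    (h₂ : ∀ t ∈ Icc 0 T, HasDerivWithinAt w₁ (w₂ t) (Icc 0 T) t) (hc : ContinuousOn w₂ (Icc 0 T)) :
    ∃ u : H2 T m, ∀ᵐ t ∂(volume.restrict (Ioo 0 T)), u.1 0 t = WithLp.toLp 2 (w t) := by
  set e := (EuclideanSpace.equiv (Fin m) ℝ).symm with he
  have hd : ∀ {v v' : ℝ → Fin m → ℝ}, (∀ t ∈ Icc 0 T, HasDerivWithinAt v (v' t) (Icc 0 T) t) →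
      ∀ t ∈ Icc 0 T, HasDerivWithinAt (fun t => e (v t)) (e (v' t)) (Icc 0 T) t :=
    fun h t ht => e.hasFDerivAt.comp_hasDerivWithinAt t (h t ht)
  have hc0 : ContinuousOn (fun t => e (w t)) (Icc 0 T) :=
    fun t ht => (hd h₁ t ht).continuousWithinAt
  have hc1 : ContinuousOn (fun t => e (w₁ t)) (Icc 0 T) :=
    fun t ht => (hd h₂ t ht).continuousWithinAt
  have hc2 : ContinuousOn (fun t => e (w₂ t)) (Icc 0 T) := e.continuous.comp_continuousOn hc
  have m0 := memLp_of_continuousOn hc0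
  have m1 := memLp_of_continuousOn hc1
  have m2 := memLp_of_continuousOn hc2
  refine ⟨⟨WithLp.toLp 2 ![m0.toLp, m1.toLp, m2.toLp], ?_, ?_⟩, m0.coeFn_toLp⟩
  · exact (isWeakDeriv_of_hasDerivWithinAt hT (hd h₁) hc1).congr_ae m0.coeFn_toLp m1.coeFn_toLp
  · exact (isWeakDeriv_of_hasDerivWithinAt hT (hd h₂) hc2).congr_ae m1.coeFn_toLp m2.coeFn_toLp

theorem coeFn_H2_add_sum {τ : Type*} (s : Finset τ) {u₀ : H2 T m} {u : τ → H2 T m}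
    {w : ℝ → Fin m → ℝ} {f : τ → ℝ → Fin m → ℝ} (c : τ → ℝ)
    (h₀ : ∀ᵐ t ∂(volume.restrict (Ioo 0 T)), u₀.1 0 t = WithLp.toLp 2 (w t))
    (h : ∀ k, ∀ᵐ t ∂(volume.restrict (Ioo 0 T)), (u k).1 0 t = WithLp.toLp 2 (f k t)) :
    ∀ᵐ t ∂(volume.restrict (Ioo 0 T)), (u₀ + ∑ k ∈ s, c k • u k : H2 T m).1 0 t =
      WithLp.toLp 2 (w t + ∑ k ∈ s, c k • f k t) := by
  classical
  induction s using Finset.induction_on with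
  | empty => simpa using h₀
  | insert k s hk ih =>
    have e : (u₀ + ∑ k ∈ insert k s, c k • u k : H2 T m).1 0 =
        c k • (u k).1 0 + (u₀ + ∑ k ∈ s, c k • u k : H2 T m).1 0 := by
      rw [Finset.sum_insert hk, add_left_comm]
      rfl
    rw [e]
    filter_upwards [Lp.coeFn_add (c k • (u k).1 0) ((u₀ + ∑ k ∈ s, c k • u k : H2 T m).1 0),
      Lp.coeFn_smul (c k) ((u k).1 0), ih, h k] with t h1 h2 h3 h4
    rw [h1, Pi.add_apply, h2, h3, Pi.smul_apply, h4, Finset.sum_insert hk, add_left_comm (w t)]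
    rfl

end sobolev

theorem contDiffOn_one_of_hasDerivWithinAt {E : Type*} [NormedAddCommGroup E] [NormedSpace ℝ E]
    {T : ℝ} (hT : 0 < T) {f g : ℝ → E} (hf : ∀ t ∈ Icc 0 T, HasDerivWithinAt f (g t) (Icc 0 T) t)
    (hg : ContinuousOn g (Icc 0 T)) : ContDiffOn ℝ 1 f (Icc 0 T) := by
  rw [contDiffOn_one_iff_derivWithin (uniqueDiffOn_Icc hT)]
  refine ⟨fun t ht => (hf t ht).differentiableWithinAt, hg.congr fun t ht => ?_⟩
  exact (hf t ht).derivWithin (uniqueDiffOn_Icc hT t ht)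

theorem eq_primitive_of_hasDerivWithinAt {E : Type*} [NormedAddCommGroup E] [NormedSpace ℝ E]
    [CompleteSpace E] {T : ℝ} (hT : 0 ≤ T) {x : ℝ → E} (z : C(Icc 0 T, E)) (h0 : x 0 = 0)
    (hx : ∀ t (ht : t ∈ Icc 0 T), HasDerivWithinAt x (z ⟨t, ht⟩) (Icc 0 T) t) (t : Icc 0 T) :
    x t = primitive hT z t := by
  have hsub : Icc 0 (t : ℝ) ⊆ Icc 0 T := Icc_subset_Icc_right t.2.2
  have h := intervalIntegral.integral_eq_sub_of_hasDerivAt_of_le t.2.1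
    (f := x) (f' := IccExtend hT z)
    (fun s hs => ((hx s (hsub hs)).continuousWithinAt).mono hsub) (fun s hs => ?_)
    ((continuous_IccExtend_map hT z).intervalIntegrable _ _)
  · rw [primitive_apply, h, h0, sub_zero]
  · have hs' : s ∈ Icc 0 T := hsub (Ioo_subset_Icc_self hs)
    rw [IccExtend_of_mem hT z hs']
    exact (hx s hs').hasDerivAt (Icc_mem_nhds hs.1 (hs.2.trans_le t.2.2))

/-! ### Steering the vehicle -/

namespace Vehicle

variable {m : ℕ} (V : Vehicle m)

/-- Since the coordinates contain `2 • q`, each component of `q` is at most `1 / 4`. The squared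
norm is then at most `3 / 16`, well inside the range where the cut-off square root is the true one.
-/
theorem dotProduct_toState_le {y y₀ : I6 ⊕ I6 → ℝ} (h₀ : (toState y₀).2.1 = 0)
    (h : ‖y - y₀‖ < 1 / 2) : (toState y).2.1 ⬝ᵥ (toState y).2.1 ≤ 1 / 2 := by
  have hb : ∀ i, |(toState y).2.1 i| ≤ 1 / 4 := by
    intro i
    have h1 := (norm_le_pi_norm (y - y₀) (Sum.inl (Sum.inr i))).trans h.le
    have h2 : 1 / 2 * y₀ (Sum.inl (Sum.inr i)) = 0 := congrFun h₀ i
    rw [Pi.sub_apply, Real.norm_eq_abs, show y₀ (Sum.inl (Sum.inr i)) = 0 by linarith, sub_zero] at h1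
    change |1 / 2 * y (Sum.inl (Sum.inr i))| ≤ 1 / 4
    rw [abs_mul, abs_of_pos (by norm_num : (0 : ℝ) < 1 / 2)]
    linarith
  have hs : ∀ i, (toState y).2.1 i * (toState y).2.1 i ≤ 1 / 16 := by
    intro i
    rw [← abs_mul_abs_self]
    nlinarith [hb i, abs_nonneg ((toState y).2.1 i)]
  rw [dotProduct, Fin.sum_univ_three]
  linarith [hs 0, hs 1, hs 2]

/-- A solution in coordinates that stays close to a curve with trivial attitude is a trajectory. -/
theorem isTrajectory_toState {T : ℝ} (hT : 0 < T) {y y₀ : ℝ → I6 ⊕ I6 → ℝ} {w w₁ : ℝ → Fin m → ℝ}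
    (hw : ∀ t ∈ Icc 0 T, HasDerivWithinAt w (w₁ t) (Icc 0 T) t)
    (hq : ∀ t ∈ Icc 0 T, (toState (y₀ t)).2.1 = 0) (hclose : ∀ t ∈ Icc 0 T, ‖y t - y₀ t‖ < 1 / 2)
    (hy : ∀ t ∈ Icc 0 T, HasDerivWithinAt y (V.coordField (y t, w t, w₁ t)) (Icc 0 T) t) :
    V.IsTrajectory T w fun t => toState (y t) := by
  intro t ht
  have hle := dotProduct_toState_le (hq t ht) (hclose t ht)
  refine ⟨by linarith, ?_⟩
  rw [(hw t ht).derivWithin (uniqueDiffOn_Icc hT t ht), ← V.toState_coordField hle]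
  exact (LinearMap.toContinuousLinearMap toState).hasFDerivAt.comp_hasDerivWithinAt t (hy t ht)

/-- Steering around a reference trajectory from `0` to `0` along which the linearized system is
controllable by means of the controls `f`. -/
theorem hasC1Steering_of_controllable {T : ℝ} (hT : 0 < T) {w w₁ w₂ : ℝ → Fin m → ℝ}
    (h₁ : ∀ t ∈ Icc 0 T, HasDerivWithinAt w (w₁ t) (Icc 0 T) t)
    (h₂ : ∀ t ∈ Icc 0 T, HasDerivWithinAt w₁ (w₂ t) (Icc 0 T) t) (hc : ContinuousOn w₂ (Icc 0 T))
    (hw0 : w 0 = 0) {f : I6 ⊕ I6 → ℝ → Fin m → ℝ} (hf : ∀ k, ContDiff ℝ ∞ (f k))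
    (hf0 : ∀ k, f k 0 = 0) {y₀ : ℝ → I6 ⊕ I6 → ℝ}
    (hy₀ : ∀ t ∈ Icc 0 T, HasDerivWithinAt y₀ (V.coordField (y₀ t, w t, w₁ t)) (Icc 0 T) t)
    (hy₀0 : y₀ 0 = 0) (hy₀T : y₀ T = 0) (hq : ∀ t ∈ Icc 0 T, (toState (y₀ t)).2.1 = 0)
    (hctl : ∀ e : I6 ⊕ I6 → ℝ, ∃ x : ℝ → I6 ⊕ I6 → ℝ, x 0 = 0 ∧ x T = e ∧
      ∀ t ∈ Icc 0 T, HasDerivWithinAt x (fderiv ℝ V.coordField (y₀ t, w t, w₁ t)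
        (x t, ∑ k, e k • f k t, ∑ k, e k • deriv (f k) t)) (Icc 0 T) t) :
    V.HasC1Steering T := by
  have hwc : ContinuousOn w (Icc 0 T) := fun t ht => (h₁ t ht).continuousWithinAt
  have hw₁c : ContinuousOn w₁ (Icc 0 T) := fun t ht => (h₂ t ht).continuousWithinAt
  have hy₀c : ContinuousOn y₀ (Icc 0 T) := fun t ht => (hy₀ t ht).continuousWithinAt
  have hfd : ∀ k t, HasDerivAt (f k) (deriv (f k) t) t := fun k t =>
    ((hf k).differentiable (by simp) t).hasDerivAt
  have hf' : ∀ k, ContDiff ℝ ∞ (deriv (f k)) := fun k => ((contDiff_infty_iff_deriv).1 (hf k)).2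
  set X₀ : C(Icc 0 T, I6 ⊕ I6 → ℝ) := ⟨fun t => y₀ t, hy₀c.domRestrict⟩ with hX₀
  set c : C(Icc 0 T, (Fin m → ℝ) × (Fin m → ℝ)) :=
    ⟨fun t => (w t, w₁ t), (hwc.prodMk hw₁c).domRestrict⟩ with hcdef
  set inp : I6 ⊕ I6 → C(Icc 0 T, (Fin m → ℝ) × (Fin m → ℝ)) := fun k =>
    ⟨fun t => (f k t, deriv (f k) t), ((hf k).continuous.prodMk (hf' k).continuous).comp
      continuous_subtype_val⟩ with hinp
  -- Perturbations of the control are combinations of the functions `f k`, one for each coordinate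
  -- of the state. The parameter space therefore has the dimension of the state space.
  set L : (I6 ⊕ I6 → ℝ) →L[ℝ] C(Icc 0 T, (Fin m → ℝ) × (Fin m → ℝ)) :=
    ∑ k, (ContinuousLinearMap.proj k : (I6 ⊕ I6 → ℝ) →L[ℝ] ℝ).smulRight (inp k) with hL
  have hLa : ∀ u t, L u t = (∑ k, u k • f k t, ∑ k, u k • deriv (f k) t) := by
    intro u t
    have : L u = ∑ k, u k • inp k := by simp [hL]
    rw [this, ContinuousMap.sum_apply, Prod.ext_iff, Prod.fst_sum, Prod.snd_sum]
    exact ⟨rfl, rfl⟩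
  obtain ⟨Φ, hΦc, hΦ0, hΦ⟩ := exists_steering hT.le V.contDiff_coordField X₀ c L
    (by
      ext1 t
      exact eq_primitive_of_hasDerivWithinAt hT.le _ hy₀0 (fun t ht => by
        rw [ContinuousMap.comp_apply, prodMkMap_apply]
        exact hy₀ t ht) t)
    hy₀T rfl
    (by
      intro e
      obtain ⟨x, hx0, hxT, hx⟩ := hctl e
      have hxc : ContinuousOn x (Icc 0 T) := fun t ht => (hx t ht).continuousWithinAt
      refine ⟨e, ⟨fun t => x t, hxc.domRestrict⟩, ?_, hxT⟩
      ext1 t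
      refine eq_primitive_of_hasDerivWithinAt hT.le _ hx0 (fun t ht => ?_) t
      rw [pointwiseApply_apply, ContinuousMap.comp_apply, prodMkMap_apply, prodMkMap_apply, hLa]
      exact hx t ht)
  obtain ⟨u₀, hu₀⟩ := exists_H2 hT.le h₁ h₂ hc
  have huk : ∀ k, ∃ u : H2 T m,
      ∀ᵐ t ∂(volume.restrict (Ioo 0 T)), u.1 0 t = WithLp.toLp 2 (f k t) := fun k =>
    exists_H2 hT.le (fun t _ => (hfd k t).hasDerivWithinAt)
      (fun t _ => ((hf' k).differentiable (by simp) t).hasDerivAt.hasDerivWithinAt)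
      ((hf' k).of_le (m := 1) (by norm_cast)).continuous_deriv_one.continuousOn
  choose u hu using huk
  set data : State × State → (I6 ⊕ I6 → ℝ) × (I6 ⊕ I6 → ℝ) :=
    fun p => (ofState p.1, ofState p.2) with hdata
  have hdc : ContDiff ℝ 1 data :=
    (contDiff_ofState.comp contDiff_fst).prodMk (contDiff_ofState.comp contDiff_snd)
  have hd0 : data 0 = (0, 0) := by simp [hdata]
  have hcomp : ContDiffAt ℝ 1 (fun p => Φ (data p)) 0 := by
    refine ContDiffAt.comp _ ?_ hdc.contDiffAt
    rw [hd0]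
    exact hΦc
  -- The map into `H²` is affine in finitely many coefficients, so it inherits their `C¹`
  -- regularity; no calculus in the Sobolev space is needed.
  set Ψ : State × State → H2 T m := fun p => u₀ + ∑ k, (Φ (data p)).2 k • u k with hΨ
  have hΨc : ContDiffAt ℝ 1 Ψ 0 := by
    refine contDiffAt_const.add (ContDiffAt.sum fun k _ => ?_)
    exact (contDiffAt_pi.1 hcomp.snd k).smul (contDiffAt_const (c := u k))
  obtain ⟨S, hS, hΨS⟩ := hΨc.contDiffOn le_rfl (by simp)
  -- Trajectories uniformly close to the reference one keep a small attitude, so the field with the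
  -- cut-off is the original field along them.
  have hclose : ∀ᶠ p in 𝓝 (0 : State × State), ‖(Φ (data p)).1 - X₀‖ < 1 / 2 := by
    have h1 : ContinuousAt (fun p => (Φ (data p)).1) 0 := hcomp.continuousAt.fst
    have h2 := (h1.sub (continuousAt_const (y := X₀))).norm
    refine h2.eventually_lt continuousAt_const ?_
    simp [hd0, hΦ0]
  have hev : ∀ᶠ p in 𝓝 (0 : State × State), p ∈ S ∧ V.Steers T (Ψ p) p.1 p.2 := by
    have h1 := hdc.continuous.tendsto 0
    rw [hd0] at h1
    filter_upwards [h1.eventually hΦ, hclose, by simpa using hS] with p hp hpc hpS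
    refine ⟨hpS, ?_⟩
    obtain ⟨hpe, hpT⟩ := hp
    set v := (Φ (data p)).2 with hv
    set X := (Φ (data p)).1 with hX
    have hder : ∀ t ∈ Icc 0 T, HasDerivWithinAt (fun t => w t + ∑ k, v k • f k t)
        (w₁ t + ∑ k, v k • deriv (f k) t) (Icc 0 T) t := fun t ht =>
      (h₁ t ht).add (HasDerivWithinAt.fun_sum fun k _ => (hfd k t).hasDerivWithinAt.const_smul (v k))
    have hderc : ContinuousOn (fun t => w₁ t + ∑ k, v k • deriv (f k) t) (Icc 0 T) :=
      hw₁c.add (continuous_finsetSum _ fun k _ =>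
        (hf' k).continuous.const_smul (v k)).continuousOn
    refine ⟨fun t => w t + ∑ k, v k • f k t,
      ⟨contDiffOn_one_of_hasDerivWithinAt hT hder hderc, coeFn_H2_add_sum _ v hu₀ hu⟩, ?_,
      fun t => toState (IccExtend hT.le X t), V.isTrajectory_toState (y₀ := y₀) hT hder hq ?_ ?_,
      ?_, ?_⟩
    · simp [hw0, hf0]
    · intro t ht
      rw [IccExtend_of_mem hT.le X ht]
      exact (ContinuousMap.norm_coe_le_norm (X - X₀) ⟨t, ht⟩).trans_lt hpc
    · intro t ht
      have h := hasDerivWithinAt_of_eq_primitive hT.le hpe t ht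
      rw [ContinuousMap.comp_apply, prodMkMap_apply, ContinuousMap.add_apply, hLa,
        ← IccExtend_of_mem hT.le X ht] at h
      exact h
    · beta_reduce
      rw [IccExtend_of_mem hT.le X ⟨le_rfl, hT.le⟩, hpe, primitive_zero, add_zero]
      exact toState_ofState p.1
    · beta_reduce
      rw [IccExtend_of_mem hT.le X ⟨hT.le, le_rfl⟩]
      rw [endEval_apply] at hpT
      rw [hpT]
      exact toState_ofState p.2
  obtain ⟨η, hη, hball⟩ := Metric.eventually_nhds_iff_ball.1 hev
  exact ⟨η, hη, Ψ, hΨS.mono fun p hp => (hball p hp).1, fun p hp => (hball p hp).2⟩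

theorem HasC1Steering.locallyControllable {V : Vehicle m} {T : ℝ} (h : V.HasC1Steering T) :
    V.LocallyControllable T := by
  obtain ⟨η, hη, Φ, -, hΦ⟩ := h
  refine ⟨η, hη, fun x₀ x₁ h₀ h₁ => ⟨Φ (x₀, x₁), hΦ (x₀, x₁) ?_⟩⟩
  rw [mem_ball_zero_iff, Prod.norm_def]
  exact max_lt h₀ h₁

end Vehicle

theorem exists_isCutoff {T : ℝ} (hT : 0 < T) : ∃ ξ, IsCutoff T ξ := by
  refine ⟨fun t => Real.smoothTransition ((3 * t - T) / T),
    Real.smoothTransition.contDiff.comp (by fun_prop),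
    fun t => ⟨Real.smoothTransition.nonneg _, Real.smoothTransition.le_one _⟩, fun t ht => ?_,
    fun t ht => ?_⟩
  · exact Real.smoothTransition.zero_of_nonpos (div_nonpos_of_nonpos_of_nonneg (by linarith) hT.le)
  · refine Real.smoothTransition.one_of_one_le ?_
    rw [le_div_iff₀ hT]
    linarith

theorem hasDerivWithinAt_refCoord {h l : ℝ → ℝ} {h' l' : ℝ} {s : Set ℝ} {t : ℝ}
    (hh : HasDerivWithinAt h h' s t) (hl : HasDerivWithinAt l l' s t) :
    HasDerivWithinAt (fun t => Vehicle.refCoord (h t) (l t)) (Vehicle.refCoord h' l') s t := by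
  refine hasDerivWithinAt_pi.2 ?_
  rintro ((i | i) | (i | i))
  · exact hh.mul_const (e1 i)
  · exact hasDerivWithinAt_const t s 0
  · exact hl.mul_const (e1 i)
  · exact hasDerivWithinAt_const t s 0

namespace Vehicle

variable {m : ℕ} [NeZero m] (V : Vehicle m)

theorem refCoord_zero : refCoord 0 0 = 0 := by
  rw [refCoord, refVelocity_zero]
  ext (i | i) <;> rfl

theorem hasDerivWithinAt_refControl {w : ℝ → ℝ} {w' : ℝ} {s : Set ℝ} {t : ℝ}
    (hw : HasDerivWithinAt w w' s t) :
    HasDerivWithinAt (fun t => (refControl (w t) : Fin m → ℝ)) (refControl w') s t := by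
  simp only [refControl_eq (m := m) (w _), refControl_eq (m := m) w']
  exact hw.smul_const _

/-- Steering around the reference trajectory. -/
theorem SymmetricEntries.hasC1Steering {V : Vehicle m} (hV : V.SymmetricEntries) (hα : V.α ≠ 0)
    {T : ℝ} (hT : 0 < T) {ξ : ℝ → ℝ} (hξ : IsCutoff T ξ) {lam : ℝ} {w : ℝ → ℝ}
    (hw : V.IsReferenceControl T ξ lam w) {l'' w'' : ℝ}
    (hl'' : HasDerivWithinAt (deriv (lbar T ξ lam)) l'' (Icc 0 T) T)
    (hw'' : HasDerivWithinAt (V.refRate T ξ lam w) w'' (Icc 0 T) T)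
    (hspan : V.SpansAt (lbar T ξ lam T) (w T) (deriv (lbar T ξ lam) T) (V.refRate T ξ lam w T)
      l'' w'') : V.HasC1Steering T := by
  set l := lbar T ξ lam with hl
  set dl := deriv l with hdl
  set dw := V.refRate T ξ lam w with hdw
  have hl' : ∀ t ∈ Icc 0 T, HasDerivWithinAt l (dl t) (Icc 0 T) t := fun t _ =>
    (hξ.hasDerivAt_lbar lam t).hasDerivWithinAt
  have hw' : ∀ t ∈ Icc 0 T, HasDerivWithinAt w (dw t) (Icc 0 T) t := hw.2
  have hlc : Continuous l := (hξ.contDiff_lbar lam).continuous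
  have hdlc : ContDiff ℝ ∞ dl := ((contDiff_infty_iff_deriv).1 (hξ.contDiff_lbar lam)).2
  have hddlc : Continuous (deriv dl) := ((contDiff_infty_iff_deriv).1 hdlc).2.continuous
  have hwc := hw.continuousOn
  have hdwc : ContinuousOn dw (Icc 0 T) := fun t ht =>
    (hw.hasDerivWithinAt_refRate hξ ht).continuousWithinAt
  have hcalA : ContinuousOn (fun t => V.calA (l t) (w t)) (Icc 0 T) := by
    simp only [calA_eq V (l _)]
    have := hlc.continuousOn (s := Icc 0 T)
    fun_prop
  have hcalB : ContinuousOn (fun t => V.calB (l t) (w t)) (Icc 0 T) := by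
    simp only [calB_eq V (l _)]
    have := hlc.continuousOn (s := Icc 0 T)
    fun_prop
  have hctl := exists_linearSteers_of_span hT (A := fun t => V.calA (l t) (w t))
    (B := fun t => V.calB (l t) (w t)) (R := V.calC) (N₀ := fun t => V.brk₀ (l t) (w t))
    (N₁ := fun t => V.brk₁ (l t) (w t) (dl t) (dw t))
    (N₂ := V.brk₂ (l T) (w T) (dl T) (dw T) l'' w'') hcalA hcalB
    (fun t _ => (V.brk₀_eq (l t) (w t)).symm)
    (fun t ht a b => by
      rw [brk₁, sub_add_cancel]
      exact hasDerivWithinAt_brk₀ (hl' t ht) (hw' t ht) a b)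
    (fun a b => by
      have hTm : T ∈ Icc 0 T := ⟨hT.le, le_rfl⟩
      rw [brk₂, sub_add_cancel]
      exact hasDerivWithinAt_brk₁ (hl' T hTm) (hw' T hTm) hl'' hw'' a b)
    hspan
  -- Controls that reach the basis vectors; by linearity their combinations reach every state.
  choose f hf using fun k : I6 ⊕ I6 => hctl (Pi.single k 1)
  refine V.hasC1Steering_of_controllable hT (w := fun t => refControl (w t))
    (w₁ := fun t => refControl (dw t)) (w₂ := fun t => refControl
      (V.α⁻¹ * (deriv dl t - V.β * (dl t * w t + l t * dw t) - 2 * V.γ * w t * dw t)))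
    (fun t ht => hasDerivWithinAt_refControl (hw' t ht))
    (fun t ht => hasDerivWithinAt_refControl (hw.hasDerivWithinAt_refRate hξ ht)) ?_ ?_
    (fun k => (hf k).1) (fun k => (hf k).2.1) (y₀ := fun t => refCoord (hbar T ξ lam t) (l t))
    (fun t ht => ?_) ?_ ?_ (fun t _ => by rw [toState_refCoord]) fun e => ?_
  · simp only [refControl_eq (m := m) (_ * _)]
    have := hlc.continuousOn (s := Icc 0 T)
    have := hdlc.continuous.continuousOn (s := Icc 0 T)
    have := hddlc.continuousOn (s := Icc 0 T)
    fun_prop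
  · simp [hw.1, refControl]
  · rw [hdw, refRate, hV.coordField_ref hα]
    exact hasDerivWithinAt_refCoord (hξ.hasDerivAt_hbar lam t).hasDerivWithinAt (hl' t ht)
  · simp only [hl, hξ.hbar_of_lt lam (show 0 < T / 3 by linarith),
      hξ.lbar_of_lt lam (show 0 < T / 3 by linarith), refCoord_zero]
  -- The loop closes: the factor `(t - T) ^ 2` of the position vanishes to second order at the final
  -- time.
  · have h1 : l T = 0 := by rw [hl, hξ.lbar_of_gt lam (by linarith), sub_self, mul_zero]
    simp only [h1, hbar, sub_self, ne_eq, OfNat.ofNat_ne_zero, not_false_eq_true, zero_pow,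
      mul_zero, refCoord_zero]
  · obtain ⟨-, -, x, hx0, hxT, hx⟩ := LinearSteers.sum Finset.univ e hf
    refine ⟨x, hx0, ?_, fun t ht => ?_⟩
    · rw [hxT]
      exact (pi_eq_sum_univ' e).symm
    · rw [fderiv_coordField]
      refine (hx t ht).congr_deriv ?_
      have h1 : (∑ k, e k • f k) t = ∑ k, e k • f k t := by simp
      have h2 : deriv (∑ k, e k • f k) t = ∑ k, e k • deriv (f k) t := by
        rw [deriv_sum fun k _ => (((hf k).1.differentiable (by simp) t).const_smul (e k))]
        exact Finset.sum_congr rfl fun k _ =>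
          deriv_const_smul (e k) ((hf k).1.differentiable (by simp) t)
      rw [h1, h2]

end Vehicle

end Underwater
end

/-! ### Assembly of the three assertions -/

theorem corollary1 {m : ℕ} [NeZero m] (V : Underwater.Vehicle m)
    (hΩ : ∀ p : Fin 3, p = 1 ∨ p = 2 → Underwater.reflect p '' V.fluid = V.fluid)
    (hχ : ∀ p : Fin 3, p = 1 ∨ p = 2 →
      ∀ y ∈ frontier V.fluid, V.χ 0 (Underwater.reflect p y) = V.χ 0 y)
    (hα : V.α ≠ 0)
    (hrank₁ : (Matrix.fromCols V.C (V.boldB + V.boldA * V.JJ⁻¹ * V.C)).rank = 6)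
    (hrank₂ : (Matrix.fromCols V.C
      ((1 / 2 : ℝ) • (V.JJ * V.boldD * V.JJ⁻¹ * V.C) + V.boldB + V.boldA * V.JJ⁻¹ * V.C)).rank = 6) :
    ∀ T : ℝ, 0 < T →
      (∀ ξ : ℝ → ℝ, Underwater.IsCutoff T ξ →
        ∃ lam₀ > 0, ∀ lam : ℝ, lam ≠ 0 → (V.γ + V.α * V.β = 0 ∨ |lam| ≤ lam₀) →
          (∃ w : ℝ → ℝ, V.IsReferenceControl T ξ lam w) ∧
          ∀ w : ℝ → ℝ, V.IsReferenceControl T ξ lam w →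
            V.RankCondition T (Underwater.lbar T ξ lam) w) ∧
      V.LocallyControllable T ∧
      V.HasC1Steering T := by
  intro T hT
  have hV := V.symmetricEntries hΩ hχ
  have hend := hV.endMatrix_zero_zero hα hrank₁ hrank₂
  -- One loop is enough for steering: any cut-off, with amplitude `lam₀` itself.
  have hsteer : V.HasC1Steering T := by
    obtain ⟨ξ, hξ⟩ := Underwater.exists_isCutoff hT
    obtain ⟨lam₀, hlam₀, h⟩ := V.exists_spansAt hα hT hξ hend
    obtain ⟨w, hw, l'', w'', hl'', hw'', hspan⟩ :=
      h lam₀ hlam₀.ne' (Or.inr (abs_of_pos hlam₀).le)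
    exact hV.hasC1Steering hα hT hξ hw hl'' hw'' hspan
  exact ⟨fun ξ hξ => V.exists_rankCondition hα hT hξ hend, hsteer.locallyControllable, hsteer⟩
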